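/- **The KAM Step.** Let $n\ge 2$ and $\tau>n-1$, and put $\nu=\tau+1$. There is a constant $c\ge 1$, depending only on $n$ and $\tau$, with the following property. *Setting.* All norms $|\cdot|$ of vectors are sup-norms and norms of matrices are the induced operator norms, except that $|k|=|k_1|+\dots+|k_n|$ for $k\in\mathbb Z^n$. Let $\Omega\subset\mathbb R^n$ be open, $\alpha>0$, and let $\Omega_\alpha$ be the set of all $\omega\in\Omega$ that have distance at least $\alpha$ to the boundary of $\Omega$ and satisfy $|\langle k,\omega\rangle|\ge\alpha/|k|^\tau$ for all $0\ne k\in\mathbb Z^n$. For $r,s,h>0$ let $$D_{r,s}=\{I:|I|<r\}\times\{\theta:|\Im\theta|<s\}\subset\mathbb C^n\times\mathbb C^n,\qquad O_h=\{\omega:|\omega-\Omega_\alpha|<h\}\subset\mathbb C^n,$$ and let $|\cdot|_{r,s,h}$ be the sup-norm over $D_{r,s}\times O_h$. Real analytic means holomorphic on the given complex domain and real at real arguments. Hamiltonians on $D_{r,s}\times O_h$ are real analytic and $2\pi$-periodic in each component of $\theta$. Let $\mathcal G$ denote the group of injective real analytic transformations $(I,\theta,\omega)\mapsto(U(I,\theta,\omega),V(\theta,\omega),\varphi(\omega))$,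 with $U$ affine in $I$, that are symplectic in $(I,\theta)$ for each $\omega$ and commute with the translations $\theta\mapsto\theta+2\pi k$, $k\in\mathbb Z^n$. *Assumptions.* Let $H=N+P$, where $N=e(\omega)+\langle\omega,I\rangle$ is a normal form with $e$ real analytic on $O_h$, and $P$ is a Hamiltonian on $D_{r,s}\times O_h$. Suppose $|P|_{r,s,h}\le\epsilon$ with $$\text{(a)}\ \ c\,\epsilon\le\alpha\eta r\sigma^\nu,\qquad \text{(b)}\ \ c\,\epsilon\le hr,\qquad \text{(c)}\ \ h\le\frac{\alpha}{2K^\nu}$$ for some $0<\eta<1/8$, $0<\sigma<s/5$ and $K\ge1$. *Conclusion.* There exist a Hamiltonian $F$ on $D_{r/2,s-3\sigma}\times O_h$ which is affine in $I$, a real analytic map $\Phi$ from $D_{\eta r,s-5\sigma}\times O_h$ to $\mathbb C^n\times\mathbb C^n$, and a real analytic map $\varphi:O_{h/4}\to O_h$, such that the following holds. 1. For each $\omega\in O_h$, $\Phi(\cdot,\omega)$ is the time-1-map of the flow of $\dot I=-F_\theta,\ \dot\theta=F_I$ on $D_{\eta r,s-5\sigma}$, and the orbits involved stay in $D_{r/2,s-3\sigma}$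 for times in $[0,1]$. 2. The map $\mathcal F(I,\theta,\omega)=(\Phi(I,\theta,\varphi(\omega)),\varphi(\omega))$ is a real analytic transformation in the group $\mathcal G$, and maps $D_{\eta r,s-5\sigma}\times O_{h/4}$ into $D_{r,s}\times O_h$. 3. On $D_{\eta r,s-5\sigma}\times O_{h/4}$ one has $H\circ\mathcal F=N_++P_+$, where $N_+=e_+(\omega)+\langle\omega,I\rangle$ is a normal form with $e_+$ real analytic on $O_{h/4}$, and $P_+$ is a Hamiltonian with $$|P_+|_{\eta r,s-5\sigma,h/4}\le c\left(\frac{\epsilon^2}{\alpha r\sigma^\nu}+(\eta^2+K^ne^{-K\sigma})\,\epsilon\right).$$ 4. With the weight matrix $W=\operatorname{diag}(r^{-1}\mathrm{Id},\sigma^{-1}\mathrm{Id})$, and $D\Phi$ the Jacobian with respect to $(I,\theta)$, $$|W(\Phi-\mathrm{id})|,\ |W(D\Phi-\mathrm{Id})W^{-1}|\le\frac{c\,\epsilon}{\alpha r\sigma^\nu}\quad\text{on }D_{\eta r,s-5\sigma}\times O_h,$$ $$|\varphi-\mathrm{id}|,\ h\,|D\varphi-\mathrm{Id}|\le\frac{c\,\epsilon}{r}\quad\text{on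 }O_{h/4}.$$ -/

import Mathlib

namespace KAM

/-- `ℂⁿ`, with the sup-norm. -/
abbrev CVec (n : ℕ) : Type := Fin n → ℂ

/-- Phase space points `(I, θ) ∈ ℂⁿ × ℂⁿ`, with the sup-norm. The angles `θ` are coordinates on
the universal cover; functions on the torus are `2π`-periodic in each `θ_j`. -/
abbrev Phase (n : ℕ) : Type := CVec n × CVec n

/-- `|k| = |k₁| + ⋯ + |kₙ|` for an integer vector. -/
def intNorm {n : ℕ} (k : Fin n → ℤ) : ℝ := ∑ j, |(k j : ℝ)|

/-- The set `Δ_α^τ` of all real `ω` with `|⟨k, ω⟩| ≥ α / |k|^τ` for all nonzero integer `k`. -/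
def diophantineSet (n : ℕ) (α τ : ℝ) : Set (Fin n → ℝ) :=
  {ω | ∀ k : Fin n → ℤ, k ≠ 0 → α / intNorm k ^ τ ≤ |∑ j, (k j : ℝ) * ω j|}

/-- `Ω_α`: the points of `Ω` that lie in `Δ_α^τ` and have distance at least `α` to the boundary
of `Ω`. -/
def frequencySet {n : ℕ} (Ω : Set (Fin n → ℝ)) (α τ : ℝ) : Set (Fin n → ℝ) :=
  {ω | ω ∈ Ω ∧ ω ∈ diophantineSet n α τ ∧ ∀ y ∈ frontier Ω, α ≤ dist ω y}

/-- `D_{r,s} = {|I| < r} × {|Im θ| < s}`. -/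
def phaseDomain (n : ℕ) (r s : ℝ) : Set (Phase n) :=
  {z | (∀ j, ‖z.1 j‖ < r) ∧ ∀ j, |(z.2 j).im| < s}

/-- The complex neighbourhood of radius `h`, in the sup-norm, of a set of real vectors. -/
def complexNhd {n : ℕ} (A : Set (Fin n → ℝ)) (h : ℝ) : Set (CVec n) :=
  {ω | ∃ ω₀ ∈ A, ‖ω - (fun j => (ω₀ j : ℂ))‖ < h}

/-- Real analytic on a complex domain: holomorphic, and real at real points. Here `star` is
coordinatewise complex conjugation, so that `star z = z` says that `z` is real. -/
def RealAnalyticOn {E F : Type*} [NormedAddCommGroup E] [NormedSpace ℂ E] [Star E]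
    [NormedAddCommGroup F] [NormedSpace ℂ F] [Star F] (f : E → F) (S : Set E) : Prop :=
  AnalyticOnNhd ℂ f S ∧ ∀ z ∈ S, star z = z → star (f z) = f z

/-- The translation vector `2πk` of the angles. -/
noncomputable def angleShift {n : ℕ} (k : Fin n → ℤ) : CVec n :=
  fun j => ((2 * Real.pi * (k j : ℝ) : ℝ) : ℂ)

/-- A real analytic function of `(I, θ, ω) ∈ D × O` that is `2π`-periodic in each angle. -/
structure IsHamiltonianOn {n : ℕ} (f : Phase n × CVec n → ℂ) (D : Set (Phase n))
    (O : Set (CVec n)) : Prop where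
  realAnalytic : RealAnalyticOn f (D ×ˢ O)
  periodic : ∀ (I θ ω : CVec n) (k : Fin n → ℤ), (I, θ) ∈ D → ω ∈ O →
    f ((I, θ + angleShift k), ω) = f ((I, θ), ω)

/-- The normal form `N = e(ω) + ⟨ω, I⟩`. -/
def normalForm {n : ℕ} (e : CVec n → ℂ) (z : Phase n × CVec n) : ℂ :=
  e z.2 + ∑ j, z.2 j * z.1.1 j

/-- `f` is affine in `I` on `D × O`. -/
def AffineInAction {n : ℕ} (f : Phase n × CVec n → ℂ) (D : Set (Phase n))
    (O : Set (CVec n)) : Prop :=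
  ∃ (a : CVec n → CVec n → ℂ) (b : CVec n → CVec n → CVec n),
    ∀ I θ ω : CVec n, (I, θ) ∈ D → ω ∈ O → f ((I, θ), ω) = a θ ω + ∑ j, b θ ω j * I j

/-- The hamiltonian vector field `X_f = (-f_θ, f_I)` at the parameter value `ω`. -/
noncomputable def hamVectorField {n : ℕ} (f : Phase n × CVec n → ℂ) (ω : CVec n)
    (z : Phase n) : Phase n :=
  (fun j => -(fderiv ℂ (fun w : Phase n => f (w, ω)) z (0, Pi.single j 1)),
   fun j => fderiv ℂ (fun w : Phase n => f (w, ω)) z (Pi.single j 1, 0))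

/-- On `D × O`, `Φ` is the time-1-map of the flow of the hamiltonian vector field of `f`, where
the orbits for times in `[0, 1]` stay in the set `D'`. -/
def IsTimeOneMap {n : ℕ} (f : Phase n × CVec n → ℂ) (Φ : Phase n × CVec n → Phase n)
    (D D' : Set (Phase n)) (O : Set (CVec n)) : Prop :=
  ∀ z ∈ D, ∀ ω ∈ O, ∃ γ : ℝ → Phase n,
    γ 0 = z ∧ γ 1 = Φ (z, ω) ∧
    ∀ t ∈ Set.Icc (0 : ℝ) 1, γ t ∈ D' ∧
      HasDerivWithinAt γ (hamVectorField f ω (γ t)) (Set.Icc (0 : ℝ) 1) t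

/-- The standard symplectic form `∑ dI_j ∧ dθ_j`. -/
def symplecticForm {n : ℕ} (u v : Phase n) : ℂ :=
  ∑ j, (u.1 j * v.2 j - u.2 j * v.1 j)

/-- `T` is a transformation in the group `𝒢`, with domain `D × O`: an injective real analytic map
`(I, θ, ω) ↦ (U(I, θ, ω), V(θ, ω), φ(ω))` with `U` affine in `I`, symplectic in `(I, θ)` for
each `ω`, which is the lift of a map homotopic to the identity on the torus. -/
structure IsGroupTransformation {n : ℕ} (T : Phase n × CVec n → Phase n × CVec n)
    (D : Set (Phase n)) (O : Set (CVec n)) : Prop where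
  realAnalytic : RealAnalyticOn T (D ×ˢ O)
  injOn : Set.InjOn T (D ×ˢ O)
  shape : ∃ (a : CVec n → CVec n → CVec n) (A : CVec n → CVec n → Matrix (Fin n) (Fin n) ℂ)
      (V : CVec n → CVec n → CVec n) (φ : CVec n → CVec n),
    ∀ I θ ω : CVec n, (I, θ) ∈ D → ω ∈ O →
      T ((I, θ), ω) = ((a θ ω + (A θ ω).mulVec I, V θ ω), φ ω)
  equivariant : ∀ (I θ ω : CVec n) (k : Fin n → ℤ), (I, θ) ∈ D → ω ∈ O →
    T ((I, θ + angleShift k), ω) = T ((I, θ), ω) + ((0, angleShift k), 0)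
  symplectic : ∀ z ∈ D, ∀ ω ∈ O, ∀ u v : Phase n,
    symplecticForm (fderiv ℂ (fun w : Phase n => (T (w, ω)).1) z u)
      (fderiv ℂ (fun w : Phase n => (T (w, ω)).1) z v) = symplecticForm u v

/-- The transformation `(I, θ, ω) ↦ (Φ(I, θ, φ(ω)), φ(ω))` of coordinates and parameters, composed
of a family `Φ` of coordinate changes and a change `φ` of the parameters. -/
def coordParamMap {n : ℕ} (Φ : Phase n × CVec n → Phase n) (φ : CVec n → CVec n)
    (z : Phase n × CVec n) : Phase n × CVec n :=
  (Φ (z.1, φ z.2), φ z.2)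

/-- The weight matrix `W = diag(r⁻¹ Id, σ⁻¹ Id)` on phase space. Its inverse is
`weight n r⁻¹ σ⁻¹`. -/
noncomputable def weight (n : ℕ) (r σ : ℝ) : Phase n →L[ℂ] Phase n :=
  (((r⁻¹ : ℝ) : ℂ) • ContinuousLinearMap.id ℂ (CVec n)).prodMap
    (((σ⁻¹ : ℝ) : ℂ) • ContinuousLinearMap.id ℂ (CVec n))

end KAM

/-! The step is one Newton iteration for conjugating `H` to normal form. For actions of size `2ηr`,
`P` differs from its part affine in `I` by `O(η²ε)`, and that part differs from its Fourier
truncation `R` to `|k| ≤ K` by `O(Kⁿ e^{-Kσ} ε)`. The generator `F` solves the homological equation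
`∑ ω_j ∂F/∂θ_j = R - R₀`, where `R₀` is the angular mean of `R`; its `k`-th coefficient is that of
`R` divided by `i⟨k, ω⟩`. Along the flow of `F` the function `⟨ω, I⟩` changes at the rate `-(R -
R₀)`, so after time one the sum `⟨ω, I⟩ + R` has become `⟨ω, I⟩ + R₀`, up to the oscillation of `R`
and `R₀` along the orbit, which is quadratic in `ε` (`norm_linear_add_sub_le`). Since `R₀ = a(ω) +
⟨b(ω), I⟩` is affine in `I` and free of angles, it is absorbed by the new normal form once the
frequencies are changed by the inverse `φ` of `ω ↦ ω + b(ω)` (`exists_freqMap`).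

The exponent `ν = τ + 1` requires `|F| ≤ C ε / (α σ^τ)`, without a further loss depending on `n`.
Termwise estimates do not give this. Instead, Parseval's identity on tori shifted into the complex
strip bounds a weighted `ℓ²` norm of the Fourier coefficients (`IsStripFun.sum_sq_exp_le`). The
Diophantine condition applied to differences `k - l` separates the small divisors from each other,
so that the sum of their inverse squares is as small as its largest term (`sum_inv_sq_divisor_le`).
Cauchy–Schwarz combines both (`IsStripFun.norm_homological_le`). Condition (c) carries the divisor
bounds over to complex frequencies.

The flow is constructed as a fixed point in the Banach space of continuous curves on `[0, 1]`. It is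
analytic in the initial value and in `ω` because a uniform contraction depending analytically on
parameters has an analytic fixed point (`exists_analytic_fixedPoint`). As `F` is affine in `I`, the
angle equation is closed, and the action equation is affine along a given angle curve. Uniqueness of
the fixed points then yields affinity in `I`, periodicity and reality; differentiating the integral
equation yields symplecticity. Cauchy estimates in the weighted norm bound `DΦ` and give
injectivity.

If `Kⁿ e^{-Kσ} ≥ e^{-1}`, the asserted bound on the new perturbation is weaker than `ε` and the
identity transformation suffices. Otherwise `Kσ ≥ 1`, which turns powers of `1/σ` in the truncation
error into powers of `K`. -/

namespace KAM

open Metric Set Filter Topology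
open scoped ContDiff
-- Cauchy estimates and Taylor remainders without dimensional constants
section Cauchy

variable {E F : Type*} [NormedAddCommGroup E] [NormedSpace ℂ E] [NormedAddCommGroup F]
  [NormedSpace ℂ F]

/-- Schwarz lemma: the values lie in the ball of radius `2 * M` about `f c`. Working with the norm
ball directly avoids any constant depending on the number of variables. -/
theorem norm_fderiv_le_of_norm_le {f : E → F} {c : E} {ρ M : ℝ} (hρ : 0 < ρ)
    (hd : DifferentiableOn ℂ f (ball c ρ)) (hM : ∀ x ∈ ball c ρ, ‖f x‖ ≤ M) :
    ‖fderiv ℂ f c‖ ≤ 2 * M / ρ := by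
  refine Complex.norm_fderiv_le_div_of_mapsTo_ball hd (fun x hx => ?_) hρ
  rw [mem_closedBall, dist_eq_norm]
  have h1 := hM x hx
  have h2 := hM c (mem_ball_self hρ)
  linarith [norm_sub_le (f x) (f c)]

/-- The first-order remainder is bounded by `4 * M` and is `o(‖x - c‖)` at the centre, so the higher
order Schwarz lemma makes it quadratic on the whole ball. This produces the `η²` term of the final
estimate. -/
theorem norm_sub_sub_fderiv_le {f : E → F} {c x : E} {ρ M : ℝ}
    (hd : DifferentiableOn ℂ f (ball c ρ)) (hM : ∀ x ∈ ball c ρ, ‖f x‖ ≤ M) (hx : x ∈ ball c ρ) :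
    ‖f x - f c - fderiv ℂ f c (x - c)‖ ≤ 4 * M * (‖x - c‖ / ρ) ^ 2 := by
  have hρ : 0 < ρ := nonempty_ball.1 ⟨x, hx⟩
  have hc : HasFDerivAt f (fderiv ℂ f c) c :=
    ((hd c (mem_ball_self hρ)).differentiableAt (ball_mem_nhds c hρ)).hasFDerivAt
  have hb := norm_fderiv_le_of_norm_le hρ hd hM
  have key := Complex.dist_le_mul_div_pow_of_mapsTo_ball_of_isLittleO (n := 1) (c := c) (z := x)
    (R₁ := ρ) (R₂ := 4 * M) (f := fun y => f y - f c - fderiv ℂ f c (y - c)) ?_ ?_ ?_ hx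
  · simpa [dist_eq_norm] using key
  · exact ((hd.sub_const _).sub (by fun_prop))
  · intro y hy
    rw [mem_closedBall, dist_eq_norm]
    have h1 := hM y hy
    have h2 := hM c (mem_ball_self hρ)
    have h3 : ‖fderiv ℂ f c (y - c)‖ ≤ 2 * M / ρ * ρ := by
      refine (ContinuousLinearMap.le_opNorm _ _).trans ?_
      have : ‖y - c‖ ≤ ρ := by rw [← dist_eq_norm]; exact (mem_ball.1 hy).le
      have h4 : 0 ≤ M := (norm_nonneg _).trans h2
      gcongr
    rw [div_mul_cancel₀ _ hρ.ne'] at h3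
    simp only [sub_self, map_zero, sub_zero]
    calc _ ≤ ‖f y - f c‖ + ‖fderiv ℂ f c (y - c)‖ := norm_sub_le _ _
      _ ≤ ‖f y‖ + ‖f c‖ + ‖fderiv ℂ f c (y - c)‖ := by gcongr; exact norm_sub_le _ _
      _ ≤ 4 * M := by linarith
  · simpa using hc.isLittleO.norm_right

end Cauchy

/-! ### Contractions and analytic dependence of their fixed points -/

section FixedPoint

theorem eq_of_contraction {E : Type*} [NormedAddCommGroup E] {T : E → E} {x y : E} {q : ℝ} (hq : q < 1)
    (h : ‖T x - T y‖ ≤ q * ‖x - y‖) (hx : T x = x) (hy : T y = y) : x = y := by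
  rw [hx, hy] at h
  have : ‖x - y‖ ≤ 0 := by nlinarith [norm_nonneg (x - y)]
  exact sub_eq_zero.1 (norm_le_zero_iff.1 this)

/-- The open ball is not complete, but `T` preserves the closed ball of radius `‖T c - c‖ / (1 -
q)`, which is smaller than `ρ` by the strict inequality `h0`. -/
theorem exists_fixedPoint_mem_ball {E : Type*} [NormedAddCommGroup E] [CompleteSpace E]
    {T : E → E} {c : E} {ρ q : ℝ} (hq : 0 ≤ q) (hq1 : q < 1)
    (hL : ∀ x ∈ ball c ρ, ∀ y ∈ ball c ρ, ‖T x - T y‖ ≤ q * ‖x - y‖)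
    (h0 : ‖T c - c‖ < (1 - q) * ρ) : ∃ x ∈ ball c ρ, T x = x := by
  have hq' : 0 < 1 - q := by linarith
  set R := ‖T c - c‖ / (1 - q) with hR
  have hR0 : 0 ≤ R := by positivity
  have hRρ : R < ρ := by rw [hR, div_lt_iff₀ hq']; linarith
  have hsub : closedBall c R ⊆ ball c ρ := closedBall_subset_ball hRρ
  have hcc : c ∈ closedBall c R := mem_closedBall_self hR0
  have hmaps : MapsTo T (closedBall c R) (closedBall c R) := by
    intro x hx
    rw [mem_closedBall, dist_eq_norm] at hx ⊢
    have h1 := hL x (hsub (by rwa [mem_closedBall, dist_eq_norm])) c (hsub hcc)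
    have h2 : ‖T c - c‖ = (1 - q) * R := by rw [hR]; field_simp
    calc ‖T x - c‖ = ‖(T x - T c) + (T c - c)‖ := by congr 1; abel
      _ ≤ ‖T x - T c‖ + ‖T c - c‖ := norm_add_le _ _
      _ ≤ q * R + (1 - q) * R := by rw [h2]; gcongr; exact h1.trans (by gcongr)
      _ = R := by ring
  have hcon : ContractingWith ⟨q, hq⟩ (hmaps.restrict T (closedBall c R) (closedBall c R)) := by
    refine ⟨by exact_mod_cast hq1, LipschitzWith.of_dist_le_mul fun x y => ?_⟩
    simp only [Subtype.dist_eq, dist_eq_norm]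
    exact hL x (hsub x.2) y (hsub y.2)
  obtain ⟨y, hy, hfix, -⟩ := hcon.exists_fixedPoint' isClosed_closedBall.isComplete hmaps hcc
    (edist_ne_top _ _)
  exact ⟨y, hsub hy, hfix⟩

variable {E Q : Type*} [NormedAddCommGroup E] [NormedSpace ℂ E] [CompleteSpace E]
  [NormedAddCommGroup Q] [NormedSpace ℂ Q] [CompleteSpace Q]

/-- The fixed point of a uniform contraction that depends analytically on a parameter is an
analytic function of the parameter. -/
theorem exists_analytic_fixedPoint {U : Set Q} (hU : IsOpen U) {G : E × Q → E} {c : Q → E}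
    (hc : ContinuousOn c U) {ρ q : ℝ} (hq : 0 ≤ q) (hq1 : q < 1)
    (hG : ∀ p ∈ U, ∀ x ∈ ball (c p) ρ, AnalyticAt ℂ G (x, p))
    (hL : ∀ p ∈ U, ∀ x ∈ ball (c p) ρ, ∀ y ∈ ball (c p) ρ,
      ‖G (x, p) - G (y, p)‖ ≤ q * ‖x - y‖)
    (h0 : ∀ p ∈ U, ‖G (c p, p) - c p‖ < (1 - q) * ρ) :
    ∃ g : Q → E, AnalyticOnNhd ℂ g U ∧ ∀ p ∈ U, g p ∈ ball (c p) ρ ∧ G (g p, p) = g p := by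
  classical
  have hex : ∀ p, ∃ x, p ∈ U → x ∈ ball (c p) ρ ∧ G (x, p) = x := by
    intro p
    by_cases hp : p ∈ U
    · obtain ⟨x, hx, hfx⟩ := exists_fixedPoint_mem_ball (T := fun x => G (x, p)) hq hq1
        (hL p hp) (h0 p hp)
      exact ⟨x, fun _ => ⟨hx, hfx⟩⟩
    · exact ⟨0, fun h => absurd h hp⟩
  choose g hg using hex
  refine ⟨g, fun p hp => ?_, hg⟩
  obtain ⟨hgp, hfix⟩ := hg p hp
  -- The implicit function theorem is applied to `x - G (x, p) = 0`. The Lipschitz constant bounds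
  -- the partial derivative `A` of `G` by `q < 1`, so `1 - A` is invertible by a Neumann series.
  set H : Q × E → E := fun u => u.2 - G (u.2, u.1) with hH
  have hGa := hG p hp (g p) hgp
  have hHa : AnalyticAt ℂ H (p, g p) := by
    refine analyticAt_snd.sub ?_
    exact AnalyticAt.fun_comp (g := G) (f := fun u : Q × E => (u.2, u.1)) hGa
      (analyticAt_snd.prod analyticAt_fst)
  have cdf : ContDiffAt ℂ ω H (p, g p) := hHa.contDiffAt
  set A : E →L[ℂ] E := fderiv ℂ G (g p, p) ∘L .inl ℂ E Q with hA
  have hAn : ‖A‖ ≤ q := by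
    have h1 : HasFDerivAt (fun x => G (x, p)) A (g p) := by
      have := hGa.differentiableAt.hasFDerivAt.comp (g p)
        (f := fun x : E => (x, p)) (hasFDerivAt_prodMk_left (g p) p)
      exact this
    refine h1.le_of_lip' hq ?_
    filter_upwards [isOpen_ball.mem_nhds hgp] with x hx
    exact hL p hp x hx _ hgp
  have hder : fderiv ℂ H (p, g p) ∘L .inr ℂ Q E = 1 - A := by
    have h1 : HasFDerivAt (fun x => H (p, x)) (fderiv ℂ H (p, g p) ∘L .inr ℂ Q E) (g p) :=
      hHa.differentiableAt.hasFDerivAt.comp (g p) (hasFDerivAt_prodMk_right p (g p))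
    have h2 : HasFDerivAt (fun x => H (p, x)) (1 - A) (g p) := by
      have h3 : HasFDerivAt (fun x => G (x, p)) A (g p) :=
        hGa.differentiableAt.hasFDerivAt.comp (g p)
          (f := fun x : E => (x, p)) (hasFDerivAt_prodMk_left (g p) p)
      exact (hasFDerivAt_id (g p)).sub h3
    exact h1.unique h2
  have hinv : (fderiv ℂ H (p, g p) ∘L .inr ℂ Q E).IsInvertible := by
    rw [hder]
    exact ⟨ContinuousLinearEquiv.unitsEquiv ℂ E (Units.oneSub A (hAn.trans_lt hq1)), by
      ext x; simp⟩
  have hψ0 := cdf.implicitFunction_apply_self (by simp) hinv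
  have hψe := cdf.eventually_apply_implicitFunction (by simp) hinv
  have hψa := (cdf.contDiffAt_implicitFunction (by simp) hinv).analyticAt
  set ψ := cdf.implicitFunction (by simp) hinv
  refine hψa.congr ?_
  -- The function `g` was chosen pointwise. Near `p` the analytic branch `ψ` stays in the moving
  -- ball about `c`, by continuity of `c`, and uniqueness of the fixed point there forces `ψ = g`.
  have hcp : ContinuousAt c p := hc.continuousAt (hU.mem_nhds hp)
  have hball : ∀ᶠ x in 𝓝 p, ψ x ∈ ball (c x) ρ := by
    have h1 : ContinuousAt (fun x => dist (ψ x) (c x)) p := hψa.continuousAt.dist hcp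
    have h2 : dist (ψ p) (c p) < ρ := by
      have : ψ p = g p := hψ0
      rw [this]; exact hgp
    exact h1.eventually_lt continuousAt_const h2
  filter_upwards [hψe, hball, hU.mem_nhds hp] with x h1 h2 hx
  have h3 : G (ψ x, x) = ψ x := by
    have h4 : H (p, g p) = 0 := by simp [hH, hfix]
    rw [h4] at h1
    exact (sub_eq_zero.1 h1).symm
  exact eq_of_contraction (T := fun y => G (y, x)) hq1 (hL x hx _ h2 _ (hg x hx).1) h3
    (hg x hx).2

end FixedPoint

end KAM

namespace KAM

open Metric Set Filter Topology MeasureTheory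
open scoped ContDiff ENNReal NNReal
-- Analyticity of superposition operators on spaces of continuous functions
section Superposition

variable {K V F : Type*} [TopologicalSpace K] [CompactSpace K]
  [NormedAddCommGroup V] [NormedSpace ℂ V] [NormedAddCommGroup F] [NormedSpace ℂ F]

/-- A multilinear map, applied pointwise to continuous functions. -/
noncomputable def pointwiseMultilinear (K : Type*) [TopologicalSpace K] [CompactSpace K] {n : ℕ}
    (p : V [×n]→L[ℂ] F) : C(K, V) [×n]→L[ℂ] C(K, F) :=
  MultilinearMap.mkContinuous
    { toFun := fun m => ⟨fun x => p fun i => m i x, by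
        exact p.cont.comp (continuous_pi fun i => (m i).continuous)⟩
      map_update_add' := by
        intro _ m i u v
        ext x
        have h : ∀ w : C(K, V), (fun j => (Function.update m i w) j x) =
            Function.update (fun j => m j x) i (w x) := by
          intro w; ext j
          by_cases hj : j = i
          · subst hj; simp
          · simp [hj]
        simp [h]
      map_update_smul' := by
        intro _ m i a v
        ext x
        have h : ∀ w : C(K, V), (fun j => (Function.update m i w) j x) =
            Function.update (fun j => m j x) i (w x) := by
          intro w; ext j
          by_cases hj : j = i
          · subst hj; simp
          · simp [hj]
        simp [h] }
    ‖p‖ (by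
      intro m
      refine (ContinuousMap.norm_le _ (by positivity)).2 fun x => ?_
      refine (p.le_opNorm _).trans ?_
      gcongr with i
      exact (m i).norm_coe_le_norm x)

theorem norm_pointwiseMultilinear_le {n : ℕ} (p : V [×n]→L[ℂ] F) :
    ‖pointwiseMultilinear K p‖ ≤ ‖p‖ :=
  MultilinearMap.mkContinuous_norm_le _ (norm_nonneg _) _

/-- The superposition operator `γ ↦ g ∘ γ` is analytic near a constant `v`, if `g` is analytic at
`v`. -/
theorem exists_analyticAt_superposition [CompleteSpace F] {g : V → F} {v : V}
    (hg : AnalyticAt ℂ g v) :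
    ∃ δ > 0, ∀ (K : Type*) [TopologicalSpace K] [CompactSpace K], ∃ N : C(K, V) → C(K, F),
      ∀ γ : C(K, V), (∀ x, ‖γ x - v‖ < δ) → AnalyticAt ℂ N γ ∧ ∀ x, N γ x = g (γ x) := by
  obtain ⟨p, r, hp⟩ := hg
  obtain ⟨δ, hδ0, hδr⟩ := ENNReal.lt_iff_exists_nnreal_btwn.1 hp.r_pos
  have hδ0' : 0 < δ := by exact_mod_cast hδ0
  -- The radius `δ` is fixed before the compact space: in `analyticAt_setIntegral` that space is cut
  -- out by means of `δ`.
  refine ⟨δ, hδ0', fun K _ _ => ?_⟩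
  set P : FormalMultilinearSeries ℂ C(K, V) C(K, F) := fun n => pointwiseMultilinear K (p n)
  set N : C(K, V) → C(K, F) := fun γ => P.sum (γ - ContinuousMap.const K v)
  -- Lifting the coefficients of the power series to pointwise operations does not increase their
  -- norms, so no radius of convergence is lost. Evaluation at a point gives back the series of `g`.
  have hrad : r ≤ P.radius := hp.r_le.trans (by
    refine FormalMultilinearSeries.radius_le_of_le fun {n} => norm_pointwiseMultilinear_le _)
  have hN : HasFPowerSeriesOnBall N P (ContinuousMap.const K v) r := by
    have := (P.hasFPowerSeriesOnBall (hp.r_pos.trans_le hrad)).mono hp.r_pos hrad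
    simpa using this.comp_sub (ContinuousMap.const K v)
  refine ⟨N, fun γ hγ => ?_⟩
  have hγ' : ‖γ - ContinuousMap.const K v‖ < δ :=
    (ContinuousMap.norm_lt_iff _ (by exact_mod_cast hδ0')).2 fun x => by simpa using hγ x
  have hmem : γ ∈ Metric.eball (ContinuousMap.const K v) r := by
    rw [Metric.mem_eball, edist_eq_enorm_sub]
    refine lt_trans ?_ hδr
    rw [enorm_eq_nnnorm]
    exact_mod_cast hγ'
  refine ⟨hN.analyticAt_of_mem hmem, fun x => ?_⟩
  have h1 := hN.hasSum_sub hmem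
  have h2 := (ContinuousMap.evalCLM ℂ x).hasSum h1
  have h3 : HasSum (fun n => p n fun _ => γ x - v) (g (γ x)) := by
    refine hp.hasSum_sub ?_
    rw [Metric.mem_eball, edist_eq_enorm_sub]
    refine lt_trans ?_ hδr
    rw [enorm_eq_nnnorm]
    exact_mod_cast hγ x
  exact h2.unique h3

end Superposition

/-! ### Analytic dependence of integrals on parameters -/

section Integral

/-- Integrals of analytic functions over compact sets depend analytically on parameters. -/
theorem analyticAt_setIntegral {X V E F : Type*} [TopologicalSpace X] [T2Space X]
    [MeasurableSpace X]
    [OpensMeasurableSpace X] [NormedAddCommGroup V] [NormedSpace ℂ V]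
    [NormedAddCommGroup E] [NormedSpace ℂ E] [NormedAddCommGroup F] [NormedSpace ℂ F]
    [SecondCountableTopologyEither X F]
    [CompleteSpace F] {μ : Measure X} [IsFiniteMeasureOnCompacts μ] {K : Set X} (hK : IsCompact K)
    {ξ : X → V} (hξ : Continuous ξ) {g : V × E → F} {w₀ : E}
    (hg : ∀ x ∈ K, AnalyticAt ℂ g (ξ x, w₀)) {A : Set X} (hA : MeasurableSet A) (hAK : A ⊆ K) :
    AnalyticAt ℂ (fun w => ∫ x in A, g (ξ x, w) ∂μ) w₀ := by
  -- Integrability is carried along so that integrals over disjoint pieces may be added. The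
  -- induction over the compact set asks for all measurable subsets of a piece, which allows
  -- overlapping pieces to be made disjoint.
  set P : Set X → Prop := fun A => AnalyticAt ℂ (fun w => ∫ x in A, g (ξ x, w) ∂μ) w₀ ∧
    ∀ᶠ w in 𝓝 w₀, IntegrableOn (fun x => g (ξ x, w)) A μ with hP
  suffices h : ∃ B, MeasurableSet B ∧ K ⊆ B ∧ ∀ A ⊆ B ∩ K, MeasurableSet A → P A by
    obtain ⟨B, -, hKB, hB⟩ := h
    exact (hB A (fun x hx => ⟨hKB (hAK hx), hAK hx⟩) hA).1
  refine hK.induction_on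
    (p := fun s => ∃ B, MeasurableSet B ∧ s ⊆ B ∧ ∀ A ⊆ B ∩ K, MeasurableSet A → P A) ?_ ?_ ?_ ?_
  · refine ⟨∅, MeasurableSet.empty, subset_rfl, fun A hA _ => ?_⟩
    obtain rfl : A = ∅ := subset_empty_iff.1 (by simpa using hA)
    simpa [hP] using analyticAt_const
  · rintro s t hst ⟨B, hB, htB, h⟩
    exact ⟨B, hB, hst.trans htB, h⟩
  · rintro s t ⟨B, hB, hsB, h⟩ ⟨C, hC, htC, h'⟩
    refine ⟨B ∪ C, hB.union hC, union_subset_union hsB htC, fun A hA hm => ?_⟩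
    obtain ⟨h1, h2⟩ := h (A ∩ B) (fun x hx => ⟨hx.2, (hA hx.1).2⟩) (hm.inter hB)
    obtain ⟨h3, h4⟩ := h' (A \ B) (fun x hx => ⟨(hA hx.1).1.resolve_left hx.2, (hA hx.1).2⟩)
      (hm.diff hB)
    refine ⟨(h1.add h3).congr ?_, ?_⟩
    · filter_upwards [h2, h4] with w hw hw'
      have := setIntegral_union (μ := μ) (f := fun x => g (ξ x, w))
        (disjoint_sdiff_inter (s := A) (t := B)).symm (hm.diff hB) hw hw'
      rw [inter_union_sdiff] at this
      exact this.symm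
    · filter_upwards [h2, h4] with w hw hw'
      rw [← inter_union_sdiff A B]
      exact hw.union hw'
  · intro x₀ hx₀
    obtain ⟨δ, hδ, hN⟩ := exists_analyticAt_superposition (hg x₀ hx₀)
    set B : Set X := {x | ‖ξ x - ξ x₀‖ ≤ δ / 2} with hB
    have hBc : IsClosed B := isClosed_le (by fun_prop) continuous_const
    refine ⟨B, mem_nhdsWithin_of_mem_nhds ?_, B, hBc.measurableSet, subset_rfl, ?_⟩
    · have : ContinuousAt (fun x => ‖ξ x - ξ x₀‖) x₀ := by fun_prop
      have h2 := this.eventually_lt (g := fun _ => δ / 2) continuousAt_const (by simpa using hδ)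
      exact h2.mono fun x hx => le_of_lt hx
    intro A hA hAm
    have hCK : IsCompact (B ∩ K) := hK.inter_left hBc
    have hCm : MeasurableSet (B ∩ K) := hCK.measurableSet
    have : CompactSpace ↥(B ∩ K) := isCompact_iff_compactSpace.1 hCK
    have hfin : IsFiniteMeasureOnCompacts (μ.comap ((↑) : ↥(B ∩ K) → X)) :=
      IsFiniteMeasureOnCompacts.comap' μ continuous_subtype_val
        (MeasurableEmbedding.subtype_coe hCm)
    set ν : Measure ↥(B ∩ K) := (μ.comap (↑)).restrict ((↑) ⁻¹' A) with hν
    obtain ⟨N, hN⟩ := hN ↥(B ∩ K)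
    have hint : ∀ f : C(↥(B ∩ K), F), Integrable f ν := fun f =>
      (f.continuous.integrable_of_hasCompactSupport
        (HasCompactSupport.of_compactSpace f)).restrict
    -- On a small piece the integral is `L (N (γ w))`: an affine continuous map into a function
    -- space, then the superposition operator, then the continuous linear functional of integration.
    set L : C(↥(B ∩ K), F) →L[ℂ] F := LinearMap.mkContinuous
      { toFun := fun f => ∫ x, f x ∂ν
        map_add' := fun f g => integral_add (hint f) (hint g)
        map_smul' := fun c f => integral_smul c f } (ν.real univ) (fun f => by
          rw [mul_comm]
          exact norm_integral_le_of_norm_le_const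
            (Eventually.of_forall fun x => f.norm_coe_le_norm x)) with hL
    set γ : E → C(↥(B ∩ K), V × E) := fun w => ⟨fun x => (ξ x, w), by fun_prop⟩ with hγ
    have hγa : AnalyticAt ℂ γ w₀ := by
      have : γ = fun w => γ 0 + (ContinuousLinearMap.inr ℂ V E).compLeftContinuous ℂ ↥(B ∩ K)
          (ContinuousLinearMap.const ℂ ↥(B ∩ K) w) := by
        ext w x <;> simp [hγ]
      rw [this]
      exact analyticAt_const.add
        ((((ContinuousLinearMap.inr ℂ V E).compLeftContinuous ℂ ↥(B ∩ K)).comp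
          (ContinuousLinearMap.const ℂ ↥(B ∩ K))).analyticAt w₀)
    have hclose : ∀ᶠ w in 𝓝 w₀, ∀ x, ‖γ w x - (ξ x₀, w₀)‖ < δ := by
      filter_upwards [ball_mem_nhds w₀ hδ] with w hw x
      have h1 : ‖ξ x - ξ x₀‖ ≤ δ / 2 := x.2.1
      have h2 : ‖w - w₀‖ < δ := by rwa [← dist_eq_norm]
      simp only [hγ, ContinuousMap.coe_mk, Prod.mk_sub_mk, Prod.norm_mk]
      exact max_lt (by linarith) h2
    have hval : ∀ᶠ w in 𝓝 w₀, ∀ x : ↥(B ∩ K), N (γ w) x = g (ξ x, w) := by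
      filter_upwards [hclose] with w hw x
      exact (hN _ hw).2 x
    constructor
    · have h1 : AnalyticAt ℂ (fun w => L (N (γ w))) w₀ :=
        (L.analyticAt _).comp ((hN _ hclose.self_of_nhds).1.comp hγa)
      refine h1.congr ?_
      filter_upwards [hval] with w hw
      have h2 : L (N (γ w)) = ∫ x : ↥(B ∩ K) in (↑) ⁻¹' A, g (ξ x, w) ∂(μ.comap (↑)) := by
        simp only [hL, hν, LinearMap.mkContinuous_apply, LinearMap.coe_mk, AddHom.coe_mk, hw]
      rw [h2]
      have h3 := (MeasurableEmbedding.subtype_coe hCm).setIntegral_map (μ := μ.comap (↑))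
        (fun x => g (ξ x, w)) A
      rw [map_comap_subtype_coe hCm, Measure.restrict_restrict hAm, inter_eq_left.2 hA] at h3
      exact h3.symm
    · filter_upwards [hval] with w hw
      have h2 := hint (N (γ w))
      have h3 : (⇑(N (γ w)) : ↥(B ∩ K) → F) = (fun x => g (ξ x, w)) ∘ (↑) := funext hw
      rw [h3, hν] at h2
      have h4 := (MeasurableEmbedding.subtype_coe hCm).integrableOn_map_iff (μ := μ.comap (↑))
        (f := fun x => g (ξ x, w)) (s := A)
      have h5 := h4.2 h2
      rw [map_comap_subtype_coe hCm] at h5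
      rw [IntegrableOn, Measure.restrict_restrict hAm, inter_eq_left.2 hA] at h5
      exact h5

end Integral
end KAM

/-! ### Fourier coefficients of periodic analytic functions on a strip -/

namespace KAM

open Metric Set Filter Topology MeasureTheory
variable {n : ℕ}

/-- The strip `|Im θ| < s`. -/
def strip (n : ℕ) (s : ℝ) : Set (CVec n) := {θ | ∀ j, |(θ j).im| < s}

theorem mem_strip {s : ℝ} {θ : CVec n} : θ ∈ strip n s ↔ ∀ j, |(θ j).im| < s := Iff.rfl

theorem isOpen_strip (s : ℝ) : IsOpen (strip n s) := by
  simp only [strip, ofPred_forall]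
  exact isOpen_iInter_of_finite fun j => isOpen_lt (by fun_prop) continuous_const

theorem strip_mono {s s' : ℝ} (h : s ≤ s') : strip n s ⊆ strip n s' :=
  fun _ hθ j => (hθ j).trans_le h

theorem convex_strip (s : ℝ) : Convex ℝ (strip n s) := by
  intro x hx y hy a b ha hb hab j
  have h : ((a • x + b • y) j).im = a * (x j).im + b * (y j).im := by simp
  rw [h, abs_lt]
  obtain ⟨h1, h2⟩ := abs_lt.1 (hx j)
  obtain ⟨h3, h4⟩ := abs_lt.1 (hy j)
  rcases ha.eq_or_lt with rfl | ha
  · obtain rfl : b = 1 := by linarith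
    constructor <;> linarith
  · have hb' : b = 1 - a := by linarith
    subst hb'
    constructor <;> nlinarith

/-- The vector `2πx`, as a complex vector. -/
noncomputable def circleVec (x : Fin n → ℝ) : CVec n := fun j => ((2 * Real.pi * x j : ℝ) : ℂ)

theorem continuous_circleVec : Continuous (circleVec : (Fin n → ℝ) → CVec n) := by
  unfold circleVec; fun_prop

theorem circleVec_add_intCast (x : Fin n → ℝ) (k : Fin n → ℤ) :
    circleVec (fun j => x j + k j) = circleVec x + angleShift k := by
  ext j; simp [circleVec, angleShift]; ring

theorem circleVec_mem_strip {s : ℝ} (hs : 0 < s) (x : Fin n → ℝ) : circleVec x ∈ strip n s := by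
  intro j
  simp only [circleVec, Complex.ofReal_im, abs_zero, hs]

theorem angleShift_im (k : Fin n → ℤ) (j : Fin n) : (angleShift k j).im = 0 := by
  simp only [angleShift, Complex.ofReal_im]

/-- The character `θ ↦ exp (i⟨k, θ⟩)`. -/
noncomputable def expChar (k : Fin n → ℤ) (θ : CVec n) : ℂ :=
  Complex.exp (Complex.I * ∑ j, (k j : ℂ) * θ j)

theorem analyticAt_expChar (k : Fin n → ℤ) (θ : CVec n) : AnalyticAt ℂ (expChar k) θ := by
  have h : ∀ j, AnalyticAt ℂ (fun θ : CVec n => θ j) θ := fun j =>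
    (ContinuousLinearMap.proj (R := ℂ) (φ := fun _ : Fin n => ℂ) j).analyticAt θ
  refine AnalyticAt.cexp (analyticAt_const.mul ?_)
  exact Finset.analyticAt_fun_sum _ fun j _ => analyticAt_const.mul (h j)

theorem expChar_add (k : Fin n → ℤ) (θ θ' : CVec n) :
    expChar k (θ + θ') = expChar k θ * expChar k θ' := by
  simp only [expChar, ← Complex.exp_add, Pi.add_apply, mul_add, Finset.sum_add_distrib]

theorem expChar_angleShift (k l : Fin n → ℤ) : expChar k (angleShift l) = 1 := by
  rw [expChar, Complex.exp_eq_one_iff]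
  refine ⟨∑ j, k j * l j, ?_⟩
  push_cast
  rw [Finset.mul_sum, Finset.sum_mul]
  refine Finset.sum_congr rfl fun j _ => ?_
  simp [angleShift]; ring

theorem expChar_zero_left (θ : CVec n) : expChar 0 θ = 1 := by simp [expChar]

theorem norm_expChar (k : Fin n → ℤ) (θ : CVec n) :
    ‖expChar k θ‖ = Real.exp (-∑ j, (k j : ℝ) * (θ j).im) := by
  rw [expChar, Complex.norm_exp]
  congr 1
  simp

theorem norm_expChar_le {k : Fin n → ℤ} {θ : CVec n} {s : ℝ} (hθ : θ ∈ strip n s) :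
    ‖expChar k θ‖ ≤ Real.exp (intNorm k * s) := by
  rw [norm_expChar, Real.exp_le_exp, intNorm, Finset.sum_mul, ← Finset.sum_neg_distrib]
  refine Finset.sum_le_sum fun j _ => ?_
  calc -((k j : ℝ) * (θ j).im) ≤ |(k j : ℝ) * (θ j).im| := neg_le_abs _
    _ = |(k j : ℝ)| * |(θ j).im| := abs_mul _ _
    _ ≤ _ := by gcongr; exact (hθ j).le

theorem expChar_circleVec (k : Fin n → ℤ) (x : Fin n → ℝ) :
    expChar k (circleVec x) = UnitAddTorus.mFourier k (fun i => (x i : UnitAddCircle)) := by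
  simp only [UnitAddTorus.mFourier, ContinuousMap.coe_mk, fourier_coe_apply, expChar, circleVec]
  rw [← Complex.exp_sum, Finset.mul_sum]
  congr 1
  refine Finset.sum_congr rfl fun j _ => ?_
  push_cast; simp; ring

/-- The half-open unit cube. -/
def unitCube (n : ℕ) : Set (Fin n → ℝ) := {x | ∀ i, x i ∈ Ioc (0 : ℝ) (0 + 1)}

theorem measurableSet_unitCube : MeasurableSet (unitCube n) :=
  MeasurableSet.univ_pi' fun _ => measurableSet_Ioc

theorem unitCube_subset : unitCube n ⊆ Icc 0 1 :=
  fun _ hx => ⟨fun i => (hx i).1.le, fun i => by simpa using (hx i).2⟩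

attribute [local instance] instMeasureSpaceUnitAddCircle
  instIsAddHaarMeasureUnitAddCircleVolume instIsProbabilityMeasureUnitAddCircleVolume

/-- The function on the torus that is induced by a `2π`-periodic function. -/
noncomputable def torusFun (g : CVec n → ℂ) (t : UnitAddTorus (Fin n)) : ℂ :=
  g (circleVec fun j => (AddCircle.equivIoc 1 0 (t j)).1)

theorem torusFun_coe {g : CVec n → ℂ}
    (hp : ∀ (x : Fin n → ℝ) (k : Fin n → ℤ), g (circleVec x + angleShift k) = g (circleVec x))
    (x : Fin n → ℝ) : torusFun g (fun i => (x i : UnitAddCircle)) = g (circleVec x) := by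
  have h : ∀ j, ∃ m : ℤ, ((AddCircle.equivIoc (1 : ℝ) 0 (x j : UnitAddCircle)).1 : ℝ) = x j + m := by
    intro j
    have h1 : (((AddCircle.equivIoc (1 : ℝ) 0 (x j : UnitAddCircle)).1 - x j : ℝ) :
        UnitAddCircle) = 0 := by
      rw [AddCircle.coe_sub, AddCircle.coe_equivIoc, sub_self]
    obtain ⟨m, hm⟩ := AddCircle.coe_eq_zero_iff 1 |>.1 h1
    exact ⟨m, by rw [zsmul_one] at hm; linarith⟩
  choose m hm using h
  rw [torusFun, ← hp x m, ← circleVec_add_intCast]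
  simp only [hm]

theorem continuous_torusFun {g : CVec n → ℂ}
    (hp : ∀ (x : Fin n → ℝ) (k : Fin n → ℤ), g (circleVec x + angleShift k) = g (circleVec x))
    (hc : Continuous fun x => g (circleVec x)) : Continuous (torusFun g) := by
  have hq : IsOpenQuotientMap (Pi.map fun (_ : Fin n) (x : ℝ) => (x : UnitAddCircle)) :=
    IsOpenQuotientMap.piMap fun _ => QuotientAddGroup.isOpenQuotientMap_mk
  rw [hq.isQuotientMap.continuous_iff]
  refine hc.congr fun x => ?_
  exact (torusFun_coe hp x).symm

/-- The Fourier coefficients of a `2π`-periodic function. -/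
noncomputable def fourierCoeff (g : CVec n → ℂ) (k : Fin n → ℤ) : ℂ :=
  ∫ x in unitCube n, expChar (-k) (circleVec x) * g (circleVec x)

theorem mFourierCoeff_torusFun {g : CVec n → ℂ}
    (hp : ∀ (x : Fin n → ℝ) (k : Fin n → ℤ), g (circleVec x + angleShift k) = g (circleVec x))
    (k : Fin n → ℤ) : UnitAddTorus.mFourierCoeff (torusFun g) k = fourierCoeff g k := by
  rw [UnitAddTorus.mFourierCoeff_eq_integral (torusFun g) k 0, fourierCoeff]
  refine setIntegral_congr_fun measurableSet_unitCube fun x _ => ?_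
  simp only [torusFun_coe hp, smul_eq_mul, expChar_circleVec]

/-- Parseval's identity in `L²` of the torus, whose measure is normalised, so that the sup bound is
also an `L²` bound. -/
theorem sum_sq_mFourierCoeff_le {f : UnitAddTorus (Fin n) → ℂ} (hf : Continuous f) {M : ℝ}
    (hM : ∀ t, ‖f t‖ ≤ M) (S : Finset (Fin n → ℤ)) :
    ∑ k ∈ S, ‖UnitAddTorus.mFourierCoeff f k‖ ^ 2 ≤ M ^ 2 := by
  set F : C(UnitAddTorus (Fin n), ℂ) := ⟨f, hf⟩
  have h := UnitAddTorus.hasSum_sq_mFourierCoeff (ContinuousMap.toLp 2 volume ℂ F)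
  simp only [UnitAddTorus.mFourierCoeff_toLp] at h
  refine (sum_le_hasSum S (fun _ _ => by positivity) h).trans ?_
  have h1 : ∫ t, ‖(ContinuousMap.toLp 2 volume ℂ F) t‖ ^ 2 = ∫ t, ‖F t‖ ^ 2 := by
    refine integral_congr_ae ?_
    filter_upwards [ContinuousMap.coeFn_toLp (p := 2) (𝕜 := ℂ) volume F] with t ht
    rw [ht]
  rw [h1]
  have h2 : ‖∫ t, ‖F t‖ ^ 2‖ ≤ M ^ 2 * (volume : Measure (UnitAddTorus (Fin n))).real univ := by
    refine norm_integral_le_of_norm_le_const (Eventually.of_forall fun t => ?_)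
    rw [Real.norm_of_nonneg (by positivity)]
    exact pow_le_pow_left₀ (norm_nonneg _) (hM t) 2
  have h3 := (Real.le_norm_self _).trans h2
  simpa using h3

/-- Translation invariance of Haar measure on the torus, pulled back to the cube. It replaces the
cancellation of boundary terms in the contour shift. -/
theorem integral_unitCube_add {g : CVec n → ℂ}
    (hp : ∀ (x : Fin n → ℝ) (k : Fin n → ℤ), g (circleVec x + angleShift k) = g (circleVec x))
    (a : Fin n → ℝ) :
    ∫ x in unitCube n, g (circleVec (x + a)) = ∫ x in unitCube n, g (circleVec x) := by
  have h1 := UnitAddTorus.integral_preimage (torusFun g) 0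
  have h2 := UnitAddTorus.integral_preimage
    (fun t => torusFun g (t + fun i => (a i : UnitAddCircle))) 0
  rw [integral_add_right_eq_self (μ := (volume : Measure (UnitAddTorus (Fin n))))
    (fun t => torusFun g t)] at h2
  rw [h1] at h2
  have h3 : ∀ x : Fin n → ℝ, torusFun g ((fun i => (x i : UnitAddCircle)) +
      fun i => (a i : UnitAddCircle)) = g (circleVec (x + a)) := fun x =>
    torusFun_coe hp (x + a)
  simp only [h3, torusFun_coe hp] at h2
  exact h2.symm

/-- An analytic `2π`-periodic function on the strip `|Im θ| < s`, with the bound `M`. -/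
structure IsStripFun (g : CVec n → ℂ) (s M : ℝ) : Prop where
  analytic : AnalyticOnNhd ℂ g (strip n s)
  periodic : ∀ θ ∈ strip n s, ∀ k, g (θ + angleShift k) = g θ
  bound : ∀ θ ∈ strip n s, ‖g θ‖ ≤ M

namespace IsStripFun

variable {g : CVec n → ℂ} {s M : ℝ}

theorem shift (h : IsStripFun g s M) {s' : ℝ} {v : CVec n}
    (hv : ∀ θ ∈ strip n s', θ + v ∈ strip n s) : IsStripFun (fun θ => g (θ + v)) s' M where
  analytic θ hθ := AnalyticAt.fun_comp (g := g) (h.analytic _ (hv θ hθ))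
    (analyticAt_id.add analyticAt_const)
  periodic θ hθ k := by
    rw [add_right_comm]
    exact h.periodic _ (hv θ hθ) k
  bound θ hθ := h.bound _ (hv θ hθ)

theorem periodic_circleVec (h : IsStripFun g s M) (hs : 0 < s) (x : Fin n → ℝ) (k : Fin n → ℤ) :
    g (circleVec x + angleShift k) = g (circleVec x) :=
  h.periodic _ (circleVec_mem_strip hs x) k

theorem continuous_circleVec (h : IsStripFun g s M) (hs : 0 < s) :
    Continuous fun x => g (circleVec x) :=
  continuous_iff_continuousAt.2 fun x =>
    ContinuousAt.comp' (h.analytic _ (circleVec_mem_strip hs x)).continuousAt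
      KAM.continuous_circleVec.continuousAt

theorem sum_sq_fourierCoeff_le (h : IsStripFun g s M) (hs : 0 < s) (S : Finset (Fin n → ℤ)) :
    ∑ k ∈ S, ‖fourierCoeff g k‖ ^ 2 ≤ M ^ 2 := by
  have hp := h.periodic_circleVec hs
  have := sum_sq_mFourierCoeff_le (continuous_torusFun hp (h.continuous_circleVec hs)) (M := M)
    (fun t => h.bound _ (circleVec_mem_strip hs _)) S
  simpa only [mFourierCoeff_torusFun hp] using this

/-- Shifting the contour of integration into the complex domain multiplies the Fourier
coefficients by exponential factors. -/
theorem fourierCoeff_shift (h : IsStripFun g s M) {y : Fin n → ℝ} (hy : ∀ j, |y j| < s)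
    (k : Fin n → ℤ) :
    fourierCoeff (fun θ => g (θ + fun j => (y j : ℂ) * Complex.I)) k =
      Real.exp (-∑ j, (k j : ℝ) * y j) * fourierCoeff g k := by
  set v : CVec n := fun j => (y j : ℂ) with hv
  set U : Set ℂ := {w | w • v ∈ strip n s} with hU
  have hvim : ∀ (w : ℂ) j, ((w • v) j).im = w.im * y j := by intro w j; simp [hv]
  have hcU : Convex ℝ U := by
    have := (convex_strip (n := n) s).is_linear_preimage
      (f := fun w : ℂ => w • v) ⟨fun a b => add_smul a b v, fun a b => smul_assoc a b v⟩
    exact this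
  set f : CVec n → ℂ := fun θ => expChar (-k) θ * g θ with hf
  have hfa : ∀ θ ∈ strip n s, AnalyticAt ℂ f θ := fun θ hθ =>
    (analyticAt_expChar _ _).mul (h.analytic θ hθ)
  have hfp : ∀ θ ∈ strip n s, ∀ l, f (θ + angleShift l) = f θ := fun θ hθ l => by
    simp only [hf]
    rw [h.periodic θ hθ, expChar_add, expChar_angleShift, mul_one]
  -- A real `w` translates the torus, so `G` is constant on the real axis; being analytic on the
  -- convex set `U`, it is constant there. The claim is `G I = G 0`, after the exponential factor is
  -- pulled out of the character.
  set G : ℂ → ℂ := fun w => ∫ x in unitCube n, f (circleVec x + w • v) with hG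
  have hmem : ∀ w ∈ U, ∀ x : Fin n → ℝ, circleVec x + w • v ∈ strip n s := by
    intro w hw x j
    have : (circleVec x j).im = 0 := by simp only [circleVec, Complex.ofReal_im]
    rw [Pi.add_apply, Complex.add_im, this, zero_add]
    exact hw j
  have hGa : AnalyticOnNhd ℂ G U := by
    intro w hw
    refine analyticAt_setIntegral (g := fun p : CVec n × ℂ => f (p.1 + p.2 • v)) (K := Icc 0 1)
      isCompact_Icc KAM.continuous_circleVec ?_ measurableSet_unitCube unitCube_subset
    intro x _
    refine AnalyticAt.fun_comp (g := f) (f := fun p : CVec n × ℂ => p.1 + p.2 • v)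
      (hfa _ (hmem w hw x)) ?_
    exact analyticAt_fst.add (analyticAt_snd.smul analyticAt_const)
  -- Without an index the hypothesis on `y` does not give `0 < s`; in dimension zero the shift is
  -- trivial.
  rcases isEmpty_or_nonempty (Fin n) with hemp | ⟨⟨j₀⟩⟩
  · have : n = 0 := by
      rcases n with _ | m
      · rfl
      · exact (hemp.false 0).elim
    subst this
    simp only [Finset.univ_eq_empty, Finset.sum_empty, neg_zero, Real.exp_zero,
      Complex.ofReal_one, one_mul]
    congr 1
    ext θ
    congr 1
    exact Subsingleton.elim _ _
  have hs : 0 < s := (abs_nonneg _).trans_lt (hy j₀)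
  have hreal : ∀ t : ℝ, (t : ℂ) ∈ U ∧ G t = G 0 := by
    intro t
    constructor
    · intro j
      rw [hvim]
      simpa using hs
    · have h1 := integral_unitCube_add (g := f) (fun x l => hfp _ (circleVec_mem_strip hs x) l)
        (fun j => t * y j / (2 * Real.pi))
      have h2 : ∀ x : Fin n → ℝ, circleVec (x + fun j => t * y j / (2 * Real.pi)) =
          circleVec x + (t : ℂ) • v := by
        intro x; ext j
        have := Real.pi_ne_zero
        simp only [circleVec, Pi.add_apply, hv, Pi.smul_apply, smul_eq_mul]
        rw [← Complex.ofReal_mul, ← Complex.ofReal_add]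
        congr 1
        field_simp
      simp only [h2] at h1
      simp only [hG, zero_smul, add_zero]
      exact h1
  have hconst : EqOn G (fun _ => G 0) U := by
    refine hGa.eqOn_of_preconnected_of_frequently_eq analyticOnNhd_const hcU.isPreconnected
      (z₀ := 0) (by simpa using (hreal 0).1) ?_
    have hseq : Tendsto (fun m : ℕ => ((1 / ((m : ℝ) + 1) : ℝ) : ℂ)) atTop (𝓝[≠] 0) := by
      refine tendsto_nhdsWithin_iff.2 ⟨?_, Eventually.of_forall fun m => ?_⟩
      · have := (Complex.continuous_ofReal.tendsto 0).comp
          (tendsto_one_div_add_atTop_nhds_zero_nat (𝕜 := ℝ))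
        simpa [Function.comp_def] using this
      · simp only [mem_compl_iff, mem_singleton_iff, Complex.ofReal_eq_zero]
        positivity
    exact hseq.frequently (Frequently.of_forall fun m => (hreal _).2)
  have hIU : Complex.I ∈ U := fun j => by rw [hvim]; simpa using hy j
  have hI : G Complex.I = G 0 := hconst hIU
  have hIv : Complex.I • v = fun j => (y j : ℂ) * Complex.I := by
    ext j; simp [hv, mul_comm]
  have h1 : G Complex.I = Real.exp (∑ j, (k j : ℝ) * y j) *
      fourierCoeff (fun θ => g (θ + fun j => (y j : ℂ) * Complex.I)) k := by
    simp only [hG, fourierCoeff]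
    rw [← integral_const_mul]
    refine setIntegral_congr_fun measurableSet_unitCube fun x _ => ?_
    have h2 : expChar (-k) (Complex.I • v) = Real.exp (∑ j, (k j : ℝ) * y j) := by
      rw [expChar, Complex.ofReal_exp]
      congr 1
      push_cast
      rw [Finset.mul_sum]
      refine Finset.sum_congr rfl fun j _ => ?_
      simp only [hv, Pi.neg_apply, Pi.smul_apply, smul_eq_mul, Int.cast_neg]
      linear_combination (-(k j : ℂ) * y j) * Complex.I_mul_I
    simp only [hf]
    rw [expChar_add, h2, hIv]
    ring
  have h2 : G 0 = fourierCoeff g k := by simp [hG, hf, fourierCoeff]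
  rw [← h2, ← hI, h1, ← mul_assoc, ← Complex.ofReal_mul, ← Real.exp_add]
  simp

end IsStripFun

end KAM

/-! ### Weighted Parseval bounds, convergence and truncation of Fourier series -/

namespace KAM

open Metric Set Filter Topology MeasureTheory
variable {n : ℕ}

theorem intNorm_nonneg (k : Fin n → ℤ) : 0 ≤ intNorm k := Finset.sum_nonneg fun _ _ => abs_nonneg _

theorem intNorm_neg (k : Fin n → ℤ) : intNorm (-k) = intNorm k := by simp [intNorm]

theorem one_le_intNorm {k : Fin n → ℤ} (hk : k ≠ 0) : 1 ≤ intNorm k := by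
  obtain ⟨j, hj⟩ := Function.ne_iff.1 hk
  have h1 : (1 : ℝ) ≤ |(k j : ℝ)| := by exact_mod_cast Int.one_le_abs hj
  exact h1.trans (Finset.single_le_sum (f := fun j => |(k j : ℝ)|) (fun _ _ => abs_nonneg _)
    (Finset.mem_univ j))

theorem abs_le_intNorm (k : Fin n → ℤ) (j : Fin n) : |(k j : ℝ)| ≤ intNorm k :=
  Finset.single_le_sum (f := fun j => |(k j : ℝ)|) (fun _ _ => abs_nonneg _) (Finset.mem_univ j)

theorem intNorm_sub_le (k l : Fin n → ℤ) : intNorm (k - l) ≤ intNorm k + intNorm l := by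
  simp only [intNorm, ← Finset.sum_add_distrib]
  refine Finset.sum_le_sum fun j _ => ?_
  simp only [Pi.sub_apply, Int.cast_sub]
  exact abs_sub _ _

theorem finite_intNorm_le (n : ℕ) (K : ℝ) : {k : Fin n → ℤ | intNorm k ≤ K}.Finite := by
  refine (Set.Finite.pi' (t := fun _ : Fin n => (Icc (-⌊K⌋) ⌊K⌋ : Set ℤ))
    fun _ => finite_Icc _ _).subset fun k hk j => ?_
  have h := (abs_le_intNorm k j).trans hk
  rw [mem_Icc, ← abs_le, Int.le_floor]
  exact_mod_cast h

/-- The integer vectors `k` with `|k| ≤ K`. -/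
noncomputable def intBall (n : ℕ) (K : ℝ) : Finset (Fin n → ℤ) := (finite_intNorm_le n K).toFinset

theorem mem_intBall {K : ℝ} {k : Fin n → ℤ} : k ∈ intBall n K ↔ intNorm k ≤ K := by
  simp [intBall]

/-- Two geometric series with ratio `x = e^{-a}`; the inequality `x / (1 - x) ≤ 1 / a` is `1 + a ≤
e^a`. -/
theorem sum_int_exp_le {a : ℝ} (ha : 0 < a) (T : Finset ℤ) :
    ∑ m ∈ T, Real.exp (-(|(m : ℝ)| * a)) ≤ 1 + 2 / a := by
  set x := Real.exp (-a) with hx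
  have hx0 : 0 < x := Real.exp_pos _
  have hx1 : x < 1 := by rw [hx, Real.exp_lt_one_iff]; linarith
  have hpow : ∀ m : ℕ, Real.exp (-((m : ℝ) * a)) = x ^ m := fun m => by
    rw [hx, ← Real.exp_nat_mul]; ring_nf
  have h1 : HasSum (fun m : ℕ => Real.exp (-(|((m : ℤ) : ℝ)| * a))) (1 - x)⁻¹ := by
    have := hasSum_geometric_of_lt_one hx0.le hx1
    refine this.congr_fun fun m => ?_
    rw [Int.cast_natCast, abs_of_nonneg (by positivity), hpow]
  have h2 : HasSum (fun m : ℕ => Real.exp (-(|((-((m : ℤ) + 1) : ℤ) : ℝ)| * a)))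
      (x * (1 - x)⁻¹) := by
    have := (hasSum_geometric_of_lt_one hx0.le hx1).mul_left x
    refine this.congr_fun fun m => ?_
    have : |((-((m : ℤ) + 1) : ℤ) : ℝ)| = ((m + 1 : ℕ) : ℝ) := by
      push_cast; rw [abs_neg, abs_of_nonneg (by positivity)]
    rw [this, hpow, pow_succ']
  have h3 := HasSum.of_nat_of_neg_add_one (f := fun m : ℤ => Real.exp (-(|(m : ℝ)| * a))) h1 h2
  refine (sum_le_hasSum T (fun m _ => (Real.exp_pos _).le) h3).trans ?_
  have h3 : x * (1 + a) ≤ 1 := by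
    have := Real.add_one_le_exp a
    calc x * (1 + a) ≤ x * Real.exp a := by gcongr; linarith
      _ = 1 := by rw [hx, ← Real.exp_add]; simp
  have h4 : 0 < 1 - x := by linarith
  have h5 : (1 - x)⁻¹ + x * (1 - x)⁻¹ = 1 + 2 * (x / (1 - x)) := by field_simp; ring
  have h6 : x / (1 - x) ≤ 1 / a := by rw [div_le_div_iff₀ h4 ha]; linarith
  rw [h5]
  calc 1 + 2 * (x / (1 - x)) ≤ 1 + 2 * (1 / a) := by gcongr
    _ = 1 + 2 / a := by ring

/-- The weight is a product over coordinates, so after enlarging `S` to a box the sum factors into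
one-dimensional ones. -/
theorem sum_exp_intNorm_le {a : ℝ} (ha : 0 < a) (S : Finset (Fin n → ℤ)) :
    ∑ k ∈ S, Real.exp (-(intNorm k * a)) ≤ (1 + 2 / a) ^ n := by
  classical
  set T : Fin n → Finset ℤ := fun j => S.image fun k => k j with hT
  have hsub : S ⊆ Fintype.piFinset T := fun k hk =>
    Fintype.mem_piFinset.2 fun j => Finset.mem_image_of_mem _ hk
  calc ∑ k ∈ S, Real.exp (-(intNorm k * a))
      ≤ ∑ k ∈ Fintype.piFinset T, Real.exp (-(intNorm k * a)) :=
        Finset.sum_le_sum_of_subset_of_nonneg hsub fun _ _ _ => (Real.exp_pos _).le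
    _ = ∑ k ∈ Fintype.piFinset T, ∏ j, Real.exp (-(|(k j : ℝ)| * a)) := by
        refine Finset.sum_congr rfl fun k _ => ?_
        rw [← Real.exp_sum, intNorm, Finset.sum_mul, Finset.sum_neg_distrib]
    _ = ∏ j, ∑ m ∈ T j, Real.exp (-(|(m : ℝ)| * a)) :=
        (Finset.prod_univ_sum T fun _ m => Real.exp (-(|(m : ℝ)| * a))).symm
    _ ≤ ∏ _j : Fin n, (1 + 2 / a) :=
        Finset.prod_le_prod (fun _ _ => Finset.sum_nonneg fun _ _ => (Real.exp_pos _).le)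
          fun j _ => sum_int_exp_le ha _
    _ = (1 + 2 / a) ^ n := by simp

theorem summable_exp_intNorm {a : ℝ} (ha : 0 < a) :
    Summable fun k : Fin n → ℤ => Real.exp (-(intNorm k * a)) :=
  summable_of_sum_le (fun _ => (Real.exp_pos _).le) (sum_exp_intNorm_le ha)

theorem volume_real_unitCube : (volume : Measure (Fin n → ℝ)).real (unitCube n) = 1 := by
  have h1 : unitCube n = univ.pi fun _ => Ioc (0 : ℝ) (0 + 1) := by
    ext x; simp [unitCube]
  rw [Measure.real, h1, volume_pi_pi]
  simp

namespace IsStripFun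

variable {g : CVec n → ℂ} {s M : ℝ}

theorem bound_nonneg (h : IsStripFun g s M) (hs : 0 < s) : 0 ≤ M :=
  (norm_nonneg _).trans (h.bound _ (circleVec_mem_strip hs 0))

/-- Shifting the torus by `±s'` in each imaginary direction multiplies the `k`-th coefficient by
`exp (-⟨k, y⟩)`, and Parseval holds on every shifted torus. For each `k` one of the `2 ^ n` sign
patterns realises the full weight `exp (|k| s')`, so summing over all patterns dominates the
weighted sum. Keeping the sum of squares, rather than single terms, is what later saves powers of
`σ`. -/
theorem sum_sq_exp_le (h : IsStripFun g s M) {s' : ℝ} (hs' : 0 ≤ s') (hss : s' < s)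
    (S : Finset (Fin n → ℤ)) :
    ∑ k ∈ S, (‖fourierCoeff g k‖ * Real.exp (intNorm k * s')) ^ 2 ≤ 2 ^ n * M ^ 2 := by
  set y : (Fin n → Bool) → Fin n → ℝ := fun b j => if b j then s' else -s' with hy
  have hyabs : ∀ b j, |y b j| = s' := fun b j => by
    simp only [hy]; split_ifs <;> simp [abs_of_nonneg hs']
  have hterm : ∀ b k, ‖fourierCoeff (fun θ => g (θ + fun j => (y b j : ℂ) * Complex.I)) k‖ =
      Real.exp (-∑ j, (k j : ℝ) * y b j) * ‖fourierCoeff g k‖ := fun b k => by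
    rw [h.fourierCoeff_shift (fun j => (hyabs b j).trans_lt hss), norm_mul, Complex.norm_real,
      Real.norm_of_nonneg (Real.exp_pos _).le]
  have hb : ∀ b, ∑ k ∈ S, (Real.exp (-∑ j, (k j : ℝ) * y b j) * ‖fourierCoeff g k‖) ^ 2 ≤ M ^ 2 := by
    intro b
    simp only [← hterm]
    refine (h.shift (s' := s - s') ?_).sum_sq_fourierCoeff_le (sub_pos.2 hss) S
    intro θ hθ j
    have h1 : ((θ + fun j => (y b j : ℂ) * Complex.I) j).im = (θ j).im + y b j := by simp
    rw [h1]
    calc _ ≤ |(θ j).im| + |y b j| := abs_add_le _ _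
      _ < s := by rw [hyabs]; linarith [hθ j]
  calc ∑ k ∈ S, (‖fourierCoeff g k‖ * Real.exp (intNorm k * s')) ^ 2
      ≤ ∑ k ∈ S, ∑ b, (Real.exp (-∑ j, (k j : ℝ) * y b j) * ‖fourierCoeff g k‖) ^ 2 := by
        refine Finset.sum_le_sum fun k _ => ?_
        -- The shift is taken positive exactly where `k j ≤ 0`, so that each term `-k_j y_j` equals
        -- `|k_j| s'`.
        have h1 : intNorm k * s' = -∑ j, (k j : ℝ) * y (fun j => decide (k j ≤ 0)) j := by
          rw [intNorm, Finset.sum_mul, ← Finset.sum_neg_distrib]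
          refine Finset.sum_congr rfl fun j _ => ?_
          simp only [hy, decide_eq_true_eq]
          split_ifs with hk
          · rw [abs_of_nonpos (by exact_mod_cast hk)]; ring
          · rw [abs_of_pos (by exact_mod_cast not_le.1 hk)]; ring
        rw [h1, mul_comm]
        exact Finset.single_le_sum
          (f := fun b => (Real.exp (-∑ j, (k j : ℝ) * y b j) * ‖fourierCoeff g k‖) ^ 2)
          (fun _ _ => by positivity) (Finset.mem_univ _)
    _ = ∑ b, ∑ k ∈ S, (Real.exp (-∑ j, (k j : ℝ) * y b j) * ‖fourierCoeff g k‖) ^ 2 :=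
        Finset.sum_comm
    _ ≤ ∑ _b : Fin n → Bool, M ^ 2 := Finset.sum_le_sum fun b _ => hb b
    _ = 2 ^ n * M ^ 2 := by simp

theorem norm_fourierCoeff_le (h : IsStripFun g s M) {s' : ℝ} (hs' : 0 ≤ s') (hss : s' < s)
    (k : Fin n → ℤ) : ‖fourierCoeff g k‖ ≤ 2 ^ n * M * Real.exp (-(intNorm k * s')) := by
  have hM := h.bound_nonneg (hs'.trans_lt hss)
  have h1 := h.sum_sq_exp_le hs' hss {k}
  rw [Finset.sum_singleton] at h1
  have h2 : (2 : ℝ) ^ n * M ^ 2 ≤ (2 ^ n * M) ^ 2 := by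
    rw [mul_pow]
    gcongr
    have : (1 : ℝ) ≤ 2 ^ n := one_le_pow₀ (by norm_num)
    nlinarith
  have h3 := (sq_le_sq₀ (by positivity) (by positivity)).1 (h1.trans h2)
  rw [Real.exp_neg, ← div_eq_mul_inv, le_div_iff₀ (Real.exp_pos _)]
  exact h3

theorem norm_term_le (h : IsStripFun g s M) {s' t a : ℝ} (hs' : 0 ≤ s') (hss : s' < s)
    (hta : t + a ≤ s') {θ : CVec n} (hθ : θ ∈ strip n t) (k : Fin n → ℤ) :
    ‖fourierCoeff g k * expChar k θ‖ ≤ 2 ^ n * M * Real.exp (-(intNorm k * a)) := by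
  have hM := h.bound_nonneg (hs'.trans_lt hss)
  rw [norm_mul]
  calc _ ≤ (2 ^ n * M * Real.exp (-(intNorm k * s'))) * Real.exp (intNorm k * t) := by
        gcongr
        · exact h.norm_fourierCoeff_le hs' hss k
        · exact norm_expChar_le hθ
    _ = 2 ^ n * M * Real.exp (-(intNorm k * (s' - t))) := by
        rw [mul_assoc, ← Real.exp_add]; ring_nf
    _ ≤ _ := by
        gcongr
        · exact intNorm_nonneg k
        · linarith

/-- The torus is shifted so as to pass through `θ`. The shifted function is still analytic on the
strip of width `s - t`, with `t` the largest `|Im θ_j|`, hence its coefficients are summable and its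
Fourier series converges pointwise. -/
theorem hasSum_fourier (h : IsStripFun g s M) {θ : CVec n} (hθ : θ ∈ strip n s) :
    HasSum (fun k => fourierCoeff g k * expChar k θ) (g θ) := by
  rcases isEmpty_or_nonempty (Fin n) with hemp | hne
  · have hu : ∀ k : Fin n → ℤ, k = 0 := fun k => Subsingleton.elim _ _
    have hθ0 : ∀ x, circleVec x = θ := fun x => Subsingleton.elim _ _
    have h1 : fourierCoeff g 0 * expChar 0 θ = g θ := by
      simp only [fourierCoeff, hθ0, neg_zero, expChar_zero_left, one_mul, mul_one]
      rw [setIntegral_const, volume_real_unitCube, one_smul]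
    rw [← h1]
    exact hasSum_single 0 fun k hk => absurd (hu k) hk
  obtain ⟨t, ht0, hts, hθt⟩ : ∃ t, 0 ≤ t ∧ t < s ∧ ∀ j, |(θ j).im| ≤ t := by
    refine ⟨Finset.univ.sup' Finset.univ_nonempty fun j => |(θ j).im|, ?_, ?_, fun j =>
      Finset.le_sup' (fun j => |(θ j).im|) (Finset.mem_univ j)⟩
    · obtain ⟨j⟩ := hne
      exact (abs_nonneg _).trans (Finset.le_sup' (fun j => |(θ j).im|) (Finset.mem_univ j))
    · rw [Finset.sup'_lt_iff]; exact fun j _ => hθ j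
  set y : Fin n → ℝ := fun j => (θ j).im
  set x : Fin n → ℝ := fun j => (θ j).re / (2 * Real.pi) with hx
  have hθxy : θ = circleVec x + fun j => (y j : ℂ) * Complex.I := by
    ext j
    have := Real.pi_ne_zero
    have h1 : 2 * Real.pi * x j = (θ j).re := by simp only [hx]; field_simp
    simp only [Pi.add_apply, circleVec, h1]
    exact (Complex.re_add_im _).symm
  have hsh : IsStripFun (fun θ => g (θ + fun j => (y j : ℂ) * Complex.I)) (s - t) M := by
    refine h.shift fun ψ hψ j => ?_
    have h1 : ((ψ + fun j => (y j : ℂ) * Complex.I) j).im = (ψ j).im + y j := by simp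
    rw [h1]
    calc _ ≤ |(ψ j).im| + |y j| := abs_add_le _ _
      _ < s := by linarith [hψ j, hθt j]
  have hst : 0 < s - t := sub_pos.2 hts
  have hp := hsh.periodic_circleVec hst
  set f : C(UnitAddTorus (Fin n), ℂ) :=
    ⟨torusFun fun θ => g (θ + fun j => (y j : ℂ) * Complex.I),
      continuous_torusFun hp (hsh.continuous_circleVec hst)⟩
  have hcoef : ∀ k, UnitAddTorus.mFourierCoeff f k =
      Real.exp (-∑ j, (k j : ℝ) * y j) * fourierCoeff g k := fun k => by
    rw [← h.fourierCoeff_shift (y := y) hθ k, ← mFourierCoeff_torusFun hp]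
    rfl
  have hsum : Summable (UnitAddTorus.mFourierCoeff f) := by
    refine Summable.of_norm_bounded (g := fun k => 2 ^ n * M *
      Real.exp (-(intNorm k * ((s - t) / 2)))) ((summable_exp_intNorm (by linarith)).mul_left _)
      fun k => ?_
    have h2 := hsh.norm_fourierCoeff_le (s' := (s - t) / 2) (by linarith) (by linarith) k
    rw [h.fourierCoeff_shift (y := y) hθ k, ← hcoef] at h2
    exact h2
  have h3 := UnitAddTorus.hasSum_mFourier_series_apply_of_summable hsum
    (fun i => (x i : UnitAddCircle))
  have h4 : f (fun i => (x i : UnitAddCircle)) = g θ := by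
    rw [hθxy]
    exact torusFun_coe (g := fun θ => g (θ + fun j => (y j : ℂ) * Complex.I)) hp x
  rw [h4] at h3
  refine h3.congr_fun fun k => ?_
  rw [hcoef, ← expChar_circleVec, smul_eq_mul]
  nth_rw 1 [hθxy]
  have h5 : expChar k (fun j => (y j : ℂ) * Complex.I) = Real.exp (-∑ j, (k j : ℝ) * y j) := by
    rw [expChar, Complex.ofReal_exp]
    congr 1
    push_cast
    rw [Finset.mul_sum, ← Finset.sum_neg_distrib]
    refine Finset.sum_congr rfl fun j _ => ?_
    linear_combination ((k j : ℂ) * y j) * Complex.I_mul_I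
  rw [expChar_add, h5]
  ring

/-- Coefficients are estimated with decay rate `s - σ / 2` at points of the strip of width `s - 2 *
σ`, so each term decays like `e^{-|k|(σ + σ/2)}`. The part `σ` gives `e^{-Kσ}` for `|k| > K`; the
part `σ / 2` makes the tail summable. -/
theorem norm_sub_trunc_le (h : IsStripFun g s M) {σ K : ℝ} (hσ : 0 < σ) (hs : 2 * σ < s)
    {θ : CVec n} (hθ : θ ∈ strip n (s - 2 * σ)) :
    ‖g θ - ∑ k ∈ intBall n K, fourierCoeff g k * expChar k θ‖ ≤
      2 ^ n * (1 + 4 / σ) ^ n * M * Real.exp (-(K * σ)) := by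
  have hM := h.bound_nonneg (by linarith)
  have hsum := h.hasSum_fourier (strip_mono (by linarith) hθ)
  have hlim := (hsum.sub_const (∑ k ∈ intBall n K, fourierCoeff g k * expChar k θ)).norm
  refine le_of_tendsto hlim ?_
  filter_upwards [eventually_ge_atTop (intBall n K)] with T hT
  classical
  rw [← Finset.sum_sdiff_eq_sub hT]
  calc _ ≤ ∑ k ∈ T \ intBall n K, ‖fourierCoeff g k * expChar k θ‖ := norm_sum_le _ _
    _ ≤ ∑ k ∈ T \ intBall n K, 2 ^ n * M * Real.exp (-(K * σ)) *
          Real.exp (-(intNorm k * (σ / 2))) := by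
        refine Finset.sum_le_sum fun k hk => ?_
        have hk' : K < intNorm k := by
          by_contra hcon
          exact (Finset.mem_sdiff.1 hk).2 (mem_intBall.2 (not_lt.1 hcon))
        refine (h.norm_term_le (s' := s - σ / 2) (t := s - 2 * σ) (a := σ + σ / 2)
          (by linarith) (by linarith) (by linarith) hθ k).trans ?_
        rw [mul_assoc, mul_assoc, mul_assoc (2 ^ n), ← Real.exp_add]
        gcongr
        nlinarith
    _ ≤ 2 ^ n * M * Real.exp (-(K * σ)) * (1 + 2 / (σ / 2)) ^ n := by
        rw [← Finset.mul_sum]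
        gcongr
        exact sum_exp_intNorm_le (by linarith) _
    _ = _ := by
        have : 2 / (σ / 2) = 4 / σ := by field_simp; norm_num
        rw [this]; ring

end IsStripFun

end KAM

/-! ### Small divisors and the bound for the homological equation -/

namespace KAM

open Metric Set Filter Topology
variable {n : ℕ}

/-- Small divisors are well separated; hence the sum of their inverse squares is of the order of
the largest term. -/
theorem sum_inv_sq_divisor_le {α τ m : ℝ} (hα : 0 < α) (hτ : 0 ≤ τ) {ω : Fin n → ℝ}
    (hω : ω ∈ diophantineSet n α τ) {S : Finset (Fin n → ℤ)}
    (hS : ∀ k ∈ S, k ≠ 0 ∧ intNorm k ≤ m) :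
    ∑ k ∈ S, 1 / (∑ j, (k j : ℝ) * ω j) ^ 2 ≤
      4 * (∑' j : ℤ, 1 / (j : ℝ) ^ 2) * ((2 * m) ^ τ / α) ^ 2 := by
  classical
  rcases S.eq_empty_or_nonempty with rfl | ⟨k₀, hk₀⟩
  · simp only [Finset.sum_empty]
    have : 0 ≤ ∑' j : ℤ, 1 / (j : ℝ) ^ 2 := tsum_nonneg fun _ => by positivity
    positivity
  have hm : 1 ≤ m := (one_le_intNorm (hS k₀ hk₀).1).trans (hS k₀ hk₀).2
  -- This is the Diophantine lower bound for all `|k| ≤ 2m`, the range that contains every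
  -- difference of two elements of `S`. Measured in units of `δ`, the divisors are at distance at
  -- least one from zero and from each other.
  set δ := α / (2 * m) ^ τ with hδ
  have hpow : 0 < (2 * m) ^ τ := Real.rpow_pos_of_pos (by linarith) τ
  have hδ0 : 0 < δ := by positivity
  set x : (Fin n → ℤ) → ℝ := fun k => (∑ j, (k j : ℝ) * ω j) / δ with hx
  have hsep : ∀ k : Fin n → ℤ, k ≠ 0 → intNorm k ≤ 2 * m → 1 ≤ |x k| := by
    intro k hk hkm
    rw [hx, abs_div, abs_of_pos hδ0, one_le_div hδ0]
    refine le_trans ?_ (hω k hk)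
    have h1 := one_le_intNorm hk
    have h2 : 0 < intNorm k ^ τ := Real.rpow_pos_of_pos (by linarith) τ
    rw [hδ]
    gcongr
  have hxsub : ∀ k l, x (k - l) = x k - x l := by
    intro k l
    simp only [hx, ← sub_div, ← Finset.sum_sub_distrib, Pi.sub_apply, Int.cast_sub, sub_mul]
  -- Numbers at mutual distance at least one have distinct integer parts, so the sum is compared
  -- with `∑ 1 / j²` over distinct integers.
  have hinj : Set.InjOn (fun k => ⌊x k⌋) S := by
    intro k hk l hl hkl
    by_contra hne
    have h1 := hsep (k - l) (sub_ne_zero.2 hne)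
      ((intNorm_sub_le k l).trans (by linarith [(hS k hk).2, (hS l hl).2]))
    rw [hxsub] at h1
    have h2 := Int.abs_sub_lt_one_of_floor_eq_floor hkl
    linarith
  have hterm : ∀ k ∈ S, 1 / (∑ j, (k j : ℝ) * ω j) ^ 2 ≤
      4 * ((2 * m) ^ τ / α) ^ 2 * (1 / ((⌊x k⌋ : ℤ) : ℝ) ^ 2) := by
    intro k hk
    have h1 := hsep k (hS k hk).1 (by linarith [(hS k hk).2])
    have h2 : (∑ j, (k j : ℝ) * ω j) = x k * δ := by simp only [hx]; field_simp
    have h3 : ((2 * m) ^ τ / α) = 1 / δ := by rw [hδ]; field_simp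
    -- Since `|x k| ≥ 1`, passing to the integer part at most doubles the absolute value and never
    -- gives zero. The square of this loss is the factor 4.
    have h4 : |((⌊x k⌋ : ℤ) : ℝ)| ≤ 2 * |x k| := by
      have h5 := Int.floor_le (x k)
      have h6 := Int.lt_floor_add_one (x k)
      have h7 := neg_abs_le (x k)
      have h8 := le_abs_self (x k)
      rw [abs_le]
      constructor <;> linarith
    have h5 : ((⌊x k⌋ : ℤ) : ℝ) ≠ 0 := by
      intro h0
      have h6 : ⌊x k⌋ = 0 := by exact_mod_cast h0
      rw [Int.floor_eq_zero_iff] at h6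
      rw [abs_of_nonneg h6.1] at h1
      linarith [h6.2]
    have h6 : ((⌊x k⌋ : ℤ) : ℝ) ^ 2 ≤ 4 * x k ^ 2 := by
      have := pow_le_pow_left₀ (abs_nonneg _) h4 2
      rw [mul_pow, sq_abs, sq_abs] at this
      linarith
    have h7 : 0 < ((⌊x k⌋ : ℤ) : ℝ) ^ 2 := by positivity
    have h8 : 0 < x k ^ 2 := by nlinarith
    rw [h2, h3]
    generalize x k = y at *
    rw [show 4 * (1 / δ) ^ 2 * (1 / ((⌊y⌋ : ℤ) : ℝ) ^ 2) =
      4 / (δ ^ 2 * ((⌊y⌋ : ℤ) : ℝ) ^ 2) by field_simp]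
    have h9 : 0 < (y * δ) ^ 2 := by rw [mul_pow]; exact mul_pos h8 (by positivity)
    rw [div_le_div_iff₀ h9 (by positivity)]
    nlinarith [sq_nonneg δ]
  calc _ ≤ ∑ k ∈ S, 4 * ((2 * m) ^ τ / α) ^ 2 * (1 / ((⌊x k⌋ : ℤ) : ℝ) ^ 2) :=
        Finset.sum_le_sum hterm
    _ = 4 * ((2 * m) ^ τ / α) ^ 2 * ∑ j ∈ S.image (fun k => ⌊x k⌋), 1 / (j : ℝ) ^ 2 := by
        rw [Finset.sum_image hinj, Finset.mul_sum]
    _ ≤ 4 * ((2 * m) ^ τ / α) ^ 2 * ∑' j : ℤ, 1 / (j : ℝ) ^ 2 := by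
        gcongr
        exact Summable.sum_le_tsum _ (fun _ _ => by positivity)
          (Real.summable_one_div_int_pow.2 one_lt_two)
    _ = _ := by ring

theorem summable_exp_mul_rpow (τ : ℝ) :
    Summable fun j : ℕ => Real.exp (-(j : ℝ)) * ((j : ℝ) + 1) ^ (2 * τ) := by
  obtain ⟨N, hN⟩ := exists_nat_ge (2 * τ)
  have h := (Real.summable_pow_mul_exp_neg_nat_mul N (r := 1) one_pos)
  have h1 := ((summable_nat_add_iff 1).2 h).mul_left (Real.exp 1)
  refine Summable.of_nonneg_of_le (fun _ => by positivity) (fun j => ?_) h1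
  have h2 : ((j : ℝ) + 1) ^ (2 * τ) ≤ ((j : ℝ) + 1) ^ N := by
    rw [← Real.rpow_natCast]
    exact Real.rpow_le_rpow_of_exponent_le (by linarith [j.cast_nonneg (α := ℝ)]) hN
  have h3 : Real.exp (-(j : ℝ)) = Real.exp 1 * Real.exp (-1 * ((j + 1 : ℕ) : ℝ)) := by
    rw [← Real.exp_add]; push_cast; ring_nf
  rw [h3, mul_assoc]
  push_cast
  rw [mul_comm (((j : ℝ) + 1) ^ N)]
  gcongr

/-- The constant in the estimate of the weighted sum of inverse squares of small divisors. -/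
noncomputable def divisorConst (τ : ℝ) : ℝ :=
  4 * (∑' j : ℤ, 1 / (j : ℝ) ^ 2) * ∑' j : ℕ, Real.exp (-(j : ℝ)) * ((j : ℝ) + 1) ^ (2 * τ)

theorem divisorConst_nonneg (τ : ℝ) : 0 ≤ divisorConst τ := by
  have h1 : 0 ≤ ∑' j : ℤ, 1 / (j : ℝ) ^ 2 := tsum_nonneg fun _ => by positivity
  have h2 : 0 ≤ ∑' j : ℕ, Real.exp (-(j : ℝ)) * ((j : ℝ) + 1) ^ (2 * τ) :=
    tsum_nonneg fun _ => by positivity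
  unfold divisorConst; positivity

/-- The sum is split into shells on which the integer part of `2|k|σ` is `i`. There `|k| ≤ (i + 1) /
(2σ)`, so the inverse squares add up to at most a constant times `((i + 1)^τ / (α σ^τ))²`, and the
weight `e^{-i}` makes the sum over shells finite, independently of `σ`. -/
theorem sum_exp_div_sq_divisor_le {α τ σ : ℝ} (hα : 0 < α) (hτ : 0 ≤ τ) (hσ : 0 < σ)
    {ω : Fin n → ℝ} (hω : ω ∈ diophantineSet n α τ) {S : Finset (Fin n → ℤ)}
    (hS : ∀ k ∈ S, k ≠ 0) :
    ∑ k ∈ S, Real.exp (-(2 * (intNorm k * σ))) / (∑ j, (k j : ℝ) * ω j) ^ 2 ≤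
      divisorConst τ / (α * σ ^ τ) ^ 2 := by
  classical
  set C := 4 * (∑' j : ℤ, 1 / (j : ℝ) ^ 2) with hC
  have hC0 : 0 ≤ C := by
    have h1 : 0 ≤ ∑' j : ℤ, 1 / (j : ℝ) ^ 2 := tsum_nonneg fun _ => by positivity
    positivity
  set f : (Fin n → ℤ) → ℕ := fun k => ⌊2 * (intNorm k * σ)⌋₊ with hf
  have hpos : ∀ k : Fin n → ℤ, 0 ≤ 2 * (intNorm k * σ) := fun k =>
    mul_nonneg zero_le_two (mul_nonneg (intNorm_nonneg k) hσ.le)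
  have hστ : 0 < σ ^ τ := Real.rpow_pos_of_pos hσ τ
  calc ∑ k ∈ S, Real.exp (-(2 * (intNorm k * σ))) / (∑ j, (k j : ℝ) * ω j) ^ 2
      ≤ ∑ k ∈ S, Real.exp (-(f k : ℝ)) * (1 / (∑ j, (k j : ℝ) * ω j) ^ 2) := by
        refine Finset.sum_le_sum fun k _ => ?_
        rw [div_eq_mul_one_div]
        gcongr
        exact Nat.floor_le (hpos k)
    _ = ∑ i ∈ S.image f, ∑ k ∈ S with f k = i,
          Real.exp (-(f k : ℝ)) * (1 / (∑ j, (k j : ℝ) * ω j) ^ 2) :=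
        (Finset.sum_fiberwise_of_maps_to (fun k hk => Finset.mem_image_of_mem f hk) _).symm
    _ ≤ ∑ i ∈ S.image f, C * (Real.exp (-(i : ℝ)) * ((i : ℝ) + 1) ^ (2 * τ)) /
          (α * σ ^ τ) ^ 2 := by
        refine Finset.sum_le_sum fun i _ => ?_
        have h1 : ∑ k ∈ S with f k = i, Real.exp (-(f k : ℝ)) *
            (1 / (∑ j, (k j : ℝ) * ω j) ^ 2) = Real.exp (-(i : ℝ)) *
            ∑ k ∈ S with f k = i, 1 / (∑ j, (k j : ℝ) * ω j) ^ 2 := by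
          rw [Finset.mul_sum]
          refine Finset.sum_congr rfl fun k hk => ?_
          rw [(Finset.mem_filter.1 hk).2]
        have h2 := sum_inv_sq_divisor_le (m := ((i : ℝ) + 1) / (2 * σ)) hα hτ hω
          (S := S.filter fun k => f k = i) (fun k hk => by
            obtain ⟨hkS, hki⟩ := Finset.mem_filter.1 hk
            refine ⟨hS k hkS, ?_⟩
            have := Nat.lt_floor_add_one (2 * (intNorm k * σ))
            rw [le_div_iff₀ (by positivity), ← hki]
            linarith)
        have h3 : (2 * (((i : ℝ) + 1) / (2 * σ))) ^ τ = ((i : ℝ) + 1) ^ τ / σ ^ τ := by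
          rw [← Real.div_rpow (by positivity) hσ.le]
          congr 1
          field_simp
        have h4 : ((i : ℝ) + 1) ^ (2 * τ) = (((i : ℝ) + 1) ^ τ) ^ 2 := by
          rw [← Real.rpow_natCast, ← Real.rpow_mul (by positivity)]
          congr 1; push_cast; ring
        rw [h3] at h2
        rw [h1]
        calc _ ≤ Real.exp (-(i : ℝ)) * (C * (((i : ℝ) + 1) ^ τ / σ ^ τ / α) ^ 2) := by gcongr
          _ = _ := by rw [h4]; field_simp
    _ = C / (α * σ ^ τ) ^ 2 *
          ∑ i ∈ S.image f, Real.exp (-(i : ℝ)) * ((i : ℝ) + 1) ^ (2 * τ) := by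
        rw [Finset.mul_sum]
        exact Finset.sum_congr rfl fun i _ => by ring
    _ ≤ C / (α * σ ^ τ) ^ 2 * ∑' i : ℕ, Real.exp (-(i : ℝ)) * ((i : ℝ) + 1) ^ (2 * τ) := by
        gcongr
        exact Summable.sum_le_tsum _ (fun _ _ => by positivity) (summable_exp_mul_rpow τ)
    _ = _ := by rw [divisorConst]; ring

/-- The small divisor `⟨k, ω⟩` for complex frequencies. -/
def divisor (k : Fin n → ℤ) (ω : CVec n) : ℂ := ∑ j, (k j : ℂ) * ω j

/-- Moving the frequency by less than `h` changes the divisor by at most `|k| h ≤ α / (2|k|^τ)` when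
`|k| ≤ K`, that is, by at most half of its Diophantine lower bound. This is the role of condition
(c), and the reason for truncating. -/
theorem half_le_norm_divisor {α τ h K : ℝ} (hτ : 0 ≤ τ) (hα : 0 < α)
    (hh : h ≤ α / (2 * K ^ (τ + 1))) {ω₀ : Fin n → ℝ} (hω₀ : ω₀ ∈ diophantineSet n α τ)
    {ω : CVec n} (hω : ‖ω - fun j => (ω₀ j : ℂ)‖ < h) {k : Fin n → ℤ} (hk : k ≠ 0)
    (hkK : intNorm k ≤ K) :
    |∑ j, (k j : ℝ) * ω₀ j| / 2 ≤ ‖divisor k ω‖ := by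
  have hk1 := one_le_intNorm hk
  have hk0 : 0 < intNorm k := by linarith
  have h1 : divisor k ω = ((∑ j, (k j : ℝ) * ω₀ j : ℝ) : ℂ) +
      ∑ j, (k j : ℂ) * (ω j - ω₀ j) := by
    rw [divisor]; push_cast
    rw [← Finset.sum_add_distrib]
    exact Finset.sum_congr rfl fun j _ => by ring
  have h2 : ‖∑ j, (k j : ℂ) * (ω j - ω₀ j)‖ ≤ intNorm k * h := by
    rw [intNorm, Finset.sum_mul]
    refine (norm_sum_le _ _).trans (Finset.sum_le_sum fun j _ => ?_)
    rw [norm_mul, Complex.norm_intCast]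
    gcongr
    exact (norm_le_pi_norm (ω - fun j => (ω₀ j : ℂ)) j).trans hω.le
  have h3 : intNorm k * h ≤ |∑ j, (k j : ℝ) * ω₀ j| / 2 := by
    have h4 := hω₀ k hk
    have h5 : intNorm k * h ≤ intNorm k * (α / (2 * intNorm k ^ (τ + 1))) := by
      refine mul_le_mul_of_nonneg_left (hh.trans ?_) hk0.le
      have : 0 < intNorm k ^ (τ + 1) := Real.rpow_pos_of_pos hk0 _
      gcongr
    have h6 : intNorm k * (α / (2 * intNorm k ^ (τ + 1))) = α / intNorm k ^ τ / 2 := by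
      rw [Real.rpow_add hk0, Real.rpow_one]
      have : 0 < intNorm k ^ τ := Real.rpow_pos_of_pos hk0 _
      field_simp
    linarith
  have h7 : |∑ j, (k j : ℝ) * ω₀ j| ≤ ‖divisor k ω‖ + intNorm k * h := by
    have h8 : ((∑ j, (k j : ℝ) * ω₀ j : ℝ) : ℂ) = divisor k ω -
      ∑ j, (k j : ℂ) * (ω j - ω₀ j) := by rw [h1]; ring
    rw [← Real.norm_eq_abs, ← Complex.norm_real, h8]
    exact (norm_sub_le _ _).trans (by gcongr)
  linarith

theorem divisor_ne_zero {α τ h K : ℝ} (hτ : 0 ≤ τ) (hα : 0 < α)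
    (hh : h ≤ α / (2 * K ^ (τ + 1))) {ω₀ : Fin n → ℝ} (hω₀ : ω₀ ∈ diophantineSet n α τ)
    {ω : CVec n} (hω : ‖ω - fun j => (ω₀ j : ℂ)‖ < h) {k : Fin n → ℤ} (hk : k ≠ 0)
    (hkK : intNorm k ≤ K) : divisor k ω ≠ 0 := by
  have h1 := half_le_norm_divisor hτ hα hh hω₀ hω hk hkK
  have h2 := hω₀ k hk
  have h3 : 0 < α / intNorm k ^ τ :=
    div_pos hα (Real.rpow_pos_of_pos (by linarith [one_le_intNorm hk]) _)
  rw [← norm_pos_iff]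
  linarith

/-- The solution of the truncated homological equation is bounded with the optimal power of the
loss `σ` of analyticity. -/
theorem IsStripFun.norm_homological_le {g : CVec n → ℂ} {s M : ℝ} (hg : IsStripFun g s M)
    {α τ σ h K : ℝ} (hα : 0 < α) (hτ : 0 ≤ τ) (hσ : 0 < σ) (hs : 2 * σ < s)
    (hh : h ≤ α / (2 * K ^ (τ + 1)))
    {ω₀ : Fin n → ℝ} (hω₀ : ω₀ ∈ diophantineSet n α τ)
    {ω : CVec n} (hω : ‖ω - fun j => (ω₀ j : ℂ)‖ < h) {θ : CVec n}
    (hθ : θ ∈ strip n (s - 2 * σ)) :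
    ‖∑ k ∈ (intBall n K).erase 0, fourierCoeff g k / (Complex.I * divisor k ω) * expChar k θ‖ ≤
      2 * Real.sqrt (2 ^ n * divisorConst τ) * M / (α * σ ^ τ) := by
  set S := (intBall n K).erase 0 with hS
  have hS' : ∀ k ∈ S, k ≠ 0 ∧ intNorm k ≤ K := fun k hk =>
    ⟨(Finset.mem_erase.1 hk).1, mem_intBall.1 (Finset.mem_erase.1 hk).2⟩
  have hM := hg.bound_nonneg (by linarith)
  have hστ : 0 < σ ^ τ := Real.rpow_pos_of_pos hσ τ
  -- The loss of `2σ` is split in halves for Cauchy–Schwarz: one `σ` goes to the weighted Parseval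
  -- sum at width `s - σ`, the other damps the small divisors.
  set a : (Fin n → ℤ) → ℝ := fun k => ‖fourierCoeff g k‖ * Real.exp (intNorm k * (s - σ))
  set b : (Fin n → ℤ) → ℝ := fun k =>
    Real.exp (-(intNorm k * σ)) / |∑ j, (k j : ℝ) * ω₀ j|
  have h1 : ‖∑ k ∈ S, fourierCoeff g k / (Complex.I * divisor k ω) * expChar k θ‖ ≤
      2 * ∑ k ∈ S, a k * b k := by
    rw [Finset.mul_sum]
    refine (norm_sum_le _ _).trans (Finset.sum_le_sum fun k hk => ?_)
    obtain ⟨hk0, hkK⟩ := hS' k hk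
    have h2 := half_le_norm_divisor hτ hα hh hω₀ hω hk0 hkK
    have h3 : 0 < |∑ j, (k j : ℝ) * ω₀ j| := (div_pos hα (Real.rpow_pos_of_pos
      (by linarith [one_le_intNorm hk0]) _)).trans_le (hω₀ k hk0)
    rw [norm_mul, norm_div, norm_mul, Complex.norm_I, one_mul]
    calc ‖fourierCoeff g k‖ / ‖divisor k ω‖ * ‖expChar k θ‖
        ≤ ‖fourierCoeff g k‖ / (|∑ j, (k j : ℝ) * ω₀ j| / 2) *
            Real.exp (intNorm k * (s - 2 * σ)) := by
          gcongr
          exact norm_expChar_le hθ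
      _ = 2 * (a k * b k) := by
          have h4 : Real.exp (intNorm k * (s - 2 * σ)) =
              Real.exp (intNorm k * (s - σ)) * Real.exp (-(intNorm k * σ)) := by
            rw [← Real.exp_add]; ring_nf
          simp only [a, b, h4]
          field_simp
  have h2 : ∑ k ∈ S, a k ^ 2 ≤ 2 ^ n * M ^ 2 :=
    hg.sum_sq_exp_le (s' := s - σ) (by linarith) (by linarith) S
  have h3 : ∑ k ∈ S, b k ^ 2 ≤ divisorConst τ / (α * σ ^ τ) ^ 2 := by
    refine le_trans (Finset.sum_le_sum fun k _ => le_of_eq ?_)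
      (sum_exp_div_sq_divisor_le hα hτ hσ hω₀ (S := S) fun k hk => (hS' k hk).1)
    simp only [b]
    rw [div_pow, sq_abs, ← Real.exp_nat_mul]
    congr 2; push_cast; ring
  have h4 : ∑ k ∈ S, a k * b k ≤ Real.sqrt (2 ^ n * divisorConst τ) * M / (α * σ ^ τ) := by
    refine (Real.sum_mul_le_sqrt_mul_sqrt S a b).trans ?_
    calc _ ≤ √(2 ^ n * M ^ 2) * √(divisorConst τ / (α * σ ^ τ) ^ 2) := by gcongr
      _ = _ := by
        have := divisorConst_nonneg τ
        rw [← Real.sqrt_mul (by positivity), show 2 ^ n * M ^ 2 * (divisorConst τ /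
          (α * σ ^ τ) ^ 2) = (2 ^ n * divisorConst τ) * (M / (α * σ ^ τ)) ^ 2 by field_simp,
          Real.sqrt_mul (by positivity), Real.sqrt_sq (by positivity)]
        ring
  calc _ ≤ 2 * ∑ k ∈ S, a k * b k := h1
    _ ≤ 2 * (Real.sqrt (2 ^ n * divisorConst τ) * M / (α * σ ^ τ)) := by gcongr
    _ = _ := by ring

end KAM

/-! ### Curves on the unit interval, integration, and characters along curves -/

namespace KAM

open Metric Set Filter Topology
variable {n : ℕ}

section Volterra

section

variable {V : Type*} [NormedAddCommGroup V]

/-- The extension of a curve on the unit interval to the real line. -/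
noncomputable def extendCurve (f : C(unitInterval, V)) (s : ℝ) : V := f (projIcc 0 1 zero_le_one s)

theorem continuous_extendCurve (f : C(unitInterval, V)) : Continuous (extendCurve f) :=
  f.continuous.comp continuous_projIcc

theorem extendCurve_coe (f : C(unitInterval, V)) (t : unitInterval) : extendCurve f t = f t := by
  simp [extendCurve]

theorem norm_extendCurve_le (f : C(unitInterval, V)) (s : ℝ) : ‖extendCurve f s‖ ≤ ‖f‖ :=
  f.norm_coe_le_norm _

theorem norm_curve_le {f : C(unitInterval, V)} {C : ℝ} (h : ∀ t, ‖f t‖ ≤ C) : ‖f‖ ≤ C :=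
  (ContinuousMap.norm_le f ((norm_nonneg _).trans (h 0))).2 h

end

variable {V : Type*} [NormedAddCommGroup V] [NormedSpace ℝ V] [NormedSpace ℂ V]
  [SMulCommClass ℝ ℂ V]

/-- Integration of curves on the unit interval. -/
noncomputable def volterra (V : Type*) [NormedAddCommGroup V] [NormedSpace ℝ V] [NormedSpace ℂ V]
    [SMulCommClass ℝ ℂ V] : C(unitInterval, V) →L[ℂ] C(unitInterval, V) :=
  LinearMap.mkContinuous
    { toFun := fun f => ⟨fun t => ∫ s in (0 : ℝ)..t, extendCurve f s,
        (intervalIntegral.continuous_primitive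
          (fun a b => (continuous_extendCurve f).intervalIntegrable a b) 0).comp
          continuous_subtype_val⟩
      map_add' := fun f g => by
        ext t
        exact intervalIntegral.integral_add ((continuous_extendCurve f).intervalIntegrable _ _)
          ((continuous_extendCurve g).intervalIntegrable _ _)
      map_smul' := fun c f => by
        ext t
        exact intervalIntegral.integral_smul c _ } 1 (fun f => by
      refine (ContinuousMap.norm_le _ (by positivity)).2 fun t => ?_
      have h := intervalIntegral.norm_integral_le_of_norm_le_const (a := (0 : ℝ)) (b := t)
        (f := extendCurve f) (C := ‖f‖) fun s _ => norm_extendCurve_le f s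
      refine h.trans ?_
      rw [sub_zero, abs_of_nonneg t.2.1, one_mul]
      exact mul_le_of_le_one_right (norm_nonneg _) t.2.2)

theorem volterra_apply (f : C(unitInterval, V)) (t : unitInterval) :
    volterra V f t = ∫ s in (0 : ℝ)..t, extendCurve f s := rfl

theorem norm_volterra_le (f : C(unitInterval, V)) : ‖volterra V f‖ ≤ ‖f‖ := by
  have h := (volterra V).le_of_opNorm_le
    (LinearMap.mkContinuous_norm_le _ zero_le_one _) f
  simpa using h

/-- A curve that satisfies an integral equation solves the corresponding differential equation. -/
theorem hasDerivWithinAt_extendCurve [CompleteSpace V] {f g : C(unitInterval, V)} {v : V}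
    (h : f = ContinuousMap.const unitInterval v + volterra V g) {t : ℝ} (ht : t ∈ Icc (0 : ℝ) 1) :
    HasDerivWithinAt (extendCurve f) (g ⟨t, ht⟩) (Icc 0 1) t := by
  have h1 : HasDerivAt (fun t => v + ∫ s in (0 : ℝ)..t, extendCurve g s) (extendCurve g t) t :=
    (intervalIntegral.integral_hasDerivAt_right
      ((continuous_extendCurve g).intervalIntegrable _ _)
      ((continuous_extendCurve g).stronglyMeasurableAtFilter _ _)
      (continuous_extendCurve g).continuousAt).const_add v
  have h2 : extendCurve g t = g ⟨t, ht⟩ := extendCurve_coe g ⟨t, ht⟩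
  rw [h2] at h1
  have h3 : ∀ x ∈ Icc (0 : ℝ) 1, extendCurve f x = v + ∫ s in (0 : ℝ)..x, extendCurve g s := by
    intro x hx
    have h4 := extendCurve_coe f ⟨x, hx⟩
    rw [h] at h4 ⊢
    exact h4
  exact h1.hasDerivWithinAt.congr h3 (h3 t ht)

end Volterra

section Lift

/-- Constant curves. -/
noncomputable def constCurve (V : Type*) [NormedAddCommGroup V] [NormedSpace ℂ V] :
    V →L[ℂ] C(unitInterval, V) := ContinuousLinearMap.const ℂ unitInterval

theorem constCurve_apply {V : Type*} [NormedAddCommGroup V] [NormedSpace ℂ V] (v : V) (t : unitInterval) :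
    constCurve V v t = v := rfl

/-- A component of a curve. -/
noncomputable def projCurve (j : Fin n) : C(unitInterval, CVec n) →L[ℂ] C(unitInterval, ℂ) :=
  (ContinuousLinearMap.proj (R := ℂ) (φ := fun _ : Fin n => ℂ) j).compLeftContinuous ℂ unitInterval

theorem projCurve_apply (j : Fin n) (Θ : C(unitInterval, CVec n)) (t : unitInterval) : projCurve j Θ t = Θ t j := rfl

/-- The curve in a coordinate axis. -/
noncomputable def singleCurve (j : Fin n) : C(unitInterval, ℂ) →L[ℂ] C(unitInterval, CVec n) :=
  (ContinuousLinearMap.single ℂ (fun _ : Fin n => ℂ) j).compLeftContinuous ℂ unitInterval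

theorem singleCurve_apply (j : Fin n) (f : C(unitInterval, ℂ)) (t : unitInterval) :
    singleCurve j f t = Pi.single j (f t) := rfl

/-- The composition of a character with a curve. -/
noncomputable def expCharCurve (k : Fin n → ℤ) (Θ : C(unitInterval, CVec n)) : C(unitInterval, ℂ) :=
  NormedSpace.exp (Complex.I • ∑ j, (k j : ℂ) • projCurve j Θ)

theorem expCharCurve_apply (k : Fin n → ℤ) (Θ : C(unitInterval, CVec n)) (t : unitInterval) :
    expCharCurve k Θ t = expChar k (Θ t) := by
  have h := NormedSpace.map_exp ((ContinuousMap.evalAlgHom ℂ ℂ t : C(unitInterval, ℂ) →ₐ[ℂ] ℂ) :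
    C(unitInterval, ℂ) →+* ℂ) (continuous_eval_const t)
    (Complex.I • ∑ j, (k j : ℂ) • projCurve j Θ)
  have h1 : expCharCurve k Θ t = NormedSpace.exp ((Complex.I • ∑ j, (k j : ℂ) • projCurve j Θ) t) :=
    h
  rw [h1, expChar, ← Complex.exp_eq_exp_ℂ]
  congr 1
  simp [projCurve_apply]

theorem analyticAt_expCharCurve (k : Fin n → ℤ) (Θ : C(unitInterval, CVec n)) :
    AnalyticAt ℂ (expCharCurve k) Θ := by
  -- The character along a curve is the exponential in the Banach algebra of continuous functions,
  -- applied to a continuous linear image of the curve; so it is analytic in the curve.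
  have h1 : AnalyticAt ℂ (fun x : C(unitInterval, ℂ) => NormedSpace.exp x)
      (Complex.I • ∑ j, (k j : ℂ) • projCurve j Θ) := NormedSpace.exp_analytic _
  have h2 : AnalyticAt ℂ (fun Θ : C(unitInterval, CVec n) => Complex.I • ∑ j, (k j : ℂ) • projCurve j Θ) Θ :=
    analyticAt_const.fun_smul (Finset.analyticAt_fun_sum _ fun j _ =>
      analyticAt_const.fun_smul ((projCurve j).analyticAt Θ))
  exact AnalyticAt.fun_comp (g := fun x : C(unitInterval, ℂ) => NormedSpace.exp x)
    (f := fun Θ => Complex.I • ∑ j, (k j : ℂ) • projCurve j Θ) h1 h2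

end Lift

end KAM

/-! ### Trigonometric Hamiltonians affine in the actions: gradients and bounds -/

namespace KAM

open Metric Set Filter Topology
variable {n : ℕ}

/-- A trigonometric polynomial in the angles that is affine in the actions. -/
noncomputable def trigHam (S : Finset (Fin n → ℤ)) (A : (Fin n → ℤ) → CVec n → ℂ)
    (B : (Fin n → ℤ) → CVec n → CVec n) (p : Phase n × CVec n) : ℂ :=
  ∑ k ∈ S, (A k p.2 + ∑ j, B k p.2 j * p.1.1 j) * expChar k p.1.2

/-- The gradient of a trigonometric polynomial with respect to the actions. -/
noncomputable def actionGrad (S : Finset (Fin n → ℤ)) (B : (Fin n → ℤ) → CVec n → CVec n)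
    (ω θ : CVec n) : CVec n :=
  fun j => ∑ k ∈ S, B k ω j * expChar k θ

/-- The gradient of a trigonometric polynomial with respect to the angles. -/
noncomputable def angleGrad (S : Finset (Fin n → ℤ)) (A : (Fin n → ℤ) → CVec n → ℂ)
    (B : (Fin n → ℤ) → CVec n → CVec n) (ω J θ : CVec n) : CVec n :=
  fun j => ∑ k ∈ S, Complex.I * k j * ((A k ω + ∑ l, B k ω l * J l) * expChar k θ)

variable {S : Finset (Fin n → ℤ)} {A : (Fin n → ℤ) → CVec n → ℂ}
  {B : (Fin n → ℤ) → CVec n → CVec n}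

theorem analyticAt_coord (j : Fin n) (θ : CVec n) : AnalyticAt ℂ (fun θ : CVec n => θ j) θ :=
  (ContinuousLinearMap.proj (R := ℂ) (φ := fun _ : Fin n => ℂ) j).analyticAt θ

theorem analyticAt_trigHam {p : Phase n × CVec n} (hA : ∀ k ∈ S, AnalyticAt ℂ (A k) p.2)
    (hB : ∀ k ∈ S, AnalyticAt ℂ (B k) p.2) : AnalyticAt ℂ (trigHam S A B) p := by
  refine Finset.analyticAt_fun_sum _ fun k hk => ?_
  refine AnalyticAt.fun_mul (AnalyticAt.fun_add ((hA k hk).fun_comp analyticAt_snd)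
    (Finset.analyticAt_fun_sum _ fun j _ => AnalyticAt.fun_mul ?_ ?_)) ?_
  · exact (analyticAt_coord j _).fun_comp ((hB k hk).fun_comp analyticAt_snd)
  · exact (analyticAt_coord j _).fun_comp (analyticAt_fst.fun_comp analyticAt_fst)
  · exact (analyticAt_expChar k _).fun_comp (analyticAt_snd.fun_comp analyticAt_fst)

theorem hasFDerivAt_expChar (k : Fin n → ℤ) (θ : CVec n) :
    HasFDerivAt (expChar k) (expChar k θ • (Complex.I • ∑ j, (k j : ℂ) •
      ContinuousLinearMap.proj (R := ℂ) (φ := fun _ : Fin n => ℂ) j)) θ := by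
  refine HasFDerivAt.cexp ?_
  refine HasFDerivAt.const_mul ?_ _
  refine HasFDerivAt.fun_sum fun j _ => ?_
  exact (ContinuousLinearMap.proj (R := ℂ) (φ := fun _ : Fin n => ℂ) j).hasFDerivAt.const_mul _

theorem hasFDerivAt_trigHam (ω : CVec n) (z : Phase n) :
    HasFDerivAt (fun w => trigHam S A B (w, ω))
      (∑ j, (actionGrad S B ω z.2 j • (ContinuousLinearMap.proj (R := ℂ) (φ := fun _ : Fin n => ℂ)
          j ∘L ContinuousLinearMap.fst ℂ (CVec n) (CVec n)) +
        angleGrad S A B ω z.1 z.2 j • (ContinuousLinearMap.proj (R := ℂ) (φ := fun _ : Fin n => ℂ)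
          j ∘L ContinuousLinearMap.snd ℂ (CVec n) (CVec n)))) z := by
  have h : HasFDerivAt (fun w => trigHam S A B (w, ω))
      (∑ k ∈ S, ((A k ω + ∑ j, B k ω j * z.1 j) • ((expChar k z.2 • (Complex.I • ∑ j, (k j : ℂ) •
        ContinuousLinearMap.proj (R := ℂ) (φ := fun _ : Fin n => ℂ) j)) ∘L
          ContinuousLinearMap.snd ℂ (CVec n) (CVec n)) +
        expChar k z.2 • ∑ j, B k ω j • (ContinuousLinearMap.proj (R := ℂ)
          (φ := fun _ : Fin n => ℂ) j ∘L ContinuousLinearMap.fst ℂ (CVec n) (CVec n)))) z := by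
    refine HasFDerivAt.fun_sum fun k _ => ?_
    refine HasFDerivAt.mul (c := fun w : Phase n => A k ω + ∑ j, B k ω j * w.1 j)
      (d := fun w : Phase n => expChar k w.2) ?_ ?_
    · refine HasFDerivAt.const_add _ (HasFDerivAt.fun_sum fun j _ => ?_)
      exact ((ContinuousLinearMap.proj (R := ℂ) (φ := fun _ : Fin n => ℂ) j ∘L
        ContinuousLinearMap.fst ℂ (CVec n) (CVec n)).hasFDerivAt (x := z)).const_mul (B k ω j)
    · exact (hasFDerivAt_expChar k z.2).comp z hasFDerivAt_snd
  refine h.congr_fderiv (ContinuousLinearMap.ext fun u => ?_)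
  simp only [sum_apply, add_apply,
    smul_apply, ContinuousLinearMap.comp_apply, ContinuousLinearMap.proj_apply,
    ContinuousLinearMap.coe_fst', ContinuousLinearMap.coe_snd', smul_eq_mul, actionGrad, angleGrad,
    Finset.sum_mul, Finset.mul_sum, Finset.sum_add_distrib]
  rw [add_comm, Finset.sum_comm]
  congr 1
  · exact Finset.sum_congr rfl fun j _ => Finset.sum_congr rfl fun k _ => by ring
  · rw [Finset.sum_comm]
    exact Finset.sum_congr rfl fun j _ => Finset.sum_congr rfl fun k _ => by ring

theorem hamVectorField_trigHam (ω : CVec n) (z : Phase n) :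
    hamVectorField (trigHam S A B) ω z =
      (-angleGrad S A B ω z.1 z.2, actionGrad S B ω z.2) := by
  classical
  simp only [hamVectorField, (hasFDerivAt_trigHam ω z).fderiv]
  ext j
  · simp [Pi.single_apply]
  · simp [Pi.single_apply]

theorem mem_phaseDomain {r s : ℝ} (hr : 0 < r) {z : Phase n} :
    z ∈ phaseDomain n r s ↔ ‖z.1‖ < r ∧ z.2 ∈ strip n s := by
  rw [phaseDomain, mem_ofPred_eq, pi_norm_lt_iff hr, mem_strip]

theorem add_mem_strip {s σ : ℝ} {θ θ' : CVec n} (hθ : θ ∈ strip n (s - σ)) (h : ‖θ' - θ‖ ≤ σ) :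
    θ' ∈ strip n s := by
  intro j
  have h1 : |((θ' - θ) j).im| ≤ σ := (Complex.abs_im_le_norm _).trans ((norm_le_pi_norm _ j).trans h)
  have h2 : (θ' j).im = (θ j).im + ((θ' - θ) j).im := by simp
  rw [h2]
  calc _ ≤ |(θ j).im| + |((θ' - θ) j).im| := abs_add_le _ _
    _ < s := by linarith [hθ j]

section Bounds

variable {ω : CVec n} {r s σ M : ℝ}

theorem hasFDerivAt_trigHam_action (ω θ J : CVec n) :
    HasFDerivAt (fun J => trigHam S A B ((J, θ), ω))
      (∑ j, actionGrad S B ω θ j • ContinuousLinearMap.proj (R := ℂ) (φ := fun _ : Fin n => ℂ) j)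
      J := by
  have h := (hasFDerivAt_trigHam (S := S) (A := A) (B := B) ω (J, θ)).comp J
    (f := fun J => (J, θ)) (hasFDerivAt_prodMk_left J θ)
  refine h.congr_fderiv (ContinuousLinearMap.ext fun u => ?_)
  simp

theorem hasFDerivAt_trigHam_angle (ω θ J : CVec n) :
    HasFDerivAt (fun θ => trigHam S A B ((J, θ), ω))
      (∑ j, angleGrad S A B ω J θ j • ContinuousLinearMap.proj (R := ℂ) (φ := fun _ : Fin n => ℂ) j)
      θ := by
  have h := (hasFDerivAt_trigHam (S := S) (A := A) (B := B) ω (J, θ)).comp θ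
    (f := fun θ => (J, θ)) (hasFDerivAt_prodMk_right J θ)
  refine h.congr_fderiv (ContinuousLinearMap.ext fun u => ?_)
  simp

theorem norm_le_of_sum_proj (v : CVec n) {C : ℝ} (hC : ‖∑ j, v j •
    ContinuousLinearMap.proj (R := ℂ) (φ := fun _ : Fin n => ℂ) j‖ ≤ C) : ‖v‖ ≤ C := by
  classical
  refine (pi_norm_le_iff_of_nonneg ((norm_nonneg _).trans hC)).2 fun j => ?_
  have h1 := (∑ j, v j • ContinuousLinearMap.proj (R := ℂ)
    (φ := fun _ : Fin n => ℂ) j).le_of_opNorm_le hC (Pi.single j 1)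
  simpa [Pi.single_apply, sum_apply, Pi.norm_single] using h1

/-- The action gradient does not depend on the actions, so the Cauchy estimate may be taken at `J =
0` with the full radius `r`. -/
theorem norm_actionGrad_le (hr : 0 < r)
    (hF : ∀ z ∈ phaseDomain n r s, ‖trigHam S A B (z, ω)‖ ≤ M) {θ : CVec n}
    (hθ : θ ∈ strip n s) : ‖actionGrad S B ω θ‖ ≤ 2 * M / r := by
  refine norm_le_of_sum_proj _ ?_
  rw [← (hasFDerivAt_trigHam_action (A := A) ω θ 0).fderiv]
  refine norm_fderiv_le_of_norm_le hr
    (fun J _ => (hasFDerivAt_trigHam_action ω θ J).differentiableAt.differentiableWithinAt)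
    fun J hJ => hF (J, θ) ?_
  exact (mem_phaseDomain hr).2 ⟨by simpa using hJ, hθ⟩

theorem norm_angleGrad_le (hr : 0 < r) (hσ : 0 < σ)
    (hF : ∀ z ∈ phaseDomain n r s, ‖trigHam S A B (z, ω)‖ ≤ M) {J θ : CVec n} (hJ : ‖J‖ < r)
    (hθ : θ ∈ strip n (s - σ)) : ‖angleGrad S A B ω J θ‖ ≤ 2 * M / σ := by
  refine norm_le_of_sum_proj _ ?_
  rw [← (hasFDerivAt_trigHam_angle ω θ J).fderiv]
  refine norm_fderiv_le_of_norm_le hσ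
    (fun θ _ => (hasFDerivAt_trigHam_angle ω θ J).differentiableAt.differentiableWithinAt)
    fun θ' hθ' => hF (J, θ') ?_
  refine (mem_phaseDomain hr).2 ⟨hJ, add_mem_strip hθ ?_⟩
  rw [← dist_eq_norm]
  exact (mem_ball.1 hθ').le

theorem analyticAt_actionGrad (ω θ : CVec n) : AnalyticAt ℂ (actionGrad S B ω) θ := by
  refine AnalyticAt.pi fun j => ?_
  exact Finset.analyticAt_fun_sum _ fun k _ => analyticAt_const.fun_mul (analyticAt_expChar k θ)

/-- One more Cauchy estimate, in the angles, and convexity of the strip. The constant `4M / (rσ)` is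
the same as that in `norm_angleLin_le`; it is the contraction constant of both integral equations.
-/
theorem norm_actionGrad_sub_le (hr : 0 < r) (hσ : 0 < σ)
    (hF : ∀ z ∈ phaseDomain n r s, ‖trigHam S A B (z, ω)‖ ≤ M) {θ θ' : CVec n}
    (hθ : θ ∈ strip n (s - σ)) (hθ' : θ' ∈ strip n (s - σ)) :
    ‖actionGrad S B ω θ - actionGrad S B ω θ'‖ ≤ 4 * M / (r * σ) * ‖θ - θ'‖ := by
  refine (convex_strip (s - σ)).norm_image_sub_le_of_norm_fderiv_le (𝕜 := ℂ)
    (fun θ _ => (analyticAt_actionGrad ω θ).differentiableAt) (fun θ hθ => ?_) hθ' hθ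
  have h := norm_fderiv_le_of_norm_le (f := actionGrad S B ω) (c := θ) (M := 2 * M / r) hσ
    (fun θ _ => (analyticAt_actionGrad ω θ).differentiableAt.differentiableWithinAt)
    fun θ' hθ' => norm_actionGrad_le hr hF (add_mem_strip hθ (by
      rw [← dist_eq_norm]; exact (mem_ball.1 hθ').le))
  refine h.trans (le_of_eq ?_)
  field_simp; ring

/-- The part of the angular gradient that is linear in the actions. -/
noncomputable def angleLin (S : Finset (Fin n → ℤ)) (B : (Fin n → ℤ) → CVec n → CVec n)
    (ω θ : CVec n) : CVec n →L[ℂ] CVec n :=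
  ContinuousLinearMap.pi fun j => ∑ k ∈ S, (Complex.I * k j * expChar k θ) • ∑ l, B k ω l •
    ContinuousLinearMap.proj (R := ℂ) (φ := fun _ : Fin n => ℂ) l

theorem angleGrad_eq (ω J θ : CVec n) :
    angleGrad S A B ω J θ = angleGrad S A B ω 0 θ + angleLin S B ω θ J := by
  ext j
  simp only [angleGrad, angleLin, Pi.add_apply, Pi.zero_apply, mul_zero, Finset.sum_const_zero,
    add_zero, ContinuousLinearMap.pi_apply, sum_apply, smul_apply, ContinuousLinearMap.proj_apply,
    smul_eq_mul, ← Finset.sum_add_distrib]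
  exact Finset.sum_congr rfl fun k _ => by ring

theorem norm_angleLin_le (hr : 0 < r) (hσ : 0 < σ)
    (hF : ∀ z ∈ phaseDomain n r s, ‖trigHam S A B (z, ω)‖ ≤ M) {θ : CVec n}
    (hθ : θ ∈ strip n (s - σ)) : ‖angleLin S B ω θ‖ ≤ 4 * M / (r * σ) := by
  have h1 : ∀ J, HasFDerivAt (fun J => angleGrad S A B ω J θ) (angleLin S B ω θ) J := fun J => by
    have : (fun J => angleGrad S A B ω J θ) =
        fun J => angleGrad S A B ω 0 θ + angleLin S B ω θ J := funext fun J => angleGrad_eq ω J θ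
    rw [this]
    exact (angleLin S B ω θ).hasFDerivAt.const_add _
  rw [← (h1 0).fderiv]
  refine (norm_fderiv_le_of_norm_le (M := 2 * M / σ) hr
    (fun J _ => (h1 J).differentiableAt.differentiableWithinAt)
    fun J hJ => norm_angleGrad_le hr hσ hF (by simpa using hJ) hθ).trans (le_of_eq ?_)
  field_simp; ring

end Bounds

section Curves


/-- The action gradient along a curve of angles. -/
noncomputable def actionGradCurve (S : Finset (Fin n → ℤ)) (B : (Fin n → ℤ) → CVec n → CVec n)
    (ω : CVec n) (Θ : C(unitInterval, CVec n)) : C(unitInterval, CVec n) :=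
  -- The gradient is assembled from operations that are analytic on curve spaces, so that its
  -- analyticity in curve and parameter needs no superposition argument.
  ∑ j, singleCurve j (∑ k ∈ S, B k ω j • expCharCurve k Θ)

/-- The angle gradient along a curve. -/
noncomputable def angleGradCurve (S : Finset (Fin n → ℤ)) (A : (Fin n → ℤ) → CVec n → ℂ)
    (B : (Fin n → ℤ) → CVec n → CVec n) (ω : CVec n) (J Θ : C(unitInterval, CVec n)) : C(unitInterval, CVec n) :=
  ∑ j, singleCurve j (∑ k ∈ S, (Complex.I * k j) •
    ((A k ω • (1 : C(unitInterval, ℂ)) + ∑ l, B k ω l • projCurve l J) * expCharCurve k Θ))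

theorem sum_singleCurve_apply (f : Fin n → C(unitInterval, ℂ)) (t : unitInterval) :
    (∑ j, singleCurve j (f j)) t = fun j => f j t := by
  ext j
  simp [ContinuousMap.sum_apply, singleCurve_apply, Finset.sum_apply, Pi.single_apply]

theorem actionGradCurve_apply (ω : CVec n) (Θ : C(unitInterval, CVec n)) (t : unitInterval) :
    actionGradCurve S B ω Θ t = actionGrad S B ω (Θ t) := by
  rw [actionGradCurve, sum_singleCurve_apply]
  ext j
  simp [actionGrad, ContinuousMap.sum_apply, expCharCurve_apply]

theorem angleGradCurve_apply (ω : CVec n) (J Θ : C(unitInterval, CVec n)) (t : unitInterval) :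
    angleGradCurve S A B ω J Θ t = angleGrad S A B ω (J t) (Θ t) := by
  rw [angleGradCurve, sum_singleCurve_apply]
  ext j
  simp [angleGrad, ContinuousMap.sum_apply, expCharCurve_apply, projCurve_apply]

variable {E : Type*} [NormedAddCommGroup E] [NormedSpace ℂ E]

theorem analyticAt_actionGradCurve {ω : E → CVec n} {Θ : E → C(unitInterval, CVec n)} {x : E}
    (hω : AnalyticAt ℂ ω x) (hΘ : AnalyticAt ℂ Θ x) (hB : ∀ k ∈ S, AnalyticAt ℂ (B k) (ω x)) :
    AnalyticAt ℂ (fun x => actionGradCurve S B (ω x) (Θ x)) x := by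
  refine Finset.analyticAt_fun_sum _ fun j _ => ((singleCurve j).analyticAt _).fun_comp ?_
  refine Finset.analyticAt_fun_sum _ fun k hk => AnalyticAt.fun_smul ?_ ?_
  · exact (analyticAt_coord j _).fun_comp ((hB k hk).fun_comp hω)
  · exact (analyticAt_expCharCurve k _).fun_comp hΘ

theorem analyticAt_angleGradCurve {ω : E → CVec n} {J Θ : E → C(unitInterval, CVec n)} {x : E}
    (hω : AnalyticAt ℂ ω x) (hJ : AnalyticAt ℂ J x) (hΘ : AnalyticAt ℂ Θ x)
    (hA : ∀ k ∈ S, AnalyticAt ℂ (A k) (ω x)) (hB : ∀ k ∈ S, AnalyticAt ℂ (B k) (ω x)) :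
    AnalyticAt ℂ (fun x => angleGradCurve S A B (ω x) (J x) (Θ x)) x := by
  refine Finset.analyticAt_fun_sum _ fun j _ => ((singleCurve j).analyticAt _).fun_comp ?_
  refine Finset.analyticAt_fun_sum _ fun k hk => AnalyticAt.fun_smul analyticAt_const ?_
  refine AnalyticAt.fun_mul (AnalyticAt.fun_add (AnalyticAt.fun_smul ?_ analyticAt_const) ?_) ?_
  · exact (hA k hk).fun_comp hω
  · refine Finset.analyticAt_fun_sum _ fun l _ => AnalyticAt.fun_smul ?_ ?_
    · exact (analyticAt_coord l _).fun_comp ((hB k hk).fun_comp hω)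
    · exact ((projCurve l).analyticAt _).fun_comp hJ
  · exact (analyticAt_expCharCurve k _).fun_comp hΘ

end Curves

end KAM

/-! ### Hamilton's equations as integral equations for curves -/

namespace KAM

open Metric Set Filter Topology
variable {n : ℕ} {S : Finset (Fin n → ℤ)} {A : (Fin n → ℤ) → CVec n → ℂ}
  {B : (Fin n → ℤ) → CVec n → CVec n}

/-- The actions along a curve. -/
noncomputable def fstCurve (n : ℕ) : C(unitInterval, Phase n) →L[ℂ] C(unitInterval, CVec n) :=
  (ContinuousLinearMap.fst ℂ (CVec n) (CVec n)).compLeftContinuous ℂ unitInterval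

/-- The angles along a curve. -/
noncomputable def sndCurve (n : ℕ) : C(unitInterval, Phase n) →L[ℂ] C(unitInterval, CVec n) :=
  (ContinuousLinearMap.snd ℂ (CVec n) (CVec n)).compLeftContinuous ℂ unitInterval

/-- Inclusion of curves of actions. -/
noncomputable def inlCurve (n : ℕ) : C(unitInterval, CVec n) →L[ℂ] C(unitInterval, Phase n) :=
  (ContinuousLinearMap.inl ℂ (CVec n) (CVec n)).compLeftContinuous ℂ unitInterval

/-- Inclusion of curves of angles. -/
noncomputable def inrCurve (n : ℕ) : C(unitInterval, CVec n) →L[ℂ] C(unitInterval, Phase n) :=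
  (ContinuousLinearMap.inr ℂ (CVec n) (CVec n)).compLeftContinuous ℂ unitInterval

theorem fstCurve_apply (γ : C(unitInterval, Phase n)) (t : unitInterval) : fstCurve n γ t = (γ t).1 := rfl

theorem sndCurve_apply (γ : C(unitInterval, Phase n)) (t : unitInterval) : sndCurve n γ t = (γ t).2 := rfl

theorem inl_add_inr_apply (J Θ : C(unitInterval, CVec n)) (t : unitInterval) :
    (inlCurve n J + inrCurve n Θ) t = (J t, Θ t) := by
  have h : (inlCurve n J + inrCurve n Θ) t = ((J t, 0) : Phase n) + (0, Θ t) := rfl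
  simp [h]

theorem fstCurve_inl_add_inr (J Θ : C(unitInterval, CVec n)) :
    fstCurve n (inlCurve n J + inrCurve n Θ) = J := by
  ext1 t; rw [fstCurve_apply, inl_add_inr_apply]

theorem sndCurve_inl_add_inr (J Θ : C(unitInterval, CVec n)) :
    sndCurve n (inlCurve n J + inrCurve n Θ) = Θ := by
  ext1 t; rw [sndCurve_apply, inl_add_inr_apply]

theorem inl_add_inr_curve (γ : C(unitInterval, Phase n)) :
    inlCurve n (fstCurve n γ) + inrCurve n (sndCurve n γ) = γ := by
  ext1 t; rw [inl_add_inr_apply]; rfl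

/-- The hamiltonian vector field of a trigonometric polynomial along a curve. -/
noncomputable def hamCurve (S : Finset (Fin n → ℤ)) (A : (Fin n → ℤ) → CVec n → ℂ)
    (B : (Fin n → ℤ) → CVec n → CVec n) (ω : CVec n) (γ : C(unitInterval, Phase n)) : C(unitInterval, Phase n) :=
  inlCurve n (-angleGradCurve S A B ω (fstCurve n γ) (sndCurve n γ)) +
    inrCurve n (actionGradCurve S B ω (sndCurve n γ))

theorem hamCurve_apply (ω : CVec n) (γ : C(unitInterval, Phase n)) (t : unitInterval) :
    hamCurve S A B ω γ t = hamVectorField (trigHam S A B) ω (γ t) := by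
  rw [hamCurve, inl_add_inr_apply, hamVectorField_trigHam, ContinuousMap.neg_apply,
    angleGradCurve_apply, actionGradCurve_apply]
  rfl

theorem volterra_inl_add_inr (J Θ : C(unitInterval, CVec n)) :
    volterra (Phase n) (inlCurve n J + inrCurve n Θ) =
      inlCurve n (volterra (CVec n) J) + inrCurve n (volterra (CVec n) Θ) := by
  have h1 : ∀ (L : Phase n →L[ℂ] CVec n) (γ : C(unitInterval, Phase n)) (t : unitInterval),
      L (volterra (Phase n) γ t) = ∫ s in (0 : ℝ)..t, L (extendCurve γ s) := by
    intro L γ t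
    rw [volterra_apply]
    exact (((L.restrictScalars ℝ).intervalIntegral_comp_comm
      ((continuous_extendCurve γ).intervalIntegrable _ _))).symm
  ext1 t
  rw [inl_add_inr_apply]
  refine Prod.ext ?_ ?_
  · refine (h1 (ContinuousLinearMap.fst ℂ _ _) _ t).trans ?_
    rw [volterra_apply]
    refine intervalIntegral.integral_congr fun s _ => ?_
    simp only [extendCurve, inl_add_inr_apply, ContinuousLinearMap.coe_fst']
  · refine (h1 (ContinuousLinearMap.snd ℂ _ _) _ t).trans ?_
    rw [volterra_apply]
    refine intervalIntegral.integral_congr fun s _ => ?_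
    simp only [extendCurve, inl_add_inr_apply, ContinuousLinearMap.coe_snd']

theorem constCurve_phase (z : Phase n) :
    constCurve (Phase n) z = inlCurve n (constCurve (CVec n) z.1) +
      inrCurve n (constCurve (CVec n) z.2) := by
  ext1 t; rw [inl_add_inr_apply]; rfl

/-- `γ` solves the hamiltonian equations with the initial value `z`. -/
def IsHamCurve (S : Finset (Fin n → ℤ)) (A : (Fin n → ℤ) → CVec n → ℂ)
    (B : (Fin n → ℤ) → CVec n → CVec n) (ω : CVec n) (z : Phase n) (γ : C(unitInterval, Phase n)) : Prop :=
  γ = constCurve (Phase n) z + volterra (Phase n) (hamCurve S A B ω γ)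

theorem isHamCurve_iff {ω : CVec n} {z : Phase n} {J Θ : C(unitInterval, CVec n)} :
    IsHamCurve S A B ω z (inlCurve n J + inrCurve n Θ) ↔
      J = constCurve (CVec n) z.1 - volterra (CVec n) (angleGradCurve S A B ω J Θ) ∧
      Θ = constCurve (CVec n) z.2 + volterra (CVec n) (actionGradCurve S B ω Θ) := by
  have h : constCurve (Phase n) z + volterra (Phase n) (hamCurve S A B ω
      (inlCurve n J + inrCurve n Θ)) =
      inlCurve n (constCurve (CVec n) z.1 - volterra (CVec n) (angleGradCurve S A B ω J Θ)) +
      inrCurve n (constCurve (CVec n) z.2 + volterra (CVec n) (actionGradCurve S B ω Θ)) := by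
    rw [hamCurve, fstCurve_inl_add_inr, sndCurve_inl_add_inr, volterra_inl_add_inr,
      constCurve_phase]
    simp only [map_neg, map_sub, map_add]
    abel
  rw [IsHamCurve, h]
  constructor
  · intro h1
    exact ⟨by simpa only [fstCurve_inl_add_inr] using congrArg (fstCurve n) h1,
      by simpa only [sndCurve_inl_add_inr] using congrArg (sndCurve n) h1⟩
  · rintro ⟨h1, h2⟩
    rw [← h1, ← h2]

/-- A continuous linear image of an analytic function is analytic. -/
theorem analyticAt_clm_comp {E V W : Type*} [NormedAddCommGroup E] [NormedSpace ℂ E]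
    [NormedAddCommGroup V] [NormedSpace ℂ V] [NormedAddCommGroup W] [NormedSpace ℂ W]
    {f : E → V} {x : E} (hf : AnalyticAt ℂ f x) (L : V →L[ℂ] W) :
    AnalyticAt ℂ (fun x => L (f x)) x :=
  AnalyticAt.fun_comp (g := L) (L.analyticAt _) hf

section Solve

variable {O : Set (CVec n)} {ω : CVec n} {r s σ M : ℝ}

theorem norm_actionGradCurve_sub_le (hr : 0 < r) (hσ : 0 < σ) (hM : 0 ≤ M)
    (hF : ∀ z ∈ phaseDomain n r s, ‖trigHam S A B (z, ω)‖ ≤ M) {Θ Θ' : C(unitInterval, CVec n)}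
    (hΘ : ∀ t, Θ t ∈ strip n (s - σ)) (hΘ' : ∀ t, Θ' t ∈ strip n (s - σ)) :
    ‖actionGradCurve S B ω Θ - actionGradCurve S B ω Θ'‖ ≤ 4 * M / (r * σ) * ‖Θ - Θ'‖ := by
  refine norm_curve_le fun t => ?_
  rw [ContinuousMap.sub_apply, actionGradCurve_apply, actionGradCurve_apply]
  refine (norm_actionGrad_sub_le hr hσ hF (hΘ t) (hΘ' t)).trans ?_
  gcongr
  exact (Θ - Θ').norm_coe_le_norm t

theorem norm_angleGradCurve_sub_le (hr : 0 < r) (hσ : 0 < σ) (hM : 0 ≤ M)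
    (hF : ∀ z ∈ phaseDomain n r s, ‖trigHam S A B (z, ω)‖ ≤ M) {J J' Θ : C(unitInterval, CVec n)}
    (hΘ : ∀ t, Θ t ∈ strip n (s - σ)) :
    ‖angleGradCurve S A B ω J Θ - angleGradCurve S A B ω J' Θ‖ ≤
      4 * M / (r * σ) * ‖J - J'‖ := by
  refine norm_curve_le fun t => ?_
  rw [ContinuousMap.sub_apply, angleGradCurve_apply, angleGradCurve_apply,
    angleGrad_eq ω (J t), angleGrad_eq ω (J' t), add_sub_add_left_eq_sub, ← map_sub]
  refine ((angleLin S B ω (Θ t)).le_of_opNorm_le (norm_angleLin_le hr hσ hF (hΘ t)) _).trans ?_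
  gcongr
  exact (J - J').norm_coe_le_norm t

/-- The angle equation contains no actions and is a contraction by itself as long as the curves stay
in the narrower strip. -/
theorem isHamCurve_unique_angle (hr : 0 < r) (hσ : 0 < σ) (hM : 0 ≤ M)
    (hq : 4 * M / (r * σ) ≤ 1 / 4)
    (hF : ∀ z ∈ phaseDomain n r s, ‖trigHam S A B (z, ω)‖ ≤ M) {θ : CVec n}
    {Θ Θ' : C(unitInterval, CVec n)} (hΘ : ∀ t, Θ t ∈ strip n (s - σ))
    (hΘ' : ∀ t, Θ' t ∈ strip n (s - σ))
    (h : Θ = constCurve (CVec n) θ + volterra (CVec n) (actionGradCurve S B ω Θ))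
    (h' : Θ' = constCurve (CVec n) θ + volterra (CVec n) (actionGradCurve S B ω Θ')) :
    Θ = Θ' := by
  refine eq_of_contraction (T := fun Θ => constCurve (CVec n) θ +
    volterra (CVec n) (actionGradCurve S B ω Θ)) (q := 4 * M / (r * σ)) (by linarith) ?_
    h.symm h'.symm
  rw [add_sub_add_left_eq_sub, ← map_sub]
  exact (norm_volterra_le _).trans (norm_actionGradCurve_sub_le hr hσ hM hF hΘ hΘ')

/-- Along a fixed angle curve the right-hand side is affine in the actions, so it contracts
globally; no bound on `J` and `J'` is needed. -/
theorem isHamCurve_unique_action (hr : 0 < r) (hσ : 0 < σ) (hM : 0 ≤ M)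
    (hq : 4 * M / (r * σ) ≤ 1 / 4)
    (hF : ∀ z ∈ phaseDomain n r s, ‖trigHam S A B (z, ω)‖ ≤ M) {J₀ : CVec n}
    {J J' Θ : C(unitInterval, CVec n)} (hΘ : ∀ t, Θ t ∈ strip n (s - σ))
    (h : J = constCurve (CVec n) J₀ - volterra (CVec n) (angleGradCurve S A B ω J Θ))
    (h' : J' = constCurve (CVec n) J₀ - volterra (CVec n) (angleGradCurve S A B ω J' Θ)) :
    J = J' := by
  refine eq_of_contraction (T := fun J => constCurve (CVec n) J₀ -
    volterra (CVec n) (angleGradCurve S A B ω J Θ)) (q := 4 * M / (r * σ)) (by linarith) ?_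
    h.symm h'.symm
  rw [sub_sub_sub_cancel_left, ← map_sub, norm_sub_rev J J']
  exact (norm_volterra_le _).trans (norm_angleGradCurve_sub_le hr hσ hM hF hΘ)

theorem isHamCurve_unique (hr : 0 < r) (hσ : 0 < σ) (hM : 0 ≤ M)
    (hq : 4 * M / (r * σ) ≤ 1 / 4)
    (hF : ∀ z ∈ phaseDomain n r s, ‖trigHam S A B (z, ω)‖ ≤ M) {z : Phase n}
    {γ γ' : C(unitInterval, Phase n)} (hγ : ∀ t, (γ t).2 ∈ strip n (s - σ))
    (hγ' : ∀ t, (γ' t).2 ∈ strip n (s - σ)) (h : IsHamCurve S A B ω z γ)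
    (h' : IsHamCurve S A B ω z γ') : γ = γ' := by
  rw [← inl_add_inr_curve γ, isHamCurve_iff] at h
  rw [← inl_add_inr_curve γ', isHamCurve_iff] at h'
  have h1 := isHamCurve_unique_angle hr hσ hM hq hF hγ hγ' h.2 h'.2
  have h2 := h.1
  rw [h1] at h2
  rw [← inl_add_inr_curve γ, ← inl_add_inr_curve γ', h1,
    isHamCurve_unique_action hr hσ hM hq hF hγ' h2 h'.1]

/-- The contraction acts on the ball of radius `σ` about the constant curve, which stays in the
strip of width `s - σ`. The constant curve is displaced by at most `2M / r = qσ / 2`, with `q` the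
contraction constant. -/
theorem exists_angleCurve (hr : 0 < r) (hσ : 0 < σ) (hM : 0 ≤ M)
    (hq : 4 * M / (r * σ) ≤ 1 / 4) (hO : IsOpen O)
    (hB : ∀ ω ∈ O, ∀ k ∈ S, AnalyticAt ℂ (B k) ω)
    (hF : ∀ ω ∈ O, ∀ z ∈ phaseDomain n r s, ‖trigHam S A B (z, ω)‖ ≤ M) :
    ∃ Θ : CVec n × CVec n → C(unitInterval, CVec n),
      AnalyticOnNhd ℂ Θ (strip n (s - 2 * σ) ×ˢ O) ∧ ∀ p ∈ strip n (s - 2 * σ) ×ˢ O,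
        (∀ t, Θ p t ∈ strip n (s - σ)) ∧
        Θ p = constCurve (CVec n) p.1 + volterra (CVec n) (actionGradCurve S B p.2 (Θ p)) := by
  have hmem : ∀ p ∈ strip n (s - 2 * σ) ×ˢ O, ∀ Θ ∈ ball (constCurve (CVec n) p.1) σ, ∀ t,
      Θ t ∈ strip n (s - σ) := by
    intro p hp Θ hΘ t
    have h1 : p.1 ∈ strip n (s - σ - σ) := by convert! hp.1 using 2; ring
    refine add_mem_strip h1 ?_
    have h2 := (Θ - constCurve (CVec n) p.1).norm_coe_le_norm t
    rw [mem_ball, dist_eq_norm] at hΘ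
    exact h2.trans hΘ.le
  refine (exists_analytic_fixedPoint
    (E := C(unitInterval, CVec n)) (Q := CVec n × CVec n) (U := strip n (s - 2 * σ) ×ˢ O)
    ((isOpen_strip _).prod hO)
    (G := fun u => constCurve (CVec n) u.2.1 + volterra (CVec n) (actionGradCurve S B u.2.2 u.1))
    (c := fun p => constCurve (CVec n) p.1) (ρ := σ) (q := 4 * M / (r * σ))
    (by fun_prop) (by positivity) (by linarith) ?_ ?_ ?_).imp fun Θ hΘ =>
      ⟨hΘ.1, fun p hp => ⟨hmem p hp _ (hΘ.2 p hp).1, (hΘ.2 p hp).2.symm⟩⟩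
  · intro p hp Θ _
    refine AnalyticAt.fun_add (analyticAt_clm_comp
      (analyticAt_fst.fun_comp analyticAt_snd) (constCurve (CVec n))) (analyticAt_clm_comp ?_ (volterra (CVec n)))
    exact analyticAt_actionGradCurve (analyticAt_snd.fun_comp analyticAt_snd) analyticAt_fst
      (hB _ hp.2)
  · intro p hp Θ hΘ Θ' hΘ'
    simp only
    rw [add_sub_add_left_eq_sub, ← map_sub]
    exact (norm_volterra_le _).trans (norm_actionGradCurve_sub_le hr hσ hM (hF _ hp.2)
      (hmem p hp Θ hΘ) (hmem p hp Θ' hΘ'))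
  · intro p hp
    simp only [add_sub_cancel_left]
    have h1 : ‖volterra (CVec n) (actionGradCurve S B p.2 (constCurve (CVec n) p.1))‖ ≤
        2 * M / r := by
      refine (norm_volterra_le _).trans (norm_curve_le fun t => ?_)
      rw [actionGradCurve_apply]
      exact norm_actionGrad_le hr (hF _ hp.2) (strip_mono (by linarith) hp.1)
    have h2 : 2 * M / r = 4 * M / (r * σ) * σ / 2 := by field_simp; ring
    rw [h2] at h1
    nlinarith

/-- The ball of radius `r / 2` is centred at zero instead of the initial action. The displacement of
zero is below `r / 4 + q r / 2`, and `q ≤ 1 / 4` is precisely what bounds this by `(1 - q) r / 2`.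
-/
theorem exists_actionCurve (hr : 0 < r) (hσ : 0 < σ) (hM : 0 ≤ M)
    (hq : 4 * M / (r * σ) ≤ 1 / 4) (hO : IsOpen O)
    (hA : ∀ ω ∈ O, ∀ k ∈ S, AnalyticAt ℂ (A k) ω)
    (hB : ∀ ω ∈ O, ∀ k ∈ S, AnalyticAt ℂ (B k) ω)
    (hF : ∀ ω ∈ O, ∀ z ∈ phaseDomain n r s, ‖trigHam S A B (z, ω)‖ ≤ M)
    {Θ : CVec n × CVec n → C(unitInterval, CVec n)} (hΘa : AnalyticOnNhd ℂ Θ (strip n (s - 2 * σ) ×ˢ O))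
    (hΘ : ∀ p ∈ strip n (s - 2 * σ) ×ˢ O, ∀ t, Θ p t ∈ strip n (s - σ)) :
    ∃ J : CVec n × (CVec n × CVec n) → C(unitInterval, CVec n),
      AnalyticOnNhd ℂ J (ball 0 (r / 4) ×ˢ (strip n (s - 2 * σ) ×ˢ O)) ∧
      ∀ p ∈ ball (0 : CVec n) (r / 4) ×ˢ (strip n (s - 2 * σ) ×ˢ O), ‖J p‖ < r / 2 ∧
        J p = constCurve (CVec n) p.1 -
          volterra (CVec n) (angleGradCurve S A B p.2.2 (J p) (Θ p.2)) := by
  refine (exists_analytic_fixedPoint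
    (E := C(unitInterval, CVec n)) (Q := CVec n × (CVec n × CVec n))
    (U := ball (0 : CVec n) (r / 4) ×ˢ (strip n (s - 2 * σ) ×ˢ O))
    (isOpen_ball.prod ((isOpen_strip _).prod hO))
    (G := fun u => constCurve (CVec n) u.2.1 -
      volterra (CVec n) (angleGradCurve S A B u.2.2.2 u.1 (Θ u.2.2)))
    (c := fun p => 0) (ρ := r / 2) (q := 4 * M / (r * σ))
    (by fun_prop) (by positivity) (by linarith) ?_ ?_ ?_).imp fun J hJ =>
      ⟨hJ.1, fun p hp => ⟨by simpa using (hJ.2 p hp).1, (hJ.2 p hp).2.symm⟩⟩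
  · intro p hp J _
    refine AnalyticAt.fun_sub (analyticAt_clm_comp
      (analyticAt_fst.fun_comp analyticAt_snd) (constCurve (CVec n))) (analyticAt_clm_comp ?_ (volterra (CVec n)))
    refine analyticAt_angleGradCurve (analyticAt_snd.fun_comp
      (analyticAt_snd.fun_comp analyticAt_snd)) analyticAt_fst
      (AnalyticAt.fun_comp (g := Θ) (f := fun u : C(unitInterval, CVec n) × CVec n × CVec n × CVec n => u.2.2)
        (hΘa _ hp.2) (analyticAt_snd.fun_comp analyticAt_snd))
      (hA _ hp.2.2) (hB _ hp.2.2)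
  · intro p hp J _ J' _
    simp only
    rw [sub_sub_sub_cancel_left, ← map_sub, norm_sub_rev J J']
    exact (norm_volterra_le _).trans (norm_angleGradCurve_sub_le hr hσ hM (hF _ hp.2.2)
      (hΘ _ hp.2))
  · intro p hp
    simp only [sub_zero]
    have h1 : ‖volterra (CVec n) (angleGradCurve S A B p.2.2 0 (Θ p.2))‖ ≤ 2 * M / σ := by
      refine (norm_volterra_le _).trans (norm_curve_le fun t => ?_)
      rw [angleGradCurve_apply]
      exact norm_angleGrad_le hr hσ (hF _ hp.2.2) (by simpa using hr) (hΘ _ hp.2 t)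
    have h2 : 2 * M / σ = 4 * M / (r * σ) * r / 2 := by field_simp; ring
    have h3 : ‖constCurve (CVec n) p.1‖ < r / 4 :=
      (norm_curve_le fun t => le_rfl).trans_lt (by simpa using hp.1)
    rw [h2] at h1
    calc _ ≤ ‖constCurve (CVec n) p.1‖ +
          ‖volterra (CVec n) (angleGradCurve S A B p.2.2 0 (Θ p.2))‖ := norm_sub_le _ _
      _ < (1 - 4 * M / (r * σ)) * (r / 2) := by nlinarith

end Solve

end KAM

/-! ### The flow, its displacement, and its dependence on the initial actions -/

namespace KAM

open Metric Set Filter Topology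
variable {n : ℕ} {S : Finset (Fin n → ℤ)} {A : (Fin n → ℤ) → CVec n → ℂ}
  {B : (Fin n → ℤ) → CVec n → CVec n} {O : Set (CVec n)} {r s σ M : ℝ}

/-- A family of trigonometric polynomials, affine in the actions and bounded by `M`, where
`M / (r * σ)` is small. -/
structure IsSmallTrigHam (S : Finset (Fin n → ℤ)) (A : (Fin n → ℤ) → CVec n → ℂ)
    (B : (Fin n → ℤ) → CVec n → CVec n) (O : Set (CVec n)) (r s σ M : ℝ) : Prop where
  r_pos : 0 < r
  sigma_pos : 0 < σ
  bound_nonneg : 0 ≤ M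
  small : 4 * M / (r * σ) ≤ 1 / 4
  isOpen : IsOpen O
  analytic_zero : ∀ ω ∈ O, ∀ k ∈ S, AnalyticAt ℂ (A k) ω
  analytic_one : ∀ ω ∈ O, ∀ k ∈ S, AnalyticAt ℂ (B k) ω
  bound : ∀ ω ∈ O, ∀ z ∈ phaseDomain n r s, ‖trigHam S A B (z, ω)‖ ≤ M

/-- The family `Γ` of curves is the flow of a trigonometric polynomial for times in `[0, 1]`. -/
structure IsTrigFlow (S : Finset (Fin n → ℤ)) (A : (Fin n → ℤ) → CVec n → ℂ)
    (B : (Fin n → ℤ) → CVec n → CVec n) (O : Set (CVec n)) (r s σ : ℝ)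
    (Γ : Phase n × CVec n → C(unitInterval, Phase n)) : Prop where
  analytic : AnalyticOnNhd ℂ Γ (phaseDomain n (r / 4) (s - 2 * σ) ×ˢ O)
  curve : ∀ z ∈ phaseDomain n (r / 4) (s - 2 * σ), ∀ ω ∈ O, IsHamCurve S A B ω z (Γ (z, ω))
  mem : ∀ z ∈ phaseDomain n (r / 4) (s - 2 * σ), ∀ ω ∈ O, ∀ t,
    Γ (z, ω) t ∈ phaseDomain n (r / 2) (s - σ)

theorem IsSmallTrigHam.exists_flow (h : IsSmallTrigHam S A B O r s σ M) :
    ∃ Γ, IsTrigFlow S A B O r s σ Γ := by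
  have hr4 : 0 < r / 4 := by linarith [h.r_pos]
  have hr2 : 0 < r / 2 := by linarith [h.r_pos]
  obtain ⟨Θ, hΘa, hΘ⟩ := exists_angleCurve h.r_pos h.sigma_pos h.bound_nonneg h.small h.isOpen
    h.analytic_one h.bound
  obtain ⟨J, hJa, hJ⟩ := exists_actionCurve h.r_pos h.sigma_pos h.bound_nonneg h.small h.isOpen
    h.analytic_zero h.analytic_one h.bound hΘa (fun p hp => (hΘ p hp).1)
  have hmem : ∀ z ∈ phaseDomain n (r / 4) (s - 2 * σ), ∀ ω ∈ O,
      (z.1, (z.2, ω)) ∈ ball (0 : CVec n) (r / 4) ×ˢ (strip n (s - 2 * σ) ×ˢ O) := by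
    intro z hz ω hω
    rw [mem_phaseDomain hr4] at hz
    exact ⟨by simpa using hz.1, hz.2, hω⟩
  refine ⟨fun p => inlCurve n (J (p.1.1, (p.1.2, p.2))) + inrCurve n (Θ (p.1.2, p.2)), ?_, ?_, ?_⟩
  · rintro ⟨z, ω⟩ ⟨hz, hω⟩
    have h1 := hmem z hz ω hω
    refine AnalyticAt.fun_add (analyticAt_clm_comp ?_ _) (analyticAt_clm_comp ?_ _)
    · refine AnalyticAt.fun_comp (g := J) (f := fun p : Phase n × CVec n => (p.1.1, (p.1.2, p.2)))
        (hJa _ h1) ?_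
      exact (analyticAt_fst.fun_comp analyticAt_fst).prod
        ((analyticAt_snd.fun_comp analyticAt_fst).prod analyticAt_snd)
    · refine AnalyticAt.fun_comp (g := Θ) (f := fun p : Phase n × CVec n => (p.1.2, p.2))
        (hΘa _ h1.2) ?_
      exact (analyticAt_snd.fun_comp analyticAt_fst).prod analyticAt_snd
  · intro z hz ω hω
    have h1 := hmem z hz ω hω
    exact isHamCurve_iff.2 ⟨(hJ _ h1).2, (hΘ _ h1.2).2⟩
  · intro z hz ω hω t
    have h1 := hmem z hz ω hω
    rw [inl_add_inr_apply, mem_phaseDomain hr2]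
    exact ⟨((J _).norm_coe_le_norm t).trans_lt (hJ _ h1).1, (hΘ _ h1.2).1 t⟩

namespace IsTrigFlow

variable {Γ : Phase n × CVec n → C(unitInterval, Phase n)} {z : Phase n} {ω : CVec n}

theorem mem_strip (h : IsSmallTrigHam S A B O r s σ M) (hΓ : IsTrigFlow S A B O r s σ Γ)
    (hz : z ∈ phaseDomain n (r / 4) (s - 2 * σ)) (hω : ω ∈ O) (t : unitInterval) :
    (Γ (z, ω) t).2 ∈ strip n (s - σ) :=
  ((mem_phaseDomain (by linarith [h.r_pos])).1 (hΓ.mem z hz ω hω t)).2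

theorem hasDerivWithinAt (hΓ : IsTrigFlow S A B O r s σ Γ)
    (hz : z ∈ phaseDomain n (r / 4) (s - 2 * σ)) (hω : ω ∈ O) {t : ℝ} (ht : t ∈ Icc (0 : ℝ) 1) :
    HasDerivWithinAt (extendCurve (Γ (z, ω)))
      (hamVectorField (trigHam S A B) ω (extendCurve (Γ (z, ω)) t)) (Icc 0 1) t := by
  have h1 := hasDerivWithinAt_extendCurve (hΓ.curve z hz ω hω) ht
  rwa [hamCurve_apply, ← extendCurve_coe] at h1

theorem apply_zero (hΓ : IsTrigFlow S A B O r s σ Γ)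
    (hz : z ∈ phaseDomain n (r / 4) (s - 2 * σ)) (hω : ω ∈ O) : Γ (z, ω) 0 = z := by
  have h1 : Γ (z, ω) 0 = (constCurve (Phase n) z +
      volterra (Phase n) (hamCurve S A B ω (Γ (z, ω)))) 0 :=
    congrArg (fun f : C(unitInterval, Phase n) => f 0) (hΓ.curve z hz ω hω)
  rw [h1, ContinuousMap.add_apply, volterra_apply]
  simp [constCurve_apply]

theorem isTimeOneMap (hΓ : IsTrigFlow S A B O r s σ Γ) :
    IsTimeOneMap (trigHam S A B) (fun p => Γ p 1) (phaseDomain n (r / 4) (s - 2 * σ))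
      (phaseDomain n (r / 2) (s - σ)) O := by
  intro z hz ω hω
  refine ⟨extendCurve (Γ (z, ω)), ?_, ?_, fun t ht => ⟨?_, hΓ.hasDerivWithinAt hz hω ht⟩⟩
  · exact (extendCurve_coe (Γ (z, ω)) 0).trans (hΓ.apply_zero hz hω)
  · exact extendCurve_coe (Γ (z, ω)) 1
  · exact hΓ.mem z hz ω hω _

theorem norm_action_sub_le (h : IsSmallTrigHam S A B O r s σ M)
    (hΓ : IsTrigFlow S A B O r s σ Γ) (hz : z ∈ phaseDomain n (r / 4) (s - 2 * σ)) (hω : ω ∈ O)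
    (t : unitInterval) : ‖(Γ (z, ω) t).1 - z.1‖ ≤ 2 * M / σ := by
  have h0 := hΓ.curve z hz ω hω
  rw [← inl_add_inr_curve (Γ (z, ω)), isHamCurve_iff] at h0
  have h1 : (Γ (z, ω) t).1 - z.1 = -(volterra (CVec n) (angleGradCurve S A B ω
      (fstCurve n (Γ (z, ω))) (sndCurve n (Γ (z, ω)))) t) := by
    have h2 := congrArg (fun f : C(unitInterval, CVec n) => f t) h0.1
    simp only [fstCurve_apply, ContinuousMap.sub_apply, constCurve_apply] at h2
    rw [h2]; abel
  rw [h1, norm_neg]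
  refine (ContinuousMap.norm_coe_le_norm _ t).trans ((norm_volterra_le _).trans
    (norm_curve_le fun u => ?_))
  rw [angleGradCurve_apply]
  have h3 := (mem_phaseDomain (by linarith [h.r_pos])).1 (hΓ.mem z hz ω hω u)
  exact norm_angleGrad_le h.r_pos h.sigma_pos (h.bound ω hω)
    (h3.1.trans (by linarith [h.r_pos])) h3.2

theorem norm_angle_sub_le (h : IsSmallTrigHam S A B O r s σ M)
    (hΓ : IsTrigFlow S A B O r s σ Γ) (hz : z ∈ phaseDomain n (r / 4) (s - 2 * σ)) (hω : ω ∈ O)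
    (t : unitInterval) : ‖(Γ (z, ω) t).2 - z.2‖ ≤ 2 * M / r := by
  have h0 := hΓ.curve z hz ω hω
  rw [← inl_add_inr_curve (Γ (z, ω)), isHamCurve_iff] at h0
  have h1 : (Γ (z, ω) t).2 - z.2 = volterra (CVec n) (actionGradCurve S B ω
      (sndCurve n (Γ (z, ω)))) t := by
    have h2 := congrArg (fun f : C(unitInterval, CVec n) => f t) h0.2
    simp only [sndCurve_apply, ContinuousMap.add_apply, constCurve_apply] at h2
    rw [h2]; abel
  rw [h1]
  refine (ContinuousMap.norm_coe_le_norm _ t).trans ((norm_volterra_le _).trans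
    (norm_curve_le fun u => ?_))
  rw [actionGradCurve_apply]
  exact norm_actionGrad_le h.r_pos (h.bound ω hω)
    (strip_mono (by linarith [h.sigma_pos]) (hΓ.mem_strip h hz hω u))

/-- The angles of the flow do not depend on the initial actions. -/
theorem sndCurve_eq (h : IsSmallTrigHam S A B O r s σ M) (hΓ : IsTrigFlow S A B O r s σ Γ)
    {I I' θ : CVec n} (hI : (I, θ) ∈ phaseDomain n (r / 4) (s - 2 * σ))
    (hI' : (I', θ) ∈ phaseDomain n (r / 4) (s - 2 * σ)) (hω : ω ∈ O) :
    sndCurve n (Γ ((I, θ), ω)) = sndCurve n (Γ ((I', θ), ω)) := by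
  have h0 := hΓ.curve _ hI ω hω
  have h1 := hΓ.curve _ hI' ω hω
  rw [← inl_add_inr_curve (Γ _), isHamCurve_iff] at h0 h1
  exact isHamCurve_unique_angle h.r_pos h.sigma_pos h.bound_nonneg h.small (h.bound ω hω)
    (hΓ.mem_strip h hI hω) (hΓ.mem_strip h hI' hω) h0.2 h1.2

/-- The actions of the flow are affine functions of the initial actions. -/
theorem fstCurve_eq (h : IsSmallTrigHam S A B O r s σ M) (hΓ : IsTrigFlow S A B O r s σ Γ)
    {I θ : CVec n} (hI : (I, θ) ∈ phaseDomain n (r / 4) (s - 2 * σ)) (hω : ω ∈ O) :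
    fstCurve n (Γ ((I, θ), ω)) = fstCurve n (Γ ((0, θ), ω)) + ∑ j, I j • ((8 / r : ℂ) •
      (fstCurve n (Γ ((Pi.single j (r / 8 : ℂ), θ), ω)) - fstCurve n (Γ ((0, θ), ω)))) := by
  have hr := h.r_pos
  have hr4 : 0 < r / 4 := by linarith
  have hθ := ((mem_phaseDomain hr4).1 hI).2
  have hI0 : ((0 : CVec n), θ) ∈ phaseDomain n (r / 4) (s - 2 * σ) :=
    (mem_phaseDomain hr4).2 ⟨by simpa using hr, hθ⟩
  -- The affine map is read off from its values at zero and at the points `(r / 8) e_j`, which lie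
  -- safely inside the ball of radius `r / 4`; hence the factor `8 / r`.
  have hIj : ∀ j, ((Pi.single j (r / 8 : ℂ) : CVec n), θ) ∈ phaseDomain n (r / 4) (s - 2 * σ) := by
    intro j
    refine (mem_phaseDomain hr4).2 ⟨?_, hθ⟩
    rw [Pi.norm_single]
    simp [abs_of_pos hr]
    linarith
  set Θ := sndCurve n (Γ ((I, θ), ω)) with hΘ
  have key : ∀ I', (I', θ) ∈ phaseDomain n (r / 4) (s - 2 * σ) →
      fstCurve n (Γ ((I', θ), ω)) = constCurve (CVec n) I' -
        volterra (CVec n) (angleGradCurve S A B ω (fstCurve n (Γ ((I', θ), ω))) Θ) := by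
    intro I' hI'
    have h0 := hΓ.curve _ hI' ω hω
    rw [← inl_add_inr_curve (Γ _), isHamCurve_iff, hΓ.sndCurve_eq h hI' hI hω] at h0
    exact h0.1
  refine isHamCurve_unique_action h.r_pos h.sigma_pos h.bound_nonneg h.small (h.bound ω hω)
    (hΓ.mem_strip h hI hω) (key I hI) ?_
  set J₀ := fstCurve n (Γ ((0, θ), ω)) with hJ₀
  set J : Fin n → C(unitInterval, CVec n) :=
    fun j => fstCurve n (Γ ((Pi.single j (r / 8 : ℂ), θ), ω)) with hJ
  have h0 := key 0 hI0
  have hj := fun j => key _ (hIj j)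
  rw [← hJ₀] at h0
  -- The angle gradient is affine in the actions along the common angle curve `Θ`. So the affine
  -- interpolation solves the integral equation with initial action `I`, and uniqueness identifies
  -- it with the flow.
  have hlin : angleGradCurve S A B ω (J₀ + ∑ j, I j • ((8 / r : ℂ) • (J j - J₀))) Θ =
      angleGradCurve S A B ω J₀ Θ + ∑ j, I j • ((8 / r : ℂ) •
        (angleGradCurve S A B ω (J j) Θ - angleGradCurve S A B ω J₀ Θ)) := by
    ext1 t
    simp only [angleGradCurve_apply, ContinuousMap.add_apply, ContinuousMap.sum_apply,
      ContinuousMap.smul_apply, ContinuousMap.sub_apply]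
    rw [angleGrad_eq, angleGrad_eq ω (J₀ t), map_add, ← add_assoc, map_sum]
    congr 1
    refine Finset.sum_congr rfl fun j _ => ?_
    rw [map_smul, map_smul, map_sub, angleGrad_eq ω (J j t)]
    congr 2
    abel
  rw [hlin, map_add, map_sum]
  have hconst : constCurve (CVec n) I = ∑ j, I j • ((8 / r : ℂ) •
      constCurve (CVec n) (Pi.single j (r / 8 : ℂ))) := by
    simp only [← map_smul, ← map_sum]
    congr 1
    ext l
    have hr' : (r : ℂ) ≠ 0 := by exact_mod_cast hr.ne'
    simp [Finset.sum_apply, Pi.single_apply]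
    field_simp
  have hsum : ∀ j, J j - J₀ = constCurve (CVec n) (Pi.single j (r / 8 : ℂ)) - volterra (CVec n)
      (angleGradCurve S A B ω (J j) Θ - angleGradCurve S A B ω J₀ Θ) := by
    intro j
    rw [map_sub]
    conv_lhs => rw [h0, show J j = _ from hj j]
    simp only [map_zero]
    abel
  have hsum2 : ∑ j, I j • ((8 / r : ℂ) • (J j - J₀)) = constCurve (CVec n) I - ∑ j, volterra (CVec n)
      (I j • ((8 / r : ℂ) • (angleGradCurve S A B ω (J j) Θ - angleGradCurve S A B ω J₀ Θ))) := by
    rw [hconst, ← Finset.sum_sub_distrib]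
    refine Finset.sum_congr rfl fun j _ => ?_
    conv_lhs => rw [hsum j]
    rw [smul_sub, smul_sub, map_smul, map_smul]
  change J₀ + ∑ j, I j • ((8 / r : ℂ) • (J j - J₀)) = _
  rw [hsum2]
  conv_lhs => arg 1; rw [h0]
  rw [map_zero]
  abel

end IsTrigFlow

end KAM

/-! ### Reality, periodicity and symplecticity of the flow -/

namespace KAM

open Metric Set Filter Topology
variable {n : ℕ} {S : Finset (Fin n → ℤ)} {A : (Fin n → ℤ) → CVec n → ℂ}
  {B : (Fin n → ℤ) → CVec n → CVec n} {O : Set (CVec n)} {r s σ M : ℝ}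

/-- Trigonometric polynomials that are real for real arguments and parameters in `O`. -/
structure IsRealTrig (S : Finset (Fin n → ℤ)) (A : (Fin n → ℤ) → CVec n → ℂ)
    (B : (Fin n → ℤ) → CVec n → CVec n) (O : Set (CVec n)) : Prop where
  neg_mem : ∀ k ∈ S, -k ∈ S
  zero : ∀ ω ∈ O, star ω = ω → ∀ k, A (-k) ω = star (A k ω)
  one : ∀ ω ∈ O, star ω = ω → ∀ k, B (-k) ω = star (B k ω)

theorem star_expChar (k : Fin n → ℤ) (θ : CVec n) :
    star (expChar k θ) = expChar (-k) (star θ) := by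
  simp only [expChar, Complex.star_def, ← Complex.exp_conj, map_mul, Complex.conj_I, map_sum,
    Pi.neg_apply, Pi.star_apply, map_intCast, Int.cast_neg, neg_mul, Finset.sum_neg_distrib,
    mul_neg]

namespace IsRealTrig

variable {ω : CVec n}

/-- Complex conjugation exchanges the characters of `k` and `-k`; every reality statement reduces to
this reindexing of the symmetric index set. -/
theorem sum_neg (h : IsRealTrig S A B O) {V : Type*} [AddCommMonoid V] (f : (Fin n → ℤ) → V) :
    ∑ k ∈ S, f (-k) = ∑ k ∈ S, f k :=
  Finset.sum_nbij' (fun k => -k) (fun k => -k) (fun k hk => h.neg_mem k hk)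
    (fun k hk => h.neg_mem k hk) (fun k _ => neg_neg k) (fun k _ => neg_neg k) fun _ _ => rfl

theorem star_coeff (h : IsRealTrig S A B O) (hω : ω ∈ O) (hr : star ω = ω) (k : Fin n → ℤ)
    (J : CVec n) : star (A k ω + ∑ l, B k ω l * J l) = A (-k) ω + ∑ l, B (-k) ω l * star J l := by
  rw [h.zero ω hω hr, h.one ω hω hr]
  simp only [Complex.star_def, map_add, map_sum, map_mul, Pi.star_apply]

theorem star_trigHam (h : IsRealTrig S A B O) (hω : ω ∈ O) (hr : star ω = ω) (z : Phase n) :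
    star (trigHam S A B (z, ω)) = trigHam S A B (star z, ω) := by
  simp only [trigHam, star_sum, star_mul', h.star_coeff hω hr, star_expChar]
  exact h.sum_neg fun k => (A k ω + ∑ l, B k ω l * (star z).1 l) * expChar k (star z).2

theorem star_actionGrad (h : IsRealTrig S A B O) (hω : ω ∈ O) (hr : star ω = ω) (θ : CVec n) :
    star (actionGrad S B ω θ) = actionGrad S B ω (star θ) := by
  ext j
  simp only [actionGrad, Pi.star_apply, star_sum, star_mul', star_expChar]
  rw [← h.sum_neg]
  refine Finset.sum_congr rfl fun k _ => ?_
  simp only [h.one ω hω hr, Pi.star_apply, star_star, neg_neg]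

theorem star_angleGrad (h : IsRealTrig S A B O) (hω : ω ∈ O) (hr : star ω = ω) (J θ : CVec n) :
    star (angleGrad S A B ω J θ) = angleGrad S A B ω (star J) (star θ) := by
  ext j
  simp only [angleGrad, Pi.star_apply, star_sum, star_mul', star_expChar, h.star_coeff hω hr]
  rw [← h.sum_neg]
  refine Finset.sum_congr rfl fun k _ => ?_
  simp

theorem star_hamVectorField (h : IsRealTrig S A B O) (hω : ω ∈ O) (hr : star ω = ω)
    (z : Phase n) : star (hamVectorField (trigHam S A B) ω z) =
      hamVectorField (trigHam S A B) ω (star z) := by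
  rw [hamVectorField_trigHam, hamVectorField_trigHam]
  refine Prod.ext ?_ ?_
  · simp only [Prod.fst_star, star_neg, h.star_angleGrad hω hr, Prod.snd_star]
  · simp only [Prod.snd_star, h.star_actionGrad hω hr]

end IsRealTrig

theorem volterra_star (γ : C(unitInterval, Phase n)) :
    volterra (Phase n) (star γ) = star (volterra (Phase n) γ) := by
  ext1 t
  rw [volterra_apply, ContinuousMap.star_apply, volterra_apply]
  exact ((starL' ℝ : Phase n ≃L[ℝ] Phase n) : Phase n →L[ℝ] Phase n).intervalIntegral_comp_comm
    ((continuous_extendCurve γ).intervalIntegrable _ _)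

theorem star_mem_strip {θ : CVec n} (hθ : θ ∈ strip n s) : star θ ∈ strip n s := by
  intro j
  simpa using hθ j

theorem hamVectorField_angleShift (ω : CVec n) (z : Phase n) (k : Fin n → ℤ) :
    hamVectorField (trigHam S A B) ω (z + (0, angleShift k)) =
      hamVectorField (trigHam S A B) ω z := by
  rw [hamVectorField_trigHam, hamVectorField_trigHam]
  refine Prod.ext (funext fun j => ?_) (funext fun j => ?_) <;>
    simp only [angleGrad, actionGrad, Prod.fst_add, Prod.snd_add, add_zero, expChar_add,
      expChar_angleShift, mul_one, Pi.neg_apply]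

theorem add_angleShift_mem_strip {θ : CVec n} (hθ : θ ∈ strip n s) (k : Fin n → ℤ) :
    θ + angleShift k ∈ strip n s := by
  intro j
  simpa [angleShift_im] using hθ j

theorem add_angleShift_mem_phaseDomain {z : Phase n} (hz : z ∈ phaseDomain n r s)
    (k : Fin n → ℤ) : z + (0, angleShift k) ∈ phaseDomain n r s :=
  ⟨by simpa using hz.1, add_angleShift_mem_strip hz.2 k⟩

/-- A hamiltonian vector field is paired with the symplectic form to the differential. -/
theorem symplecticForm_hamVectorField (f : Phase n × CVec n → ℂ) (ω : CVec n) (z v : Phase n) :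
    symplecticForm (hamVectorField f ω z) v = -(fderiv ℂ (fun w : Phase n => f (w, ω)) z v) := by
  classical
  have hv : v = ∑ j, v.1 j • ((Pi.single j 1, 0) : Phase n) +
      ∑ j, v.2 j • ((0, Pi.single j 1) : Phase n) := by
    refine Prod.ext ?_ ?_ <;> ext l <;>
      simp [Prod.fst_sum, Prod.snd_sum, Finset.sum_apply, Pi.single_apply]
  conv_rhs => rw [hv]
  simp only [map_add, map_sum, map_smul, smul_eq_mul, symplecticForm, hamVectorField, neg_add,
    ← Finset.sum_neg_distrib, ← Finset.sum_add_distrib]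
  exact Finset.sum_congr rfl fun j _ => by ring

theorem symplecticForm_swap (u v : Phase n) : symplecticForm u v = -symplecticForm v u := by
  simp only [symplecticForm, ← Finset.sum_neg_distrib]
  exact Finset.sum_congr rfl fun j _ => by ring

/-- The symplectic form as a linear functional of its first argument. -/
noncomputable def symplecticLeft (v : Phase n) : Phase n →L[ℂ] ℂ :=
  ∑ j, (v.2 j • (ContinuousLinearMap.proj (R := ℂ) (φ := fun _ : Fin n => ℂ) j ∘L
      ContinuousLinearMap.fst ℂ (CVec n) (CVec n)) -
    v.1 j • (ContinuousLinearMap.proj (R := ℂ) (φ := fun _ : Fin n => ℂ) j ∘L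
      ContinuousLinearMap.snd ℂ (CVec n) (CVec n)))

theorem symplecticLeft_apply (u v : Phase n) : symplecticLeft v u = symplecticForm u v := by
  simp only [symplecticLeft, symplecticForm, sum_apply, sub_apply, smul_apply,
    ContinuousLinearMap.comp_apply, ContinuousLinearMap.proj_apply, smul_eq_mul,
    ContinuousLinearMap.coe_fst', ContinuousLinearMap.coe_snd']
  exact Finset.sum_congr rfl fun j _ => by ring

theorem hasDerivWithinAt_symplecticForm {ξ ζ : ℝ → Phase n} {ξ' ζ' : Phase n} {s : Set ℝ} {t : ℝ}
    (hξ : HasDerivWithinAt ξ ξ' s t) (hζ : HasDerivWithinAt ζ ζ' s t) :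
    HasDerivWithinAt (fun t => symplecticForm (ξ t) (ζ t))
      (symplecticForm ξ' (ζ t) + symplecticForm (ξ t) ζ') s t := by
  have h1 : ∀ {ξ : ℝ → Phase n} {ξ' : Phase n}, HasDerivWithinAt ξ ξ' s t → ∀ j,
      HasDerivWithinAt (fun t => (ξ t).1 j) (ξ'.1 j) s t := fun h j =>
    hasDerivWithinAt_pi.1 (hasFDerivWithinAt_fst.comp_hasDerivWithinAt t h (mapsTo_univ _ _)) j
  have h2 : ∀ {ξ : ℝ → Phase n} {ξ' : Phase n}, HasDerivWithinAt ξ ξ' s t → ∀ j,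
      HasDerivWithinAt (fun t => (ξ t).2 j) (ξ'.2 j) s t := fun h j =>
    hasDerivWithinAt_pi.1 (hasFDerivWithinAt_snd.comp_hasDerivWithinAt t h (mapsTo_univ _ _)) j
  have h3 := HasDerivWithinAt.fun_sum (u := Finset.univ) fun j _ =>
    ((h1 hξ j).fun_mul (h2 hζ j)).fun_sub ((h2 hξ j).fun_mul (h1 hζ j))
  refine h3.congr_deriv ?_
  simp only [symplecticForm, ← Finset.sum_add_distrib]
  exact Finset.sum_congr rfl fun j _ => by ring

section

variable {f : Phase n × CVec n → ℂ} {ω : CVec n} {z : Phase n}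

theorem analyticAt_hamVectorField (hf : AnalyticAt ℂ (fun w : Phase n => f (w, ω)) z) :
    AnalyticAt ℂ (hamVectorField f ω) z := by
  have h : ∀ v, AnalyticAt ℂ (fun w => fderiv ℂ (fun w : Phase n => f (w, ω)) w v) z := fun v =>
    analyticAt_clm_comp hf.fderiv (ContinuousLinearMap.apply ℂ ℂ v)
  exact (AnalyticAt.pi fun j => (h _).fun_neg).prod (AnalyticAt.pi fun j => h _)

/-- The derivative of a hamiltonian vector field is infinitesimally symplectic. -/
theorem symplecticForm_fderiv_hamVectorField
    (hf : AnalyticAt ℂ (fun w : Phase n => f (w, ω)) z) (u v : Phase n) :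
    symplecticForm (fderiv ℂ (hamVectorField f ω) z u) v +
      symplecticForm u (fderiv ℂ (hamVectorField f ω) z v) = 0 := by
  have key : ∀ a b : Phase n, symplecticForm (fderiv ℂ (hamVectorField f ω) z a) b =
      -(fderiv ℂ (fderiv ℂ (fun w : Phase n => f (w, ω))) z a b) := by
    intro a b
    have h1 : HasFDerivAt (fun w => symplecticLeft b (hamVectorField f ω w))
        ((symplecticLeft b).comp (fderiv ℂ (hamVectorField f ω) z)) z :=
      (symplecticLeft b).hasFDerivAt.comp z
        (analyticAt_hamVectorField hf).differentiableAt.hasFDerivAt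
    have h2 : (fun w => symplecticLeft b (hamVectorField f ω w)) =
        fun w => -(fderiv ℂ (fun w : Phase n => f (w, ω)) w b) := by
      funext w
      rw [symplecticLeft_apply, symplecticForm_hamVectorField]
    rw [h2] at h1
    have h3 : HasFDerivAt (fun w => -(fderiv ℂ (fun w : Phase n => f (w, ω)) w b)) _ z :=
      (hf.fderiv.differentiableAt.hasFDerivAt.clm_apply (hasFDerivAt_const b z)).fun_neg
    have h4 := congrArg (fun L : Phase n →L[ℂ] ℂ => L a) (h1.unique h3)
    simpa [symplecticLeft_apply] using h4
  have hsymm : IsSymmSndFDerivAt ℂ (fun w : Phase n => f (w, ω)) z :=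
    ContDiffAt.isSymmSndFDerivAt_of_omega hf.contDiffAt
  rw [key, symplecticForm_swap u, key, hsymm.eq u v]
  ring

end

theorem isOpen_phaseDomain (hr : 0 < r) : IsOpen (phaseDomain n r s) := by
  have h : phaseDomain n r s = {z | ‖z.1‖ < r} ∩ Prod.snd ⁻¹' strip n s := by
    ext z
    exact mem_phaseDomain hr
  rw [h]
  exact (isOpen_lt (by fun_prop) continuous_const).inter ((isOpen_strip s).preimage continuous_snd)

theorem hasFDerivAt_curve_apply (t : unitInterval) (γ : C(unitInterval, Phase n)) :
    HasFDerivAt (fun γ : C(unitInterval, Phase n) => γ t)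
      (ContinuousMap.evalCLM ℂ t : C(unitInterval, Phase n) →L[ℂ] Phase n) γ :=
  (ContinuousMap.evalCLM ℂ t : C(unitInterval, Phase n) →L[ℂ] Phase n).hasFDerivAt

namespace IsTrigFlow

variable {Γ : Phase n × CVec n → C(unitInterval, Phase n)} {z : Phase n} {ω : CVec n}

/-- The translate of an integral curve solves the same equation from the translated initial value,
because the vector field is periodic; uniqueness gives equality. -/
theorem equivariant (h : IsSmallTrigHam S A B O r s σ M) (hΓ : IsTrigFlow S A B O r s σ Γ)
    (hz : z ∈ phaseDomain n (r / 4) (s - 2 * σ)) (hω : ω ∈ O) (k : Fin n → ℤ) :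
    Γ (z + (0, angleShift k), ω) = Γ (z, ω) + constCurve (Phase n) (0, angleShift k) := by
  have hz' := add_angleShift_mem_phaseDomain hz k
  refine isHamCurve_unique h.r_pos h.sigma_pos h.bound_nonneg h.small (h.bound ω hω)
    (hΓ.mem_strip h hz' hω) (fun t => ?_) (hΓ.curve _ hz' ω hω) ?_
  · exact add_angleShift_mem_strip (hΓ.mem_strip h hz hω t) k
  · have h1 : hamCurve S A B ω (Γ (z, ω) + constCurve (Phase n) (0, angleShift k)) =
        hamCurve S A B ω (Γ (z, ω)) := by
      ext1 t
      rw [hamCurve_apply, hamCurve_apply, ContinuousMap.add_apply, constCurve_apply,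
        hamVectorField_angleShift]
    rw [IsHamCurve, h1, map_add]
    conv_lhs => rw [hΓ.curve z hz ω hω]
    abel

/-- For real `ω` the vector field commutes with conjugation, so the conjugate of the curve from a
real point solves the same initial value problem. -/
theorem star_eq (h : IsSmallTrigHam S A B O r s σ M) (hR : IsRealTrig S A B O)
    (hΓ : IsTrigFlow S A B O r s σ Γ) (hz : z ∈ phaseDomain n (r / 4) (s - 2 * σ)) (hω : ω ∈ O)
    (hz' : star z = z) (hω' : star ω = ω) : star (Γ (z, ω)) = Γ (z, ω) := by
  refine isHamCurve_unique h.r_pos h.sigma_pos h.bound_nonneg h.small (h.bound ω hω)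
    (fun t => ?_) (hΓ.mem_strip h hz hω) ?_ (hΓ.curve _ hz ω hω)
  · exact star_mem_strip (hΓ.mem_strip h hz hω t)
  · have h1 : hamCurve S A B ω (star (Γ (z, ω))) = star (hamCurve S A B ω (Γ (z, ω))) := by
      ext1 t
      rw [hamCurve_apply, ContinuousMap.star_apply, ContinuousMap.star_apply, hamCurve_apply,
        hR.star_hamVectorField hω hω']
    have h2 : constCurve (Phase n) z = star (constCurve (Phase n) z) := by
      ext1 t
      exact hz'.symm
    rw [IsHamCurve, h1, volterra_star, h2, ← star_add]
    exact congrArg star (hΓ.curve z hz ω hω)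

theorem analyticAt_hamCurve (hA : ∀ k ∈ S, AnalyticAt ℂ (A k) ω)
    (hB : ∀ k ∈ S, AnalyticAt ℂ (B k) ω) (γ : C(unitInterval, Phase n)) :
    AnalyticAt ℂ (hamCurve S A B ω) γ := by
  refine AnalyticAt.fun_add (analyticAt_clm_comp (AnalyticAt.fun_neg ?_) _)
    (analyticAt_clm_comp ?_ _)
  · exact analyticAt_angleGradCurve (ω := fun _ => ω) analyticAt_const ((fstCurve n).analyticAt γ)
      ((sndCurve n).analyticAt γ) hA hB
  · exact analyticAt_actionGradCurve (ω := fun _ => ω) analyticAt_const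
      ((sndCurve n).analyticAt γ) hB

theorem analyticAt_left (hΓ : IsTrigFlow S A B O r s σ Γ)
    (hz : z ∈ phaseDomain n (r / 4) (s - 2 * σ)) (hω : ω ∈ O) :
    AnalyticAt ℂ (fun w : Phase n => Γ (w, ω)) z :=
  AnalyticAt.fun_comp (g := Γ) (f := fun w : Phase n => (w, ω)) (hΓ.analytic _ ⟨hz, hω⟩)
    (analyticAt_id.prod analyticAt_const)

/-- The linearization of the flow satisfies the variational equation. -/
theorem hasDerivWithinAt_fderiv (h : IsSmallTrigHam S A B O r s σ M)
    (hΓ : IsTrigFlow S A B O r s σ Γ) (hz : z ∈ phaseDomain n (r / 4) (s - 2 * σ)) (hω : ω ∈ O)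
    (u : Phase n) {t : ℝ} (ht : t ∈ Icc (0 : ℝ) 1) :
    HasDerivWithinAt (extendCurve (fderiv ℂ (fun w : Phase n => Γ (w, ω)) z u))
      (fderiv ℂ (hamVectorField (trigHam S A B) ω) (extendCurve (Γ (z, ω)) t)
        (extendCurve (fderiv ℂ (fun w : Phase n => Γ (w, ω)) z u) t)) (Icc 0 1) t := by
  set Y := fun w : Phase n => Γ (w, ω) with hY
  have hYd : HasFDerivAt Y (fderiv ℂ Y z) z := (hΓ.analyticAt_left hz hω).differentiableAt.hasFDerivAt
  have hA := h.analytic_zero ω hω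
  have hB := h.analytic_one ω hω
  have hH : HasFDerivAt (hamCurve S A B ω) (fderiv ℂ (hamCurve S A B ω) (Y z)) (Y z) :=
    (analyticAt_hamCurve hA hB _).differentiableAt.hasFDerivAt
  have h1 : HasFDerivAt Y (constCurve (Phase n) + (volterra (Phase n)).comp
      ((fderiv ℂ (hamCurve S A B ω) (Y z)).comp (fderiv ℂ Y z))) z := by
    -- The variational equation is obtained by differentiating the integral equation as an identity
    -- in the curve space; `h5` then shows that the derivative of the lifted vector field acts
    -- pointwise.
    have h2 : HasFDerivAt (fun w => constCurve (Phase n) w +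
        volterra (Phase n) (hamCurve S A B ω (Y w))) (constCurve (Phase n) +
        (volterra (Phase n)).comp ((fderiv ℂ (hamCurve S A B ω) (Y z)).comp (fderiv ℂ Y z))) z :=
      (constCurve (Phase n)).hasFDerivAt.add
        ((volterra (Phase n)).hasFDerivAt.comp z (hH.comp z hYd))
    refine h2.congr_of_eventuallyEq ?_
    filter_upwards [(isOpen_phaseDomain (by linarith [h.r_pos])).mem_nhds hz] with w hw
    exact hΓ.curve w hw ω hω
  have h3 : fderiv ℂ Y z u = ContinuousMap.const unitInterval u +
      volterra (Phase n) (fderiv ℂ (hamCurve S A B ω) (Y z) (fderiv ℂ Y z u)) := by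
    conv_lhs => rw [h1.fderiv]
    rfl
  have h4 := hasDerivWithinAt_extendCurve h3 ht
  have h5 : ∀ (t : unitInterval) (γ η : C(unitInterval, Phase n)),
      fderiv ℂ (hamCurve S A B ω) γ η t =
        fderiv ℂ (hamVectorField (trigHam S A B) ω) (γ t) (η t) := by
    intro t γ η
    have e1 : HasFDerivAt (fun γ : C(unitInterval, Phase n) => hamCurve S A B ω γ t)
        ((ContinuousMap.evalCLM ℂ t).comp (fderiv ℂ (hamCurve S A B ω) γ)) γ :=
      (hasFDerivAt_curve_apply t _).comp γ
        (analyticAt_hamCurve hA hB _).differentiableAt.hasFDerivAt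
    have e2 : HasFDerivAt (fun γ : C(unitInterval, Phase n) =>
        hamVectorField (trigHam S A B) ω (γ t))
        ((fderiv ℂ (hamVectorField (trigHam S A B) ω) (γ t)).comp (ContinuousMap.evalCLM ℂ t)) γ :=
      HasFDerivAt.comp γ (g := hamVectorField (trigHam S A B) ω)
        (f := fun γ : C(unitInterval, Phase n) => γ t)
        ((analyticAt_hamVectorField ((analyticAt_trigHam (p := (γ t, ω)) hA hB).fun_comp
          (f := fun w => (w, ω)) (analyticAt_id.prod analyticAt_const))).differentiableAt.hasFDerivAt)
        (hasFDerivAt_curve_apply t _)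
    have e3 : (fun γ : C(unitInterval, Phase n) => hamCurve S A B ω γ t) =
        fun γ => hamVectorField (trigHam S A B) ω (γ t) := funext fun γ => hamCurve_apply ω γ t
    rw [e3] at e1
    exact congrArg (fun L : C(unitInterval, Phase n) →L[ℂ] Phase n => L η) (e1.unique e2)
  rw [h5] at h4
  have h6 : ∀ f : C(unitInterval, Phase n), f ⟨t, ht⟩ = extendCurve f t := fun f =>
    (extendCurve_coe f ⟨t, ht⟩).symm
  rwa [h6, h6] at h4

/-- The flow is symplectic. -/
theorem symplectic (h : IsSmallTrigHam S A B O r s σ M)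
    (hΓ : IsTrigFlow S A B O r s σ Γ) (hz : z ∈ phaseDomain n (r / 4) (s - 2 * σ)) (hω : ω ∈ O)
    (u v : Phase n) :
    symplecticForm (fderiv ℂ (fun w : Phase n => Γ (w, ω) 1) z u)
      (fderiv ℂ (fun w : Phase n => Γ (w, ω) 1) z v) = symplecticForm u v := by
  set Y := fun w : Phase n => Γ (w, ω) with hY
  have hYd : HasFDerivAt Y (fderiv ℂ Y z) z := (hΓ.analyticAt_left hz hω).differentiableAt.hasFDerivAt
  have hA := h.analytic_zero ω hω
  have hB := h.analytic_one ω hω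
  have heval : ∀ (t : unitInterval) (u : Phase n),
      fderiv ℂ (fun w : Phase n => Γ (w, ω) t) z u = fderiv ℂ Y z u t := by
    intro t u
    have e1 : HasFDerivAt (fun w : Phase n => Γ (w, ω) t)
        ((ContinuousMap.evalCLM ℂ t).comp (fderiv ℂ Y z)) z :=
      (hasFDerivAt_curve_apply t _).comp z hYd
    rw [e1.fderiv]; rfl
  have hzero : ∀ u : Phase n, fderiv ℂ Y z u 0 = u := by
    intro u
    rw [← heval]
    have e1 : (fun w : Phase n => Γ (w, ω) 0) =ᶠ[𝓝 z] id := by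
      filter_upwards [(isOpen_phaseDomain (by linarith [h.r_pos])).mem_nhds hz] with w hw
      exact hΓ.apply_zero hw hω
    rw [e1.fderiv_eq, fderiv_id]; rfl
  -- The symplectic product of two solutions of the variational equation is constant, since the
  -- linearised field is infinitesimally symplectic. At time zero it is the product of `u` and `v`.
  set g : ℝ → ℂ := fun t => symplecticForm (extendCurve (fderiv ℂ Y z u) t)
    (extendCurve (fderiv ℂ Y z v) t) with hg
  have hgd : ∀ t ∈ Icc (0 : ℝ) 1, HasDerivWithinAt g 0 (Icc 0 1) t := by
    intro t ht
    refine (hasDerivWithinAt_symplecticForm (hΓ.hasDerivWithinAt_fderiv h hz hω u ht)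
      (hΓ.hasDerivWithinAt_fderiv h hz hω v ht)).congr_deriv ?_
    exact symplecticForm_fderiv_hamVectorField ((analyticAt_trigHam
      (p := (extendCurve (Γ (z, ω)) t, ω)) hA hB).fun_comp
          (f := fun w => (w, ω)) (analyticAt_id.prod analyticAt_const)) _ _
  have hc : g 1 = g 0 := by
    refine constant_of_has_deriv_right_zero (a := 0) (b := 1)
      (fun t ht => (hgd t ht).continuousWithinAt) (fun t ht => ?_) 1 ⟨zero_le_one, le_rfl⟩
    exact (hgd t (Ico_subset_Icc_self ht)).mono_of_mem_nhdsWithin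
      (Icc_mem_nhdsGE_of_mem ht)
  have e0 : ∀ f : C(unitInterval, Phase n), extendCurve f 0 = f 0 := fun f => extendCurve_coe f 0
  have e1 : ∀ f : C(unitInterval, Phase n), extendCurve f 1 = f 1 := fun f => extendCurve_coe f 1
  rw [hg] at hc
  simp only [e0, e1, hzero] at hc
  rw [heval, heval, hc]

end IsTrigFlow

end KAM

/-! ### Weighted Cauchy estimates and the homological equation along the flow -/

namespace KAM

open Metric Set Filter Topology
variable {n : ℕ} {S : Finset (Fin n → ℤ)} {A : (Fin n → ℤ) → CVec n → ℂ}
  {B : (Fin n → ℤ) → CVec n → CVec n} {O : Set (CVec n)} {r s σ M : ℝ}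

theorem weight_apply (z : Phase n) :
    weight n r σ z = (((r⁻¹ : ℝ) : ℂ) • z.1, ((σ⁻¹ : ℝ) : ℂ) • z.2) := rfl

theorem norm_weight_le (hr : 0 < r) (hσ : 0 < σ) {z : Phase n} {κ : ℝ} (h1 : ‖z.1‖ ≤ κ * r)
    (h2 : ‖z.2‖ ≤ κ * σ) : ‖weight n r σ z‖ ≤ κ := by
  rw [weight_apply, Prod.norm_mk, max_le_iff, norm_smul, norm_smul, Complex.norm_real,
    Complex.norm_real, Real.norm_of_nonneg (by positivity), Real.norm_of_nonneg (by positivity),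
    inv_mul_le_iff₀ hr, inv_mul_le_iff₀ hσ]
  constructor <;> linarith

theorem weight_weight (hr : 0 < r) (hσ : 0 < σ) (z : Phase n) :
    weight n r⁻¹ σ⁻¹ (weight n r σ z) = z := by
  have h1 : (r : ℂ) ≠ 0 := by exact_mod_cast hr.ne'
  have h2 : (σ : ℂ) ≠ 0 := by exact_mod_cast hσ.ne'
  simp [weight_apply, smul_smul, h1, h2]

theorem norm_weight_inv_fst_le (hr : 0 < r) (x : Phase n) :
    ‖(weight n r⁻¹ σ⁻¹ x).1‖ ≤ r * ‖x‖ := by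
  rw [weight_apply, inv_inv, norm_smul, Complex.norm_real, Real.norm_of_nonneg hr.le]
  exact mul_le_mul_of_nonneg_left (norm_fst_le x) hr.le

theorem norm_weight_inv_snd_le (hσ : 0 < σ) (x : Phase n) :
    ‖(weight n r⁻¹ σ⁻¹ x).2‖ ≤ σ * ‖x‖ := by
  rw [weight_apply, inv_inv σ, norm_smul, Complex.norm_real, Real.norm_of_nonneg hσ.le]
  exact mul_le_mul_of_nonneg_left (norm_snd_le x) hσ.le

theorem convex_phaseDomain (r s : ℝ) : Convex ℝ (phaseDomain n r s) := by
  rcases le_or_gt r 0 with hr | hr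
  · rcases isEmpty_or_nonempty (Fin n) with hn | ⟨⟨j⟩⟩
    · have h : phaseDomain n r s = univ := eq_univ_of_forall fun z => ⟨hn.elim, hn.elim⟩
      rw [h]; exact convex_univ
    · have h : phaseDomain n r s = ∅ := eq_empty_of_forall_notMem fun z hz =>
        absurd ((norm_nonneg _).trans_lt (hz.1 j)) hr.not_gt
      rw [h]; exact convex_empty
  · have h : phaseDomain n r s = LinearMap.fst ℝ (CVec n) (CVec n) ⁻¹' ball 0 r ∩
        LinearMap.snd ℝ (CVec n) (CVec n) ⁻¹' strip n s := by
      ext z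
      rw [mem_phaseDomain hr]
      simp
    rw [h]
    exact ((convex_ball _ _).linear_preimage _).inter ((convex_strip s).linear_preimage _)

theorem phaseDomain_mono {r' s' : ℝ} (hr : r ≤ r') (hs : s ≤ s') :
    phaseDomain n r s ⊆ phaseDomain n r' s' :=
  fun _ hw => ⟨fun j => (hw.1 j).trans_le hr, fun j => (hw.2 j).trans_le hs⟩

section Cauchy

variable {E : Type*} [NormedAddCommGroup E] [NormedSpace ℂ E] {f : Phase n → E} {ρ κ C : ℝ}

/-- The Cauchy estimate in weighted coordinates. -/
theorem norm_fderiv_comp_weight_le (hρ : 0 < ρ - κ * r) (hr : 0 < r) (hσ : 0 < σ) (hκ : 0 < κ)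
    (hf : ∀ z ∈ phaseDomain n ρ s, DifferentiableAt ℂ f z)
    (hC : ∀ z ∈ phaseDomain n ρ s, ‖f z‖ ≤ C) {z : Phase n}
    (hz : z ∈ phaseDomain n (ρ - κ * r) (s - κ * σ)) :
    ‖(fderiv ℂ f z).comp (weight n r⁻¹ σ⁻¹)‖ ≤ 2 * C / κ := by
  rw [mem_phaseDomain hρ] at hz
  have hρ' : 0 < ρ := by nlinarith
  -- In weighted coordinates a ball of radius `κ` corresponds to a polydisc of radius `κr` in the
  -- actions and `κσ` in the angles, so one Cauchy estimate treats both with the same loss.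
  have hmem : ∀ x ∈ ball (weight n r σ z) κ, weight n r⁻¹ σ⁻¹ x ∈ phaseDomain n ρ s := by
    intro x hx
    rw [mem_ball, dist_eq_norm] at hx
    have h0 : weight n r⁻¹ σ⁻¹ x = z + weight n r⁻¹ σ⁻¹ (x - weight n r σ z) := by
      rw [map_sub, weight_weight hr hσ]; abel
    have h1 := norm_weight_inv_fst_le (σ := σ) hr (x - weight n r σ z)
    have h2 := norm_weight_inv_snd_le (r := r) hσ (x - weight n r σ z)
    rw [mem_phaseDomain hρ', h0]
    refine ⟨(norm_add_le _ _).trans_lt ?_, add_mem_strip hz.2 ?_⟩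
    · nlinarith [hz.1]
    · simp only [Prod.snd_add, add_sub_cancel_left]
      nlinarith
  have h1 : ∀ x ∈ ball (weight n r σ z) κ, HasFDerivAt (fun x => f (weight n r⁻¹ σ⁻¹ x))
      ((fderiv ℂ f (weight n r⁻¹ σ⁻¹ x)).comp (weight n r⁻¹ σ⁻¹)) x := fun x hx =>
    (hf _ (hmem x hx)).hasFDerivAt.comp x (weight n r⁻¹ σ⁻¹).hasFDerivAt
  have h2 := norm_fderiv_le_of_norm_le hκ
    (fun x hx => (h1 x hx).differentiableAt.differentiableWithinAt)
    (fun x hx => hC _ (hmem x hx))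
  rwa [(h1 _ (mem_ball_self hκ)).fderiv, weight_weight hr hσ] at h2

/-- Lipschitz estimate in weighted coordinates. -/
theorem norm_sub_le_weight (hρ : 0 < ρ - κ * r) (hr : 0 < r) (hσ : 0 < σ) (hκ : 0 < κ)
    (hf : ∀ z ∈ phaseDomain n ρ s, DifferentiableAt ℂ f z)
    (hC : ∀ z ∈ phaseDomain n ρ s, ‖f z‖ ≤ C) {z z' : Phase n}
    (hz : z ∈ phaseDomain n (ρ - κ * r) (s - κ * σ))
    (hz' : z' ∈ phaseDomain n (ρ - κ * r) (s - κ * σ)) :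
    ‖f z - f z'‖ ≤ 2 * C / κ * ‖weight n r σ (z - z')‖ := by
  have hmono : phaseDomain n (ρ - κ * r) (s - κ * σ) ⊆ phaseDomain n ρ s := fun w hw =>
    ⟨fun j => (hw.1 j).trans_le (by nlinarith), fun j => (hw.2 j).trans_le (by nlinarith)⟩
  -- The mean value inequality is applied in weighted coordinates, where the domain remains convex.
  have hconv : Convex ℝ ((weight n r⁻¹ σ⁻¹ : Phase n →L[ℂ] Phase n) ⁻¹'
      phaseDomain n (ρ - κ * r) (s - κ * σ)) :=
    (convex_phaseDomain _ _).linear_preimage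
      ((weight n r⁻¹ σ⁻¹ : Phase n →L[ℂ] Phase n).restrictScalars ℝ : Phase n →ₗ[ℝ] Phase n)
  have hw : ∀ {w}, w ∈ phaseDomain n (ρ - κ * r) (s - κ * σ) → weight n r σ w ∈
      (weight n r⁻¹ σ⁻¹ : Phase n →L[ℂ] Phase n) ⁻¹' phaseDomain n (ρ - κ * r) (s - κ * σ) := by
    intro w hw
    rwa [mem_preimage, weight_weight hr hσ]
  have h1 := hconv.norm_image_sub_le_of_norm_hasFDerivWithin_le (𝕜 := ℂ)
    (f := fun x => f (weight n r⁻¹ σ⁻¹ x))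
    (f' := fun x => (fderiv ℂ f (weight n r⁻¹ σ⁻¹ x)).comp (weight n r⁻¹ σ⁻¹))
    (s := (weight n r⁻¹ σ⁻¹ : Phase n →L[ℂ] Phase n) ⁻¹' phaseDomain n (ρ - κ * r) (s - κ * σ))
    (x := weight n r σ z') (y := weight n r σ z) (C := 2 * C / κ)
    (fun x hx => ((hf _ (hmono hx)).hasFDerivAt.comp x
      (weight n r⁻¹ σ⁻¹).hasFDerivAt).hasFDerivWithinAt)
    (fun x hx => norm_fderiv_comp_weight_le hρ hr hσ hκ hf hC hx)
    (hw hz') (hw hz)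
  rwa [weight_weight hr hσ, weight_weight hr hσ, ← map_sub] at h1

end Cauchy

namespace IsTrigFlow

variable {Γ : Phase n × CVec n → C(unitInterval, Phase n)} {z : Phase n} {ω : CVec n} {η : ℝ}

theorem norm_weight_sub_le (h : IsSmallTrigHam S A B O r s σ M)
    (hΓ : IsTrigFlow S A B O r s σ Γ) (hz : z ∈ phaseDomain n (r / 4) (s - 2 * σ)) (hω : ω ∈ O)
    (t : unitInterval) : ‖weight n r σ (Γ (z, ω) t - z)‖ ≤ 2 * M / (r * σ) := by
  have hr := h.r_pos
  have hσ := h.sigma_pos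
  refine norm_weight_le hr hσ ((hΓ.norm_action_sub_le h hz hω t).trans (le_of_eq ?_))
    ((hΓ.norm_angle_sub_le h hz hω t).trans (le_of_eq ?_)) <;> field_simp

theorem differentiableAt (hΓ : IsTrigFlow S A B O r s σ Γ)
    (hz : z ∈ phaseDomain n (r / 4) (s - 2 * σ)) (hω : ω ∈ O) (t : unitInterval) :
    DifferentiableAt ℂ (fun w : Phase n => Γ (w, ω) t) z :=
  (((hasFDerivAt_curve_apply t _).comp z
    (hΓ.analyticAt_left hz hω).differentiableAt.hasFDerivAt)).differentiableAt

/-- Between this domain and that of the flow there is room for a weighted ball of radius `1 / 8`,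
since `η ≤ 1 / 8` leaves `r / 8` in the actions. Cauchy's estimate on the displacement `2M / (rσ)`
gives `2 · 2 · 8 = 32`. -/
theorem norm_weight_fderiv_le (h : IsSmallTrigHam S A B O r s σ M)
    (hΓ : IsTrigFlow S A B O r s σ Γ) (hη : η ≤ 1 / 8)
    (hz : z ∈ phaseDomain n (η * r) (s - 3 * σ)) (hω : ω ∈ O) :
    ‖(weight n r σ).comp ((fderiv ℂ (fun w : Phase n => Γ (w, ω) 1) z -
      ContinuousLinearMap.id ℂ (Phase n)).comp (weight n r⁻¹ σ⁻¹))‖ ≤ 32 * M / (r * σ) := by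
  have hr := h.r_pos
  have hσ := h.sigma_pos
  have hz' : z ∈ phaseDomain n (r / 4 - 1 / 8 * r) (s - 2 * σ - 1 / 8 * σ) :=
    phaseDomain_mono (by nlinarith) (by linarith) hz
  have hz'' : z ∈ phaseDomain n (r / 4) (s - 2 * σ) :=
    phaseDomain_mono (by nlinarith) (by linarith) hz
  have hd : ∀ z ∈ phaseDomain n (r / 4) (s - 2 * σ), HasFDerivAt
      (fun w => weight n r σ (Γ (w, ω) 1 - w)) ((weight n r σ).comp
        (fderiv ℂ (fun w : Phase n => Γ (w, ω) 1) z - ContinuousLinearMap.id ℂ (Phase n))) z :=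
    fun z hz => (weight n r σ).hasFDerivAt.comp z
      ((hΓ.differentiableAt hz hω 1).hasFDerivAt.sub (hasFDerivAt_id z))
  have h1 := norm_fderiv_comp_weight_le (C := 2 * M / (r * σ)) (by linarith) hr hσ
    (by norm_num : (0 : ℝ) < 1 / 8) (fun z hz => (hd z hz).differentiableAt)
    (fun z hz => hΓ.norm_weight_sub_le h hz hω 1) hz'
  rw [(hd z hz'').fderiv] at h1
  refine h1.trans (le_of_eq ?_)
  field_simp
  ring

/-- In the weighted norm `Φ - id` has Lipschitz constant `32M / (rσ) < 1`. Hence two points with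
equal images coincide. -/
theorem injOn (h : IsSmallTrigHam S A B O r s σ M)
    (hΓ : IsTrigFlow S A B O r s σ Γ) (hη : η ≤ 1 / 8) (hM : 32 * M / (r * σ) < 1)
    (hω : ω ∈ O) : InjOn (fun w : Phase n => Γ (w, ω) 1) (phaseDomain n (η * r) (s - 3 * σ)) := by
  have hr := h.r_pos
  have hσ := h.sigma_pos
  intro z hz w hw hzw
  have hd : ∀ z ∈ phaseDomain n (r / 4) (s - 2 * σ), DifferentiableAt ℂ
      (fun w => weight n r σ (Γ (w, ω) 1 - w)) z :=
    fun z hz => (weight n r σ).differentiableAt.comp z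
      ((hΓ.differentiableAt hz hω 1).sub differentiableAt_id)
  have h1 := norm_sub_le_weight (C := 2 * M / (r * σ)) (by linarith) hr hσ
    (by norm_num : (0 : ℝ) < 1 / 8) hd
    (fun z hz => hΓ.norm_weight_sub_le h hz hω 1)
    (phaseDomain_mono (by nlinarith) (by linarith) hz :
      z ∈ phaseDomain n (r / 4 - 1 / 8 * r) (s - 2 * σ - 1 / 8 * σ))
    (phaseDomain_mono (by nlinarith) (by linarith) hw :
      w ∈ phaseDomain n (r / 4 - 1 / 8 * r) (s - 2 * σ - 1 / 8 * σ))
  simp only at hzw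
  rw [← map_sub, hzw, sub_sub_sub_cancel_left, map_sub, norm_sub_rev, ← map_sub] at h1
  have h2 : 2 * (2 * M / (r * σ)) / (1 / 8) = 32 * M / (r * σ) := by field_simp; ring
  rw [h2] at h1
  have h3 : ‖weight n r σ (z - w)‖ = 0 := by
    have := norm_nonneg (weight n r σ (z - w))
    nlinarith
  have h4 := weight_weight hr hσ (z - w)
  rw [norm_eq_zero.1 h3, map_zero] at h4
  exact (sub_eq_zero.1 h4.symm)

end IsTrigFlow

/-- Along the flow of the solution `f` of the homological equation `∂_ω f = R - R₀`, the
linear hamiltonian `⟨ω, I⟩` plus `R` stays close to `R₀`. -/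
theorem norm_linear_add_sub_le {f : Phase n × CVec n → ℂ} {ω : CVec n} {γ : ℝ → Phase n}
    {R R₀ : Phase n → ℂ} {a b : ℝ}
    (hγ : ∀ t ∈ Icc (0 : ℝ) 1,
      HasDerivWithinAt γ (hamVectorField f ω (γ t)) (Icc (0 : ℝ) 1) t)
    (hf : ∀ t ∈ Icc (0 : ℝ) 1, ∑ j, ω j * (hamVectorField f ω (γ t)).1 j =
      -(R (γ t) - R₀ (γ t)))
    (ha : ∀ t ∈ Icc (0 : ℝ) 1, ‖R (γ 1) - R (γ t)‖ ≤ a)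
    (hb : ∀ t ∈ Icc (0 : ℝ) 1, ‖R₀ (γ t) - R₀ (γ 0)‖ ≤ b) :
    ‖∑ j, ω j * ((γ 1).1 j - (γ 0).1 j) + R (γ 1) - R₀ (γ 0)‖ ≤ a + b := by
  -- A linear term in `t` is added so that the difference of the end values is exactly the quantity
  -- to be bounded, while the derivative contains only differences of values of `R` and of `R₀`
  -- along the orbit. No second-order bracket is needed.
  have h1 : ∀ t ∈ Icc (0 : ℝ) 1, HasDerivWithinAt
      (fun t : ℝ => ∑ j, ω j * (γ t).1 j + (t : ℂ) * (R (γ 1) - R₀ (γ 0)))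
      ((R (γ 1) - R (γ t)) + (R₀ (γ t) - R₀ (γ 0))) (Icc 0 1) t := by
    intro t ht
    have h2 : ∀ j, HasDerivWithinAt (fun t => (γ t).1 j) ((hamVectorField f ω (γ t)).1 j)
        (Icc 0 1) t := fun j =>
      hasDerivWithinAt_pi.1
        (hasFDerivWithinAt_fst.comp_hasDerivWithinAt t (hγ t ht) (mapsTo_univ _ _)) j
    have h3 : HasDerivWithinAt (fun t : ℝ => (t : ℂ)) 1 (Icc 0 1) t :=
      (Complex.ofRealCLM.hasDerivAt (x := t)).hasDerivWithinAt
    refine ((HasDerivWithinAt.fun_sum (u := Finset.univ) fun j _ =>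
      (h2 j).const_mul (ω j)).fun_add (h3.mul_const _)).congr_deriv ?_
    rw [hf t ht]
    ring
  have h2 := norm_image_sub_le_of_norm_deriv_le_segment_01' h1 fun t ht =>
    (norm_add_le _ _).trans (add_le_add (ha t (Ico_subset_Icc_self ht))
      (hb t (Ico_subset_Icc_self ht)))
  refine le_trans (le_of_eq (congrArg norm ?_)) h2
  simp only [mul_sub, Finset.sum_sub_distrib, Complex.ofReal_one, Complex.ofReal_zero]
  ring

/-- The homological equation for trigonometric polynomials. -/
theorem sum_mul_hamVectorField_trigHam {A' : (Fin n → ℤ) → CVec n → ℂ}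
    {B' : (Fin n → ℤ) → CVec n → CVec n} {ω : CVec n} (h0 : (0 : Fin n → ℤ) ∈ S)
    (hd : ∀ k ∈ S.erase 0, divisor k ω ≠ 0)
    (hA : ∀ k, A' k ω = A k ω / (Complex.I * divisor k ω))
    (hB : ∀ k j, B' k ω j = B k ω j / (Complex.I * divisor k ω)) (z : Phase n) :
    ∑ j, ω j * (hamVectorField (trigHam (S.erase 0) A' B') ω z).1 j =
      -(trigHam S A B (z, ω) - (A 0 ω + ∑ j, B 0 ω j * z.1 j)) := by
  rw [hamVectorField_trigHam, trigHam, ← Finset.add_sum_erase S _ h0]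
  simp only [expChar_zero_left, mul_one, add_sub_cancel_left, Pi.neg_apply, mul_neg,
    Finset.sum_neg_distrib, angleGrad, Finset.mul_sum]
  rw [Finset.sum_comm]
  congr 1
  refine Finset.sum_congr rfl fun k hk => ?_
  have h1 : A' k ω + ∑ l, B' k ω l * z.1 l =
      (A k ω + ∑ l, B k ω l * z.1 l) / (Complex.I * divisor k ω) := by
    rw [hA, add_div, Finset.sum_div]
    congr 1
    exact Finset.sum_congr rfl fun l _ => by rw [hB]; ring
  rw [h1]
  have h2 : ∀ c : ℂ, ∑ j, ω j * (Complex.I * k j * c) = Complex.I * divisor k ω * c := by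
    intro c
    rw [divisor, Finset.mul_sum, Finset.sum_mul]
    exact Finset.sum_congr rfl fun j _ => by ring
  rw [h2, ← mul_assoc, mul_div_cancel₀ _ (mul_ne_zero Complex.I_ne_zero (hd k hk))]

end KAM

/-! ### Fourier coefficients of the affine part of the perturbation -/

namespace KAM

open Metric Set Filter Topology MeasureTheory
variable {n : ℕ}

theorem fourierCoeff_add {g g' : CVec n → ℂ} (hg : Continuous fun x => g (circleVec x))
    (hg' : Continuous fun x => g' (circleVec x)) (k : Fin n → ℤ) :
    fourierCoeff (fun θ => g θ + g' θ) k = fourierCoeff g k + fourierCoeff g' k := by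
  have hint : ∀ {f : CVec n → ℂ}, (Continuous fun x => f (circleVec x)) →
      IntegrableOn (fun x => expChar (-k) (circleVec x) * f (circleVec x)) (unitCube n) := by
    intro f hf
    refine (ContinuousOn.integrableOn_compact isCompact_Icc ?_).mono_set unitCube_subset
    refine (Continuous.mul ?_ hf).continuousOn
    exact continuous_iff_continuousAt.2 fun x =>
      ((analyticAt_expChar (-k) _).continuousAt).comp' continuous_circleVec.continuousAt
  simp only [fourierCoeff, mul_add]
  exact integral_add (hint hg) (hint hg')

theorem fourierCoeff_mul_const (g : CVec n → ℂ) (a : ℂ) (k : Fin n → ℤ) :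
    fourierCoeff (fun θ => g θ * a) k = fourierCoeff g k * a := by
  simp only [fourierCoeff, ← mul_assoc]
  exact integral_mul_const _ _

theorem fourierCoeff_sum {ι : Type*} (s : Finset ι) {g : ι → CVec n → ℂ}
    (hg : ∀ i, Continuous fun x => g i (circleVec x)) (k : Fin n → ℤ) :
    fourierCoeff (fun θ => ∑ i ∈ s, g i θ) k = ∑ i ∈ s, fourierCoeff (g i) k := by
  classical
  induction s using Finset.induction_on with
  | empty => simp [fourierCoeff]
  | insert i s hi ih =>
    simp only [Finset.sum_insert hi]
    rw [fourierCoeff_add (hg i) (continuous_finsetSum s fun i _ => hg i), ih]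

theorem star_circleVec (x : Fin n → ℝ) : star (circleVec x) = circleVec x := by
  ext j
  simp [circleVec]

theorem fourierCoeff_neg {g : CVec n → ℂ} (hg : ∀ x, star (g (circleVec x)) = g (circleVec x))
    (k : Fin n → ℤ) : fourierCoeff g (-k) = star (fourierCoeff g k) := by
  have h1 : star (fourierCoeff g k) =
      ∫ x in unitCube n, star (expChar (-k) (circleVec x) * g (circleVec x)) :=
    (integral_conj (𝕜 := ℂ)).symm
  rw [h1, fourierCoeff]
  refine setIntegral_congr_fun measurableSet_unitCube fun x _ => ?_
  simp only [star_mul', star_expChar, star_circleVec, hg]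

/-- The directional derivative can be computed along the real line through `z`, where the function
takes real values. -/
theorem star_fderiv_apply {E : Type*} [NormedAddCommGroup E] [NormedSpace ℂ E] {f : E → ℂ}
    {z v : E} (hf : DifferentiableAt ℂ f z)
    (h : ∀ᶠ t : ℝ in 𝓝 0, star (f (z + (t : ℂ) • v)) = f (z + (t : ℂ) • v)) :
    star (fderiv ℂ f z v) = fderiv ℂ f z v := by
  have h1 : HasDerivAt (fun t : ℝ => f (z + (t : ℂ) • v)) (fderiv ℂ f z v) 0 := by
    have h2 : HasDerivAt (fun t : ℂ => z + t • v) v ((0 : ℝ) : ℂ) := by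
      simpa using ((hasDerivAt_id (((0 : ℝ) : ℂ))).smul_const v).const_add z
    have h3 : HasFDerivAt f (fderiv ℂ f z) (z + ((0 : ℝ) : ℂ) • v) := by
      simpa using hf.hasFDerivAt
    exact (h3.comp_hasDerivAt _ h2).comp_ofReal
  exact (h1.star.congr_of_eventuallyEq (h.mono fun t ht => ht.symm)).unique h1

/-- The derivative of `P` with respect to the actions in the direction `v`, at `I = 0`. -/
noncomputable def actionDeriv (P : Phase n × CVec n → ℂ) (v : CVec n) (p : CVec n × CVec n) : ℂ :=
  fderiv ℂ P ((0, p.1), p.2) ((v, 0), 0)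

/-- The Fourier coefficients of `P` at `I = 0`. -/
noncomputable def coeffZero (P : Phase n × CVec n → ℂ) (k : Fin n → ℤ) (ω : CVec n) : ℂ :=
  fourierCoeff (fun θ => P ((0, θ), ω)) k

/-- The Fourier coefficients of the gradient of `P` with respect to the actions at `I = 0`. -/
noncomputable def coeffOne (P : Phase n × CVec n → ℂ) (k : Fin n → ℤ) (ω : CVec n) : CVec n :=
  fun j => fourierCoeff (fun θ => actionDeriv P (Pi.single j 1) (θ, ω)) k

/-- The part of `P` that is affine in the actions. -/
noncomputable def affinePart (P : Phase n × CVec n → ℂ) (ω I θ : CVec n) : ℂ :=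
  P ((0, θ), ω) + actionDeriv P I (θ, ω)

/-- A Hamiltonian on `D_{r,s} × O` that is bounded by `ε`. -/
structure IsBoundedHam (P : Phase n × CVec n → ℂ) (r s ε : ℝ) (O : Set (CVec n)) : Prop where
  r_pos : 0 < r
  s_pos : 0 < s
  isOpen : IsOpen O
  ham : IsHamiltonianOn P (phaseDomain n r s) O
  bound : ∀ z ∈ phaseDomain n r s, ∀ ω ∈ O, ‖P (z, ω)‖ ≤ ε

namespace IsBoundedHam

variable {P : Phase n × CVec n → ℂ} {r s ε : ℝ} {O : Set (CVec n)} {ω I θ : CVec n}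

theorem mem (h : IsBoundedHam P r s ε O) (hI : ‖I‖ < r) (hθ : θ ∈ strip n s) :
    (I, θ) ∈ phaseDomain n r s := (mem_phaseDomain h.r_pos).2 ⟨hI, hθ⟩

theorem mem_zero (h : IsBoundedHam P r s ε O) (hθ : θ ∈ strip n s) :
    ((0 : CVec n), θ) ∈ phaseDomain n r s := h.mem (by simpa using h.r_pos) hθ

theorem analyticAt (h : IsBoundedHam P r s ε O) (hI : ‖I‖ < r) (hθ : θ ∈ strip n s) (hω : ω ∈ O) :
    AnalyticAt ℂ P ((I, θ), ω) := h.ham.realAnalytic.1 _ ⟨h.mem hI hθ, hω⟩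

theorem analyticAt_zero (h : IsBoundedHam P r s ε O) (hθ : θ ∈ strip n s) (hω : ω ∈ O) :
    AnalyticAt ℂ P ((0, θ), ω) := h.analyticAt (by simpa using h.r_pos) hθ hω

theorem analyticAt_restrict (h : IsBoundedHam P r s ε O) (hθ : θ ∈ strip n s) (hω : ω ∈ O) :
    AnalyticAt ℂ (fun p : CVec n × CVec n => P ((0, p.1), p.2)) (θ, ω) :=
  AnalyticAt.fun_comp (g := P) (f := fun p : CVec n × CVec n => (((0 : CVec n), p.1), p.2))
    (h.analyticAt_zero hθ hω) ((analyticAt_const.prod analyticAt_fst).prod analyticAt_snd)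

theorem analyticAt_actionDeriv (h : IsBoundedHam P r s ε O) (hθ : θ ∈ strip n s) (hω : ω ∈ O)
    (v : CVec n) : AnalyticAt ℂ (actionDeriv P v) (θ, ω) :=
  AnalyticAt.fun_comp (g := fun q => fderiv ℂ P q ((v, 0), 0))
    (f := fun p : CVec n × CVec n => (((0 : CVec n), p.1), p.2))
    (analyticAt_clm_comp (h.analyticAt_zero hθ hω).fderiv
      (ContinuousLinearMap.apply ℂ ℂ (((v, 0), 0) : Phase n × CVec n)))
    ((analyticAt_const.prod analyticAt_fst).prod analyticAt_snd)

theorem actionDeriv_eq (h : IsBoundedHam P r s ε O) (hθ : θ ∈ strip n s) (hω : ω ∈ O)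
    (v : CVec n) : actionDeriv P v (θ, ω) = fderiv ℂ (fun I => P ((I, θ), ω)) 0 v := by
  have h1 : HasFDerivAt (fun I : CVec n => ((I, θ), ω))
      ((ContinuousLinearMap.inl ℂ (Phase n) (CVec n)).comp
        (ContinuousLinearMap.inl ℂ (CVec n) (CVec n))) 0 :=
    (hasFDerivAt_prodMk_left (𝕜 := ℂ) ((0 : CVec n), θ) ω).comp 0
      (hasFDerivAt_prodMk_left (𝕜 := ℂ) (0 : CVec n) θ)
  have h2 := (h.analyticAt_zero hθ hω).differentiableAt.hasFDerivAt.comp 0 h1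
  exact (congrArg (fun L : CVec n →L[ℂ] ℂ => L v) h2.fderiv).symm

theorem differentiableOn (h : IsBoundedHam P r s ε O) (hθ : θ ∈ strip n s) (hω : ω ∈ O) :
    DifferentiableOn ℂ (fun I => P ((I, θ), ω)) (ball 0 r) := by
  intro I hI
  exact (AnalyticAt.fun_comp (g := P) (f := fun I : CVec n => ((I, θ), ω))
    (h.analyticAt (by simpa using hI) hθ hω)
    ((analyticAt_id.prod analyticAt_const).prod
      analyticAt_const)).differentiableAt.differentiableWithinAt

theorem norm_actionDeriv_le (h : IsBoundedHam P r s ε O) (hθ : θ ∈ strip n s) (hω : ω ∈ O)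
    (v : CVec n) : ‖actionDeriv P v (θ, ω)‖ ≤ 2 * ε / r * ‖v‖ := by
  rw [h.actionDeriv_eq hθ hω]
  exact ContinuousLinearMap.le_of_opNorm_le _ (norm_fderiv_le_of_norm_le h.r_pos
    (h.differentiableOn hθ hω) fun I hI => h.bound _ (h.mem (by simpa using hI) hθ) _ hω) v

theorem norm_sub_affinePart_le (h : IsBoundedHam P r s ε O) (hI : ‖I‖ < r) (hθ : θ ∈ strip n s)
    (hω : ω ∈ O) : ‖P ((I, θ), ω) - affinePart P ω I θ‖ ≤ 4 * ε * (‖I‖ / r) ^ 2 := by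
  have h1 := norm_sub_sub_fderiv_le (x := I) (h.differentiableOn hθ hω)
    (fun I hI => h.bound _ (h.mem (by simpa using hI) hθ) _ hω) (by simpa using hI)
  rwa [sub_zero, ← h.actionDeriv_eq hθ hω, sub_sub] at h1

theorem periodic (h : IsBoundedHam P r s ε O) (hI : ‖I‖ < r) (hθ : θ ∈ strip n s) (hω : ω ∈ O)
    (k : Fin n → ℤ) : P ((I, θ + angleShift k), ω) = P ((I, θ), ω) :=
  h.ham.periodic I θ ω k (h.mem hI hθ) hω

theorem isStripFun_zero (h : IsBoundedHam P r s ε O) (hω : ω ∈ O) :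
    IsStripFun (fun θ => P ((0, θ), ω)) s ε where
  analytic θ hθ := AnalyticAt.fun_comp (g := fun p : CVec n × CVec n => P ((0, p.1), p.2))
    (f := fun θ => (θ, ω)) (h.analyticAt_restrict hθ hω) (analyticAt_id.prod analyticAt_const)
  periodic θ hθ k := h.periodic (by simpa using h.r_pos) hθ hω k
  bound θ hθ := h.bound _ (h.mem_zero hθ) _ hω

theorem isStripFun_actionDeriv (h : IsBoundedHam P r s ε O) (hω : ω ∈ O) (v : CVec n) :
    IsStripFun (fun θ => actionDeriv P v (θ, ω)) s (2 * ε / r * ‖v‖) where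
  analytic θ hθ := AnalyticAt.fun_comp (g := actionDeriv P v) (f := fun θ => (θ, ω))
    (h.analyticAt_actionDeriv hθ hω v) (analyticAt_id.prod analyticAt_const)
  periodic θ hθ k := by
    rw [h.actionDeriv_eq hθ hω, h.actionDeriv_eq (add_angleShift_mem_strip hθ k) hω]
    congr 1
    refine Filter.EventuallyEq.fderiv_eq ?_
    filter_upwards [ball_mem_nhds (0 : CVec n) h.r_pos] with I hI
    exact h.periodic (by simpa using hI) hθ hω k
  bound θ hθ := h.norm_actionDeriv_le hθ hω v

theorem bound_nonneg (h : IsBoundedHam P r s ε O) (hω : ω ∈ O) : 0 ≤ ε :=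
  (h.isStripFun_zero hω).bound_nonneg h.s_pos

/-- With `I` frozen the affine part is a scalar function of the angles, bounded by `ε` from the
value at `I = 0` and by `2ε` from the derivative. The Fourier estimates then apply uniformly in `‖I‖
≤ r`, without separate bounds for the coefficients of degree zero and one. -/
theorem isStripFun_affinePart (h : IsBoundedHam P r s ε O) (hω : ω ∈ O) (hI : ‖I‖ ≤ r) :
    IsStripFun (affinePart P ω I) s (3 * ε) where
  analytic θ hθ := ((h.isStripFun_zero hω).analytic θ hθ).add
    ((h.isStripFun_actionDeriv hω I).analytic θ hθ)
  periodic θ hθ k := by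
    rw [affinePart, affinePart, (h.isStripFun_zero hω).periodic θ hθ,
      (h.isStripFun_actionDeriv hω I).periodic θ hθ]
  bound θ hθ := by
    have hε := h.bound_nonneg hω
    have hr := h.r_pos
    refine (norm_add_le _ _).trans ((add_le_add ((h.isStripFun_zero hω).bound θ hθ)
      ((h.isStripFun_actionDeriv hω I).bound θ hθ)).trans ?_)
    have h1 : 2 * ε / r * ‖I‖ ≤ 2 * ε / r * r := by gcongr
    have h2 : 2 * ε / r * r = 2 * ε := by field_simp
    linarith

theorem actionDeriv_eq_sum (v : CVec n) (p : CVec n × CVec n) :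
    actionDeriv P v p = ∑ j, actionDeriv P (Pi.single j 1) p * v j := by
  classical
  have hv : (((v, 0), 0) : Phase n × CVec n) =
      ∑ j, v j • (((Pi.single j 1, 0), 0) : Phase n × CVec n) := by
    refine Prod.ext (Prod.ext ?_ ?_) ?_ <;> ext l <;>
      simp [Prod.fst_sum, Prod.snd_sum, Finset.sum_apply, Pi.single_apply]
  rw [actionDeriv, hv, map_sum]
  exact Finset.sum_congr rfl fun j _ => by rw [map_smul, smul_eq_mul, mul_comm]; rfl

theorem fourierCoeff_affinePart (h : IsBoundedHam P r s ε O) (hω : ω ∈ O) (I : CVec n)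
    (k : Fin n → ℤ) : fourierCoeff (affinePart P ω I) k =
      coeffZero P k ω + ∑ j, coeffOne P k ω j * I j := by
  have hc : ∀ v, Continuous fun x => actionDeriv P v (circleVec x, ω) := fun v =>
    (h.isStripFun_actionDeriv hω v).continuous_circleVec h.s_pos
  have h1 : affinePart P ω I = fun θ => P ((0, θ), ω) +
      ∑ j, actionDeriv P (Pi.single j 1) (θ, ω) * I j := by
    funext θ
    rw [affinePart, actionDeriv_eq_sum]
  rw [h1, fourierCoeff_add (g' := fun θ => ∑ j, actionDeriv P (Pi.single j 1) (θ, ω) * I j)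
    ((h.isStripFun_zero hω).continuous_circleVec h.s_pos)
    (continuous_finsetSum _ fun j _ => (hc _).mul continuous_const),
    fourierCoeff_sum (g := fun j θ => actionDeriv P (Pi.single j 1) (θ, ω) * I j) _
      fun j => (hc _).mul continuous_const]
  exact congrArg _ (Finset.sum_congr rfl fun j _ => fourierCoeff_mul_const _ _ _)

theorem analyticAt_coeffZero (h : IsBoundedHam P r s ε O) (hω : ω ∈ O) (k : Fin n → ℤ) :
    AnalyticAt ℂ (coeffZero P k) ω := by
  refine analyticAt_setIntegral (g := fun p : CVec n × CVec n => expChar (-k) p.1 *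
    P ((0, p.1), p.2)) isCompact_Icc continuous_circleVec (fun x _ => ?_) measurableSet_unitCube
    unitCube_subset
  exact ((analyticAt_expChar (-k) _).fun_comp analyticAt_fst).fun_mul
    (h.analyticAt_restrict (circleVec_mem_strip h.s_pos x) hω)

theorem analyticAt_coeffOne (h : IsBoundedHam P r s ε O) (hω : ω ∈ O) (k : Fin n → ℤ) :
    AnalyticAt ℂ (coeffOne P k) ω := by
  refine AnalyticAt.pi fun j => ?_
  refine analyticAt_setIntegral (g := fun p : CVec n × CVec n => expChar (-k) p.1 *
    actionDeriv P (Pi.single j 1) p) isCompact_Icc continuous_circleVec (fun x _ => ?_)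
    measurableSet_unitCube unitCube_subset
  exact ((analyticAt_expChar (-k) _).fun_comp analyticAt_fst).fun_mul
    (h.analyticAt_actionDeriv (circleVec_mem_strip h.s_pos x) hω _)

theorem coeffZero_neg (h : IsBoundedHam P r s ε O) (hω : ω ∈ O) (hr : star ω = ω)
    (k : Fin n → ℤ) : coeffZero P (-k) ω = star (coeffZero P k ω) := by
  refine fourierCoeff_neg (fun x => ?_) k
  refine h.ham.realAnalytic.2 _ ⟨h.mem_zero (circleVec_mem_strip h.s_pos x), hω⟩ ?_
  exact Prod.ext (Prod.ext (star_zero _) (star_circleVec x)) hr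

theorem coeffOne_neg (h : IsBoundedHam P r s ε O) (hω : ω ∈ O) (hr : star ω = ω)
    (k : Fin n → ℤ) : coeffOne P (-k) ω = star (coeffOne P k ω) := by
  classical
  ext j
  refine fourierCoeff_neg (fun x => ?_) k
  have hx := circleVec_mem_strip h.s_pos x
  rw [h.actionDeriv_eq hx hω]
  refine star_fderiv_apply ((h.differentiableOn hx hω).differentiableAt
    (ball_mem_nhds _ h.r_pos)) ?_
  have hcont : ContinuousAt (fun t : ℝ => (0 : CVec n) + (t : ℂ) • (Pi.single j 1 : CVec n)) 0 := by
    fun_prop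
  filter_upwards [hcont.preimage_mem_nhds (by simpa using ball_mem_nhds (0 : CVec n) h.r_pos)]
    with t ht
  refine h.ham.realAnalytic.2 _ ⟨h.mem (by simpa using ht) hx, hω⟩ ?_
  refine Prod.ext (Prod.ext ?_ (star_circleVec x)) hr
  ext l
  by_cases hl : l = j <;> simp [hl]

end IsBoundedHam

end KAM

/-! ### The frequency map, and size of the truncation and of its generator -/

namespace KAM

open Metric Set Filter Topology
variable {n : ℕ}

section Frequencies

variable {D : Set (Fin n → ℝ)} {h h' : ℝ} {ω x : CVec n}

theorem isOpen_complexNhd (D : Set (Fin n → ℝ)) (h : ℝ) : IsOpen (complexNhd D h) := by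
  have h1 : complexNhd D h = ⋃ ω₀ ∈ D, ball (fun j => ((ω₀ j : ℝ) : ℂ)) h := by
    ext ω
    simp [complexNhd, dist_eq_norm]
  rw [h1]
  exact isOpen_biUnion fun _ _ => isOpen_ball

theorem complexNhd_mono (hh : h ≤ h') : complexNhd D h ⊆ complexNhd D h' :=
  fun _ ⟨ω₀, h1, h2⟩ => ⟨ω₀, h1, h2.trans_le hh⟩

theorem mem_complexNhd_of_mem_ball (hω : ω ∈ complexNhd D h) (hx : x ∈ ball ω h') :
    x ∈ complexNhd D (h + h') := by
  obtain ⟨ω₀, h1, h2⟩ := hω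
  refine ⟨ω₀, h1, ?_⟩
  rw [mem_ball, dist_eq_norm] at hx
  calc _ = ‖(ω - fun j => (ω₀ j : ℂ)) + (x - ω)‖ := by congr 1; abel
    _ < h + h' := (norm_add_le _ _).trans_lt (add_lt_add h2 hx)

/-- Inversion of a map `φ ↦ φ + v(φ)` that is close to the identity. -/
theorem exists_freqMap {m : ℝ} (hh : 0 < h) (hm0 : 0 ≤ m) (hm : 32 * m ≤ h) {v : CVec n → CVec n}
    (hv : AnalyticOnNhd ℂ v (complexNhd D h)) (hvm : ∀ ω ∈ complexNhd D h, ‖v ω‖ ≤ m)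
    (hvr : ∀ ω ∈ complexNhd D h, star ω = ω → star (v ω) = v ω) :
    ∃ φ : CVec n → CVec n, AnalyticOnNhd ℂ φ (complexNhd D (h / 2)) ∧
      ∀ ω ∈ complexNhd D (h / 2), φ ω ∈ complexNhd D h ∧ φ ω + v (φ ω) = ω ∧
        (star ω = ω → star (φ ω) = φ ω) := by
  -- Cauchy's estimate with radius `h / 4` gives the Lipschitz constant `2m / (h / 4)` on the `3h /
  -- 4`-neighbourhood, which contains the balls of radius `h / 4` about points of the `h /
  -- 2`-neighbourhood.
  have hq0 : 0 ≤ 8 * m / h := by positivity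
  have hq1 : 8 * m / h ≤ 1 / 4 := by rw [div_le_iff₀ hh]; linarith
  have hmem : ∀ ω ∈ complexNhd D (h / 2), ball ω (h / 4) ⊆ complexNhd D (3 * h / 4) := by
    intro ω hω x hx
    exact complexNhd_mono (by linarith) (mem_complexNhd_of_mem_ball hω hx)
  have hsub : complexNhd D (3 * h / 4) ⊆ complexNhd D h := complexNhd_mono (by linarith)
  have hderiv : ∀ x ∈ complexNhd D (3 * h / 4), ‖fderiv ℂ v x‖ ≤ 8 * m / h := by
    intro x hx
    have h1 : ball x (h / 4) ⊆ complexNhd D h := fun y hy =>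
      complexNhd_mono (by linarith) (mem_complexNhd_of_mem_ball hx hy)
    refine (norm_fderiv_le_of_norm_le (by linarith : 0 < h / 4)
      (hv.differentiableOn.mono h1) fun y hy => hvm y (h1 hy)).trans (le_of_eq ?_)
    field_simp
    ring
  have hlip : ∀ ω ∈ complexNhd D (h / 2), ∀ x ∈ ball ω (h / 4), ∀ y ∈ ball ω (h / 4),
      ‖(ω - v x) - (ω - v y)‖ ≤ 8 * m / h * ‖x - y‖ := by
    intro ω hω x hx y hy
    rw [sub_sub_sub_cancel_left, norm_sub_rev x y]
    exact (convex_ball ω (h / 4)).norm_image_sub_le_of_norm_fderiv_le (𝕜 := ℂ)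
      (fun z hz => (hv z (hsub (hmem ω hω hz))).differentiableAt)
      (fun z hz => hderiv z (hmem ω hω hz)) hx hy
  obtain ⟨φ, hφa, hφ⟩ := exists_analytic_fixedPoint (U := complexNhd D (h / 2))
    (isOpen_complexNhd D _) (G := fun u : CVec n × CVec n => u.2 - v u.1) (c := fun ω => ω)
    (ρ := h / 4) continuousOn_id hq0 (by linarith : 8 * m / h < 1)
    (fun ω hω x hx => analyticAt_snd.fun_sub (AnalyticAt.fun_comp (g := v)
      (f := fun u : CVec n × CVec n => u.1) (hv x (hsub (hmem ω hω hx))) analyticAt_fst))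
    hlip
    (fun ω hω => by
      have h1 := hvm ω (complexNhd_mono (by linarith) hω)
      simp only [sub_sub_cancel_left, norm_neg]
      nlinarith)
  refine ⟨φ, hφa, fun ω hω => ⟨hsub (hmem ω hω (hφ ω hω).1), ?_, fun hr => ?_⟩⟩
  · have h1 : ω - v (φ ω) = φ ω := (hφ ω hω).2
    exact (sub_eq_iff_eq_add.1 h1).symm
  -- As `v` is only known to be real at real points, the contraction is run again on real vectors.
  -- Its fixed point lies in the complex ball as well, so it is `φ ω`.
  · set ι : (Fin n → ℝ) → CVec n := fun x j => (x j : ℂ) with hι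
    have hιs : ∀ x, star (ι x) = ι x := fun x => by ext j; simp [hι]
    have hιre : ∀ y : CVec n, star y = y → ι (fun j => (y j).re) = y := by
      intro y hy
      ext j
      exact Complex.conj_eq_iff_re.1 (congrFun hy j)
    have hnorm : ∀ x y : Fin n → ℝ, ‖ι x - ι y‖ = ‖x - y‖ := by
      intro x y
      simp only [Pi.norm_def, hι, Pi.sub_apply, ← Complex.ofReal_sub, Complex.nnnorm_real]
    set ω' : Fin n → ℝ := fun j => (ω j).re with hω'
    have hιω : ι ω' = ω := hιre ω hr
    have hball : ∀ x ∈ ball ω' (h / 4), ι x ∈ ball ω (h / 4) := by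
      intro x hx
      rw [mem_ball, dist_eq_norm] at hx ⊢
      rwa [← hιω, hnorm]
    have hιT : ∀ x ∈ ball ω' (h / 4), ι (fun j => ((ω - v (ι x)) j).re) = ω - v (ι x) := by
      intro x hx
      refine hιre _ ?_
      rw [star_sub, hr, hvr _ (hsub (hmem ω hω (hball x hx))) (hιs x)]
    obtain ⟨x, hx, hfx⟩ := exists_fixedPoint_mem_ball (c := ω') (ρ := h / 4)
      (T := fun x j => ((ω - v (ι x)) j).re) hq0 (by linarith : 8 * m / h < 1)
      (fun x hx y hy => by
        rw [← hnorm, ← hnorm, hιT x hx, hιT y hy]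
        exact hlip ω hω _ (hball x hx) _ (hball y hy))
      (by
        have h1 := hvm ω (complexNhd_mono (by linarith) hω)
        rw [← hnorm, hιT _ (mem_ball_self (by linarith)), hιω, sub_sub_cancel_left, norm_neg]
        nlinarith)
    have h2 : ω - v (ι x) = ι x := by
      rw [← hιT x hx]
      exact congrArg ι hfx
    have h3 : φ ω = ι x := eq_of_contraction (T := fun x => ω - v x) (by linarith : 8 * m / h < 1)
      (hlip ω hω _ (hφ ω hω).1 _ (hball x hx)) (hφ ω hω).2 h2
    rw [h3, hιs]

end Frequencies

/-- The coefficients of the solution of the homological equation. -/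
noncomputable def solZero (P : Phase n × CVec n → ℂ) (k : Fin n → ℤ) (ω : CVec n) : ℂ :=
  coeffZero P k ω / (Complex.I * divisor k ω)

/-- The coefficients of the action gradient of the solution of the homological equation. -/
noncomputable def solOne (P : Phase n × CVec n → ℂ) (k : Fin n → ℤ) (ω : CVec n) : CVec n :=
  fun j => coeffOne P k ω j / (Complex.I * divisor k ω)

theorem analyticAt_divisor (k : Fin n → ℤ) (ω : CVec n) : AnalyticAt ℂ (divisor k) ω :=
  Finset.analyticAt_fun_sum _ fun j _ => analyticAt_const.fun_mul (analyticAt_coord j ω)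

theorem star_divisor {ω : CVec n} (hω : star ω = ω) (k : Fin n → ℤ) :
    Complex.I * divisor (-k) ω = star (Complex.I * divisor k ω) := by
  have h1 : ∀ j, star (ω j) = ω j := fun j => congrFun hω j
  simp only [divisor, star_mul', star_sum, h1, Pi.neg_apply, Int.cast_neg, Complex.star_def,
    Complex.conj_I, map_intCast, neg_mul, Finset.sum_neg_distrib, mul_neg]

theorem intBall_neg_mem {K : ℝ} {k : Fin n → ℤ} (hk : k ∈ intBall n K) : -k ∈ intBall n K := by
  rw [mem_intBall, intNorm_neg]
  exact mem_intBall.1 hk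

namespace IsBoundedHam

variable {P : Phase n × CVec n → ℂ} {r s ε : ℝ} {O : Set (CVec n)} {ω I θ : CVec n}

theorem trigHam_coeff (hP : IsBoundedHam P r s ε O) (hω : ω ∈ O) (S : Finset (Fin n → ℤ))
    (z : Phase n) : trigHam S (coeffZero P) (coeffOne P) (z, ω) =
      ∑ k ∈ S, fourierCoeff (affinePart P ω z.1) k * expChar k z.2 :=
  Finset.sum_congr rfl fun k _ => by rw [hP.fourierCoeff_affinePart hω]

theorem trigHam_sol (hP : IsBoundedHam P r s ε O) (hω : ω ∈ O) (S : Finset (Fin n → ℤ))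
    (z : Phase n) : trigHam S (solZero P) (solOne P) (z, ω) = ∑ k ∈ S,
      fourierCoeff (affinePart P ω z.1) k / (Complex.I * divisor k ω) * expChar k z.2 := by
  refine Finset.sum_congr rfl fun k _ => ?_
  rw [hP.fourierCoeff_affinePart hω, add_div, Finset.sum_div]
  congr 2
  exact Finset.sum_congr rfl fun l _ => by rw [solOne]; ring

theorem isRealTrig_sol (hP : IsBoundedHam P r s ε O) (K : ℝ) :
    IsRealTrig ((intBall n K).erase 0) (solZero P) (solOne P) O where
  neg_mem k hk := by
    rw [Finset.mem_erase] at hk ⊢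
    exact ⟨neg_ne_zero.2 hk.1, intBall_neg_mem hk.2⟩
  zero ω hω hr k := by
    rw [solZero, solZero, hP.coeffZero_neg hω hr, star_divisor hr, star_div₀]
  one ω hω hr k := by
    ext j
    rw [solOne, Pi.star_apply, solOne, hP.coeffOne_neg hω hr, star_divisor hr, star_div₀,
      Pi.star_apply]

theorem norm_coeffOne_zero_le (hP : IsBoundedHam P r s ε O) (hω : ω ∈ O) :
    ‖coeffOne P 0 ω‖ ≤ 2 * ε / r := by
  have h0 : 0 ≤ 2 * ε / r := by
    have := hP.bound_nonneg hω
    have := hP.r_pos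
    positivity
  refine (pi_norm_le_iff_of_nonneg h0).2 fun j => ?_
  have h1 := (hP.isStripFun_actionDeriv hω (Pi.single j 1)).sum_sq_fourierCoeff_le hP.s_pos {0}
  rw [Finset.sum_singleton, Pi.norm_single, norm_one, mul_one] at h1
  exact (sq_le_sq₀ (norm_nonneg _) h0).1 h1

theorem norm_mean_le (hP : IsBoundedHam P r s ε O) (hω : ω ∈ O) (hI : ‖I‖ ≤ r) :
    ‖coeffZero P 0 ω + ∑ j, coeffOne P 0 ω j * I j‖ ≤ 3 * ε := by
  have h1 := (hP.isStripFun_affinePart hω hI).sum_sq_fourierCoeff_le hP.s_pos {0}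
  rw [Finset.sum_singleton, hP.fourierCoeff_affinePart hω] at h1
  exact (sq_le_sq₀ (norm_nonneg _) (by linarith [hP.bound_nonneg hω])).1 h1

/-- Since `Kσ ≥ 1`, the factor `1 + 4 / σ` of the tail estimate is at most `5K`. The constant
collects `2 ^ n · 5 ^ n` and the bound `3ε` of the affine part. -/
theorem norm_affinePart_sub_trigHam_le (hP : IsBoundedHam P r s ε O) (hω : ω ∈ O) {σ K : ℝ}
    (hσ : 0 < σ) (hs : 2 * σ < s) (hKσ : 1 ≤ K * σ) (hK : 1 ≤ K) {z : Phase n}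
    (hz : z ∈ phaseDomain n r (s - 2 * σ)) :
    ‖affinePart P ω z.1 z.2 - trigHam (intBall n K) (coeffZero P) (coeffOne P) (z, ω)‖ ≤
      3 * 10 ^ n * (K ^ n * Real.exp (-(K * σ))) * ε := by
  rw [mem_phaseDomain hP.r_pos] at hz
  have hε := hP.bound_nonneg hω
  rw [hP.trigHam_coeff hω]
  refine ((hP.isStripFun_affinePart hω hz.1.le).norm_sub_trunc_le hσ hs hz.2).trans ?_
  have h1 : 1 + 4 / σ ≤ 5 * K := by
    have : 4 / σ ≤ 4 * K := by rw [div_le_iff₀ hσ]; linarith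
    linarith
  have h2 : (1 + 4 / σ) ^ n ≤ (5 * K) ^ n := pow_le_pow_left₀ (by positivity) h1 n
  calc _ ≤ 2 ^ n * (5 * K) ^ n * (3 * ε) * Real.exp (-(K * σ)) := by gcongr
    _ = _ := by rw [mul_pow, show (10 : ℝ) = 2 * 5 by norm_num, mul_pow]; ring

theorem norm_trigHam_coeff_le (hP : IsBoundedHam P r s ε O) (hω : ω ∈ O) {σ K : ℝ}
    (hσ : 0 < σ) (hs : 2 * σ < s) (hKσ : 1 ≤ K * σ) (hK : 1 ≤ K)
    (hK1 : K ^ n * Real.exp (-(K * σ)) ≤ 1) {z : Phase n}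
    (hz : z ∈ phaseDomain n r (s - 2 * σ)) :
    ‖trigHam (intBall n K) (coeffZero P) (coeffOne P) (z, ω)‖ ≤ 6 * 10 ^ n * ε := by
  have h1 := hP.norm_affinePart_sub_trigHam_le hω hσ hs hKσ hK hz
  have hε := hP.bound_nonneg hω
  have hz' := (mem_phaseDomain hP.r_pos).1 hz
  have h2 := (hP.isStripFun_affinePart hω hz'.1.le).bound z.2 (strip_mono (by linarith) hz'.2)
  have h3 : (1 : ℝ) ≤ 10 ^ n := one_le_pow₀ (by norm_num)
  have h4 : 3 * 10 ^ n * (K ^ n * Real.exp (-(K * σ))) * ε ≤ 3 * 10 ^ n * 1 * ε := by gcongr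
  have h5 := norm_sub_norm_le (trigHam (intBall n K) (coeffZero P) (coeffOne P) (z, ω))
    (affinePart P ω z.1 z.2)
  rw [norm_sub_rev] at h5
  nlinarith

end IsBoundedHam

section Homological

variable {P : Phase n × CVec n → ℂ} {r s ε α τ σ h K : ℝ} {D : Set (Fin n → ℝ)}

/-- The constant in the estimate of the solution of the homological equation. -/
noncomputable def solConst (n : ℕ) (τ : ℝ) : ℝ := 6 * √(2 ^ n * divisorConst τ)

theorem solConst_nonneg : 0 ≤ solConst n τ := by
  unfold solConst; positivity

theorem IsBoundedHam.norm_trigHam_sol_le (hP : IsBoundedHam P r s ε (complexNhd D h))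
    (hD : D ⊆ diophantineSet n α τ) (hα : 0 < α) (hτ : 0 ≤ τ) (hσ : 0 < σ) (hs : 2 * σ < s)
    (hh : h ≤ α / (2 * K ^ (τ + 1))) {ω : CVec n} (hω : ω ∈ complexNhd D h) {z : Phase n}
    (hz : z ∈ phaseDomain n r (s - 2 * σ)) :
    ‖trigHam ((intBall n K).erase 0) (solZero P) (solOne P) (z, ω)‖ ≤
      solConst n τ * ε / (α * σ ^ τ) := by
  rw [mem_phaseDomain hP.r_pos] at hz
  rw [hP.trigHam_sol hω]
  obtain ⟨ω₀, h1, h2⟩ := hω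
  refine ((hP.isStripFun_affinePart ⟨ω₀, h1, h2⟩ hz.1.le).norm_homological_le hα hτ hσ hs hh
    (hD h1) h2 hz.2).trans (le_of_eq ?_)
  rw [solConst]
  ring

theorem divisor_ne_zero_of_mem (hD : D ⊆ diophantineSet n α τ) (hα : 0 < α) (hτ : 0 ≤ τ)
    (hh : h ≤ α / (2 * K ^ (τ + 1))) {ω : CVec n} (hω : ω ∈ complexNhd D h) {k : Fin n → ℤ}
    (hk : k ∈ (intBall n K).erase 0) : divisor k ω ≠ 0 := by
  obtain ⟨ω₀, h1, h2⟩ := hω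
  rw [Finset.mem_erase, mem_intBall] at hk
  exact divisor_ne_zero hτ hα hh (hD h1) h2 hk.1 hk.2

theorem IsBoundedHam.isSmallTrigHam (hP : IsBoundedHam P r s ε (complexNhd D h))
    (hε : 0 ≤ ε) (hD : D ⊆ diophantineSet n α τ) (hα : 0 < α) (hτ : 0 ≤ τ) (hσ : 0 < σ)
    (hs : 2 * σ < s) (hh : h ≤ α / (2 * K ^ (τ + 1)))
    (hsmall : 4 * (solConst n τ * ε / (α * σ ^ τ)) / (r * σ) ≤ 1 / 4) :
    IsSmallTrigHam ((intBall n K).erase 0) (solZero P) (solOne P) (complexNhd D h) r (s - 2 * σ)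
      σ (solConst n τ * ε / (α * σ ^ τ)) where
  r_pos := hP.r_pos
  sigma_pos := hσ
  bound_nonneg := by
    have := solConst_nonneg (n := n) (τ := τ)
    positivity
  small := hsmall
  isOpen := isOpen_complexNhd D h
  analytic_zero ω hω k hk := (hP.analyticAt_coeffZero hω k).fun_div
    (analyticAt_const.fun_mul (analyticAt_divisor k ω))
    (mul_ne_zero Complex.I_ne_zero (divisor_ne_zero_of_mem hD hα hτ hh hω hk))
  analytic_one ω hω k hk := AnalyticAt.pi fun j =>
    ((analyticAt_coord j _).fun_comp (hP.analyticAt_coeffOne hω k)).fun_div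
      (analyticAt_const.fun_mul (analyticAt_divisor k ω))
      (mul_ne_zero Complex.I_ne_zero (divisor_ne_zero_of_mem hD hα hτ hh hω hk))
  bound ω hω z hz := hP.norm_trigHam_sol_le hD hα hτ hσ hs hh hω hz

end Homological

end KAM

/-! ### The transformation as an element of the group, and the new perturbation -/

namespace KAM

open Metric Set Filter Topology
variable {n : ℕ} {S : Finset (Fin n → ℤ)} {A : (Fin n → ℤ) → CVec n → ℂ}
  {B : (Fin n → ℤ) → CVec n → CVec n} {O O' : Set (CVec n)} {r s σ M η : ℝ}
  {Γ : Phase n × CVec n → C(unitInterval, Phase n)}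

/-- The derivative of the solution of `φ + v(φ) = id`. -/
theorem norm_fderiv_freqMap_sub_le {D : Set (Fin n → ℝ)} {h m : ℝ} (hh : 0 < h)
    {φ : CVec n → CVec n} (hφ : AnalyticOnNhd ℂ φ (complexNhd D (h / 2)))
    (hm : ∀ ω ∈ complexNhd D (h / 2), ‖φ ω - ω‖ ≤ m) {ω : CVec n}
    (hω : ω ∈ complexNhd D (h / 4)) :
    h * ‖fderiv ℂ φ ω - ContinuousLinearMap.id ℂ (CVec n)‖ ≤ 8 * m := by
  have hsub : ball ω (h / 4) ⊆ complexNhd D (h / 2) := fun x hx =>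
    complexNhd_mono (by linarith) (mem_complexNhd_of_mem_ball hω hx)
  have hd : ∀ x ∈ ball ω (h / 4), HasFDerivAt (fun x => φ x - x)
      (fderiv ℂ φ x - ContinuousLinearMap.id ℂ (CVec n)) x := fun x hx =>
    (hφ x (hsub hx)).differentiableAt.hasFDerivAt.sub (hasFDerivAt_id x)
  have h1 := norm_fderiv_le_of_norm_le (by linarith : 0 < h / 4)
    (fun x hx => (hd x hx).differentiableAt.differentiableWithinAt) fun x hx => hm x (hsub hx)
  rw [(hd ω (mem_ball_self (by linarith))).fderiv] at h1
  calc _ ≤ h * (2 * m / (h / 4)) := mul_le_mul_of_nonneg_left h1 hh.le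
    _ = 8 * m := by field_simp; ring

theorem IsSmallTrigHam.isHamiltonianOn (h : IsSmallTrigHam S A B O r s σ M)
    (hR : IsRealTrig S A B O) (D : Set (Phase n)) : IsHamiltonianOn (trigHam S A B) D O where
  realAnalytic := ⟨fun p hp => analyticAt_trigHam (h.analytic_zero _ hp.2) (h.analytic_one _ hp.2),
    fun p hp hr => by
      have h1 : star p.1 = p.1 := congrArg Prod.fst hr
      have h2 := hR.star_trigHam hp.2 (congrArg Prod.snd hr) p.1
      rwa [h1] at h2⟩
  periodic I θ ω k _ _ := by
    simp only [trigHam, expChar_add, expChar_angleShift, mul_one]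

theorem affineInAction_trigHam (D : Set (Phase n)) : AffineInAction (trigHam S A B) D O := by
  refine ⟨fun θ ω => ∑ k ∈ S, A k ω * expChar k θ, fun θ ω => actionGrad S B ω θ, ?_⟩
  intro I θ ω _ _
  simp only [trigHam, actionGrad, add_mul, Finset.sum_add_distrib, Finset.sum_mul]
  rw [Finset.sum_comm]
  congr 1
  exact Finset.sum_congr rfl fun j _ => Finset.sum_congr rfl fun k _ => by ring

namespace IsTrigFlow

theorem realAnalyticOn (h : IsSmallTrigHam S A B O r s σ M) (hR : IsRealTrig S A B O)
    (hΓ : IsTrigFlow S A B O r s σ Γ) :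
    RealAnalyticOn (fun p => Γ p 1) (phaseDomain n (r / 4) (s - 2 * σ) ×ˢ O) := by
  refine ⟨fun p hp => analyticAt_clm_comp (hΓ.analytic p hp)
    (ContinuousMap.evalCLM ℂ 1 : C(unitInterval, Phase n) →L[ℂ] Phase n), fun p hp hr => ?_⟩
  exact congrArg (fun γ : C(unitInterval, Phase n) => γ 1)
    (hΓ.star_eq h hR hp.1 hp.2 (congrArg Prod.fst hr) (congrArg Prod.snd hr))

theorem isGroupTransformation (h : IsSmallTrigHam S A B O r s σ M) (hR : IsRealTrig S A B O)
    (hΓ : IsTrigFlow S A B O r s σ Γ) (hη : η ≤ 1 / 8) (hM : 32 * M / (r * σ) < 1)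
    {φ : CVec n → CVec n} (hφ : RealAnalyticOn φ O') (hφO : MapsTo φ O' O) (hφi : InjOn φ O') :
    IsGroupTransformation (coordParamMap (fun p => Γ p 1) φ) (phaseDomain n (η * r) (s - 3 * σ))
      O' := by
  have hr := h.r_pos
  have hσ := h.sigma_pos
  have hsub : phaseDomain n (η * r) (s - 3 * σ) ⊆ phaseDomain n (r / 4) (s - 2 * σ) :=
    phaseDomain_mono (by nlinarith) (by linarith)
  have hΦ := hΓ.realAnalyticOn h hR
  refine ⟨⟨fun p hp => ?_, fun p hp hp' => ?_⟩, ?_, ?_, ?_, ?_⟩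
  · have h1 : AnalyticAt ℂ (fun p : Phase n × CVec n => φ p.2) p :=
      (hφ.1 _ hp.2).fun_comp analyticAt_snd
    exact (AnalyticAt.fun_comp (g := fun p => Γ p 1)
      (f := fun p : Phase n × CVec n => (p.1, φ p.2)) (hΦ.1 _ ⟨hsub hp.1, hφO hp.2⟩)
      (analyticAt_fst.prod h1)).prod h1
  · have h1 : star (φ p.2) = φ p.2 := hφ.2 _ hp.2 (congrArg Prod.snd hp')
    exact Prod.ext (hΦ.2 (p.1, φ p.2) ⟨hsub hp.1, hφO hp.2⟩
      (Prod.ext (congrArg Prod.fst hp' : star p.1 = p.1) h1)) h1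
  · rintro ⟨z, ω⟩ ⟨hz, hω⟩ ⟨w, ω'⟩ ⟨hw, hω'⟩ heq
    have h1 : ω = ω' := hφi hω hω' (congrArg Prod.snd heq)
    subst h1
    exact Prod.ext (hΓ.injOn h hη hM (hφO hω) hz hw (congrArg Prod.fst heq)) rfl
  -- The coefficients of the affine map are the values of the flow at `I = 0` and the difference
  -- quotients at the points `(r / 8) e_j`; the angles may be computed at `I = 0`.
  · refine ⟨fun θ ω => (Γ ((0, θ), φ ω) 1).1, fun θ ω => Matrix.of fun i j => (8 / r : ℂ) *
      ((Γ ((Pi.single j (r / 8 : ℂ), θ), φ ω) 1).1 i - (Γ ((0, θ), φ ω) 1).1 i),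
      fun θ ω => (Γ ((0, θ), φ ω) 1).2, φ, fun I θ ω hz hω => ?_⟩
    have hz' := hsub hz
    have hz0 : ((0 : CVec n), θ) ∈ phaseDomain n (r / 4) (s - 2 * σ) :=
      ⟨fun j => by simpa using hr, hz'.2⟩
    refine Prod.ext (Prod.ext ?_ ?_) rfl
    · refine (congrArg (fun γ : C(unitInterval, CVec n) => γ 1)
        (hΓ.fstCurve_eq h hz' (hφO hω))).trans ?_
      ext i
      simp only [ContinuousMap.add_apply, ContinuousMap.sum_apply, ContinuousMap.smul_apply,
        ContinuousMap.sub_apply, Pi.add_apply, Finset.sum_apply, Pi.smul_apply, Pi.sub_apply,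
        smul_eq_mul, fstCurve_apply, Matrix.mulVec, dotProduct, Matrix.of_apply]
      congr 1
      exact Finset.sum_congr rfl fun j _ => mul_comm _ _
    · exact congrArg (fun γ : C(unitInterval, CVec n) => γ 1)
        (hΓ.sndCurve_eq h hz' hz0 (hφO hω))
  · intro I θ ω k hz hω
    have h1 := congrArg (fun γ : C(unitInterval, Phase n) => γ 1)
      (hΓ.equivariant h (hsub hz) (hφO hω) k)
    have h2 : ((I, θ) : Phase n) + (0, angleShift k) = (I, θ + angleShift k) := by simp
    rw [h2] at h1
    exact Prod.ext h1 (add_zero _).symm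
  · intro z hz ω hω u v
    exact hΓ.symplectic h (hsub hz) (hφO hω) u v

end IsTrigFlow

/-- The transformed Hamiltonian minus its new normal form is a Hamiltonian. -/
theorem IsGroupTransformation.isHamiltonianOn_comp_sub {T : Phase n × CVec n → Phase n × CVec n}
    {D D' : Set (Phase n)} (hT : IsGroupTransformation T D' O') (hmaps : MapsTo T (D' ×ˢ O') (D ×ˢ O))
    {e e' : CVec n → ℂ} {P : Phase n × CVec n → ℂ} (he : RealAnalyticOn e O)
    (he' : RealAnalyticOn e' O') (hP : IsHamiltonianOn P D O) :
    IsHamiltonianOn (fun p => normalForm e (T p) + P (T p) - normalForm e' p) D' O' := by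
  have hN : ∀ {e : CVec n → ℂ} {D : Set (Phase n)} {O : Set (CVec n)}, RealAnalyticOn e O →
      RealAnalyticOn (normalForm e) (D ×ˢ O) := by
    intro e D O he
    refine ⟨fun p hp => ?_, fun p hp hr => ?_⟩
    · refine AnalyticAt.fun_add ((he.1 _ hp.2).fun_comp analyticAt_snd)
        (Finset.analyticAt_fun_sum _ fun j _ => AnalyticAt.fun_mul ?_ ?_)
      · exact (analyticAt_coord j _).fun_comp analyticAt_snd
      · exact (analyticAt_coord j _).fun_comp (analyticAt_fst.fun_comp analyticAt_fst)
    · have h1 : star p.2 = p.2 := congrArg Prod.snd hr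
      have h2 : star p.1.1 = p.1.1 := congrArg (fun q : Phase n × CVec n => q.1.1) hr
      have h3 : ∀ j, star (p.2 j) = p.2 j := fun j => congrFun h1 j
      have h4 : ∀ j, star (p.1.1 j) = p.1.1 j := fun j => congrFun h2 j
      rw [normalForm, star_add, he.2 _ hp.2 h1, star_sum]
      simp only [star_mul', h3, h4]
  refine ⟨⟨fun p hp => ?_, fun p hp hr => ?_⟩, fun I θ ω k hz hω => ?_⟩
  · exact ((((hN he).1 _ (hmaps hp)).fun_comp (hT.realAnalytic.1 p hp)).fun_add
      ((hP.realAnalytic.1 _ (hmaps hp)).fun_comp (hT.realAnalytic.1 p hp))).fun_sub ((hN he').1 p hp)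
  · have h1 := hT.realAnalytic.2 p hp hr
    rw [star_sub, star_add, (hN he).2 _ (hmaps hp) h1, hP.realAnalytic.2 _ (hmaps hp) h1,
      (hN he').2 p hp hr]
  · have h1 := hT.equivariant I θ ω k hz hω
    have h2 : ∀ q : Phase n × CVec n, q ∈ D ×ˢ O → P (q + ((0, angleShift k), 0)) = P q := by
      rintro ⟨⟨J, ψ⟩, ϖ⟩ hq
      have h3 := hP.periodic J ψ ϖ k hq.1 hq.2
      simpa using h3
    have h4 : ∀ q : Phase n × CVec n, normalForm e (q + ((0, angleShift k), 0)) =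
        normalForm e q := by
      intro q
      simp [normalForm]
    rw [h1, h2 _ (hmaps ⟨hz, hω⟩), h4]
    rfl

/-- The estimate of the new perturbation. -/
theorem IsTrigFlow.norm_newPerturbation_le {P : Phase n × CVec n → ℂ} {ε α τ h K sf : ℝ}
    {D : Set (Fin n → ℝ)} (hP : IsBoundedHam P r s ε (complexNhd D h))
    (hD : D ⊆ diophantineSet n α τ) (hα : 0 < α) (hτ : 0 ≤ τ) (hs : 5 * σ < s) (hsf : sf = s - 2 * σ)
    (hh : h ≤ α / (2 * K ^ (τ + 1))) (hKσ : 1 ≤ K * σ) (hK : 1 ≤ K)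
    (hK1 : K ^ n * Real.exp (-(K * σ)) ≤ 1)
    (hF : IsSmallTrigHam ((intBall n K).erase 0) (solZero P) (solOne P) (complexNhd D h) r sf σ M)
    (hΓ : IsTrigFlow ((intBall n K).erase 0) (solZero P) (solOne P) (complexNhd D h) r sf σ Γ)
    (hη : η ≤ 1 / 8) (hMη : 2 * M / σ ≤ η * r) {z : Phase n}
    (hz : z ∈ phaseDomain n (η * r) (sf - 3 * σ)) {ω : CVec n} (hω : ω ∈ complexNhd D h) :
    ‖∑ j, ω j * ((Γ (z, ω) 1).1 j - z.1 j) + P (Γ (z, ω) 1, ω) -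
      (coeffZero P 0 ω + ∑ j, coeffOne P 0 ω j * z.1 j)‖ ≤
      120 * 10 ^ n * (M / (r * σ)) * ε + 16 * η ^ 2 * ε +
        3 * 10 ^ n * (K ^ n * Real.exp (-(K * σ))) * ε := by
  have hr := hF.r_pos
  have hσ := hF.sigma_pos
  have hM := hF.bound_nonneg
  have hε := hP.bound_nonneg hω
  have hηr : 0 ≤ η * r := le_trans (by positivity) hMη
  have hz' : z ∈ phaseDomain n (r / 4) (sf - 2 * σ) :=
    phaseDomain_mono (by nlinarith) (by linarith) hz
  set R : Phase n → ℂ := fun w => trigHam (intBall n K) (coeffZero P) (coeffOne P) (w, ω) with hR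
  set R₀ : Phase n → ℂ := fun w => coeffZero P 0 ω + ∑ j, coeffOne P 0 ω j * w.1 j with hR₀
  set γ := extendCurve (Γ (z, ω)) with hγ
  have hγ0 : γ 0 = z := (extendCurve_coe (Γ (z, ω)) 0).trans (hΓ.apply_zero hz' hω)
  have hγ1 : γ 1 = Γ (z, ω) 1 := extendCurve_coe (Γ (z, ω)) 1
  have hmem : ∀ t, γ t ∈ phaseDomain n (r - 1 / 2 * r) (sf - 1 / 2 * σ) := fun t =>
    phaseDomain_mono (by linarith) (by linarith) (hΓ.mem z hz' ω hω _)
  have hW : ∀ t, ‖weight n r σ (γ t - z)‖ ≤ 2 * (M / (r * σ)) := fun t => by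
    rw [← mul_div_assoc]
    exact hΓ.norm_weight_sub_le hF hz' hω _
  have hRd : ∀ w, DifferentiableAt ℂ R w := fun w =>
    (hasFDerivAt_trigHam (A := coeffZero P) ω w).differentiableAt
  have hR₀d : ∀ w, DifferentiableAt ℂ R₀ w := by
    intro w
    refine (differentiableAt_const _).add (DifferentiableAt.fun_sum fun j _ => ?_)
    exact ((analyticAt_coord j _).differentiableAt.comp w differentiableAt_fst).const_mul _
  have hr2 : 0 < r - 1 / 2 * r := by linarith
  have hε3 : 0 ≤ 6 * 10 ^ n * ε := by positivity
  have hX : 0 ≤ M / (r * σ) := by positivity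
  -- The first bound combines the Lipschitz constant of `R` with the weighted distance of two orbit
  -- points, the second that of `R₀` with the distance from the initial point. Together they give
  -- `96 · 10 ^ n + 24 ≤ 120 · 10 ^ n` times `M / (rσ) * ε`.
  have h1 := norm_linear_add_sub_le (R := R) (R₀ := R₀) (γ := γ)
    (a := 4 * (6 * 10 ^ n * ε) * (4 * (M / (r * σ)))) (b := 4 * (3 * ε) * (2 * (M / (r * σ))))
    (fun t ht => hΓ.hasDerivWithinAt hz' hω ht)
    (fun t _ => by
      refine sum_mul_hamVectorField_trigHam (A := coeffZero P) (B := coeffOne P) ?_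
        (fun k hk => divisor_ne_zero_of_mem hD hα hτ hh hω hk) (fun k => rfl) (fun k j => rfl) _
      rw [mem_intBall]
      simp only [intNorm, Pi.zero_apply, Int.cast_zero, abs_zero, Finset.sum_const_zero]
      linarith)
    (fun t _ => by
      refine (norm_sub_le_weight hr2 hr hσ (by norm_num : (0 : ℝ) < 1 / 2)
        (fun w _ => hRd w) (C := 6 * 10 ^ n * ε) (fun w hw => ?_) (hmem 1) (hmem t)).trans ?_
      · rw [hsf] at hw
        exact hP.norm_trigHam_coeff_le hω hσ (by linarith) hKσ hK hK1 hw
      · have h2 : γ 1 - γ t = (γ 1 - z) - (γ t - z) := by abel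
        have h3 : ‖weight n r σ (γ 1 - γ t)‖ ≤ 4 * (M / (r * σ)) := by
          rw [h2, map_sub]
          exact (norm_sub_le _ _).trans (by linarith [hW 1, hW t])
        calc _ ≤ 2 * (6 * 10 ^ n * ε) / (1 / 2) * (4 * (M / (r * σ))) := by gcongr
          _ = _ := by ring)
    (fun t _ => by
      refine (norm_sub_le_weight hr2 hr hσ (by norm_num : (0 : ℝ) < 1 / 2)
        (fun w _ => hR₀d w) (C := 3 * ε) (fun w hw => ?_) (hmem t) (hmem 0)).trans ?_
      · exact hP.norm_mean_le hω ((mem_phaseDomain hr).1 hw).1.le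
      · rw [hγ0]
        calc _ ≤ 2 * (3 * ε) / (1 / 2) * (2 * (M / (r * σ))) := by gcongr; exact hW t
          _ = _ := by ring)
  rw [hγ0, hγ1] at h1
  set w := Γ (z, ω) 1 with hw
  have hwm : w ∈ phaseDomain n (r / 2) (sf - σ) := hΓ.mem z hz' ω hω 1
  have hw' := (mem_phaseDomain (by linarith : 0 < r / 2)).1 hwm
  -- The flow moves the actions by at most `ηr`, by condition (a); so the Taylor error at the image
  -- point is `4ε (2η)² = 16η²ε`.
  have hw1 : ‖w.1‖ ≤ 2 * η * r := by
    have h2 : w.1 = (w.1 - z.1) + z.1 := by abel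
    have h3 := (hΓ.norm_action_sub_le hF hz' hω 1).trans hMη
    have h4 : ‖z.1‖ ≤ η * r := (pi_norm_le_iff_of_nonneg hηr).2 fun j => (hz.1 j).le
    rw [h2]
    exact (norm_add_le _ _).trans (by linarith)
  have h2 : ‖P (w, ω) - affinePart P ω w.1 w.2‖ ≤ 16 * η ^ 2 * ε := by
    have h3 := hP.norm_sub_affinePart_le (I := w.1) (θ := w.2) (by linarith [hw'.1])
      (strip_mono (by rw [hsf]; linarith) hw'.2) hω
    refine h3.trans ?_
    have h4 : ‖w.1‖ / r ≤ 2 * η := by rw [div_le_iff₀ hr]; exact hw1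
    calc _ ≤ 4 * ε * (2 * η) ^ 2 := by gcongr
      _ = _ := by ring
  have h3 : ‖affinePart P ω w.1 w.2 - R w‖ ≤
      3 * 10 ^ n * (K ^ n * Real.exp (-(K * σ))) * ε :=
    hP.norm_affinePart_sub_trigHam_le hω hσ (by linarith) hKσ hK
      (phaseDomain_mono (by linarith) (by rw [hsf]; linarith) hwm)
  -- Three errors remain: the oscillation along the flow, the Taylor remainder in the actions, and
  -- the Fourier tail.
  have h4 : ∑ j, ω j * (w.1 j - z.1 j) + P (w, ω) - R₀ z =
      (∑ j, ω j * (w.1 j - z.1 j) + R w - R₀ z) + (P (w, ω) - affinePart P ω w.1 w.2) +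
        (affinePart P ω w.1 w.2 - R w) := by ring
  rw [h4]
  refine (norm_add₃_le).trans ?_
  have h5 : (1 : ℝ) ≤ 10 ^ n := one_le_pow₀ (by norm_num)
  have h6 : 0 ≤ M / (r * σ) * ε := by positivity
  nlinarith

end KAM

/-! ### The identity transformation, and the algebra of the new normal form -/

namespace KAM

open Metric Set Filter Topology
variable {n : ℕ}

/-- Used when `Kⁿ e^{-Kσ}` is not small and nothing has to be gained. -/
theorem isGroupTransformation_id (D : Set (Phase n)) (O : Set (CVec n)) :
    IsGroupTransformation (coordParamMap Prod.fst id) D O where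
  realAnalytic := ⟨fun _ _ => analyticAt_id, fun _ _ hz => hz⟩
  injOn _ _ _ _ h := h
  shape := ⟨fun _ _ => 0, fun _ _ => 1, fun θ _ => θ, id, fun I θ ω _ _ => by
    simp [coordParamMap]⟩
  equivariant I θ ω k _ _ := by simp [coordParamMap]
  symplectic z _ ω _ u v := by
    have h : fderiv ℂ (fun w : Phase n => (coordParamMap Prod.fst id (w, ω)).1) z =
        ContinuousLinearMap.id ℂ (Phase n) := fderiv_id
    rw [h]; rfl

theorem isTimeOneMap_zero {D D' : Set (Phase n)} (hD : D ⊆ D') (O : Set (CVec n)) :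
    IsTimeOneMap (fun _ => 0) Prod.fst D D' O := by
  intro z hz ω _
  refine ⟨fun _ => z, rfl, rfl, fun t _ => ⟨hD hz, ?_⟩⟩
  have h : hamVectorField (fun _ => 0) ω z = 0 := by
    refine Prod.ext (funext fun j => ?_) (funext fun j => ?_) <;> simp [hamVectorField]
  rw [h]
  exact hasDerivWithinAt_const _ _ _

/-- The new perturbation is expressed by the change of the linear hamiltonian `⟨ω, I⟩`, if the
frequencies are shifted by the mean value of the action gradient. -/
theorem normalForm_add_sub_eq {P : Phase n × CVec n → ℂ} {e : CVec n → ℂ} {φ : CVec n → CVec n}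
    {Φ : Phase n × CVec n → Phase n} {z : Phase n} {ω : CVec n}
    (hφ : φ ω + coeffOne P 0 (φ ω) = ω) :
    normalForm e (coordParamMap Φ φ (z, ω)) + P (coordParamMap Φ φ (z, ω)) -
      normalForm (fun ω => e (φ ω) + coeffZero P 0 (φ ω)) (z, ω) =
    ∑ j, φ ω j * ((Φ (z, φ ω)).1 j - z.1 j) + P (Φ (z, φ ω), φ ω) -
      (coeffZero P 0 (φ ω) + ∑ j, coeffOne P 0 (φ ω) j * z.1 j) := by
  have h1 : ∑ j, ω j * z.1 j = ∑ j, φ ω j * z.1 j + ∑ j, coeffOne P 0 (φ ω) j * z.1 j := by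
    rw [← Finset.sum_add_distrib]
    refine Finset.sum_congr rfl fun j _ => ?_
    rw [← add_mul]
    exact congrArg (fun v : CVec n => v j * z.1 j) hφ.symm
  simp only [normalForm, coordParamMap, mul_sub, Finset.sum_sub_distrib, h1]
  ring

end KAM

/-! ### The KAM step -/

set_option maxHeartbeats 1000000 in
theorem mainTheorem4 (n : ℕ) (hn : 2 ≤ n) (τ : ℝ) (hτ : (n : ℝ) - 1 < τ) :
    ∃ c : ℝ, 1 ≤ c ∧
      ∀ (Ω : Set (Fin n → ℝ)) (α r s h ε η σ K : ℝ)
        (e : KAM.CVec n → ℂ) (P : KAM.Phase n × KAM.CVec n → ℂ),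
        IsOpen Ω → 0 < α → 0 < r → 0 < s → 0 < h → 0 ≤ ε →
        0 < η → η < 1 / 8 → 0 < σ → σ < s / 5 → 1 ≤ K →
        -- the normal form `N = e(ω) + ⟨ω, I⟩` and the perturbation `P` are real analytic
        KAM.RealAnalyticOn e (KAM.complexNhd (KAM.frequencySet Ω α τ) h) →
        KAM.IsHamiltonianOn P (KAM.phaseDomain n r s)
          (KAM.complexNhd (KAM.frequencySet Ω α τ) h) →
        (∀ z ∈ KAM.phaseDomain n r s, ∀ ω ∈ KAM.complexNhd (KAM.frequencySet Ω α τ) h,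
          ‖P (z, ω)‖ ≤ ε) →
        -- the smallness assumptions (a), (b), (c)
        c * ε ≤ α * η * r * σ ^ (τ + 1) →
        c * ε ≤ h * r →
        h ≤ α / (2 * K ^ (τ + 1)) →
        ∃ (F : KAM.Phase n × KAM.CVec n → ℂ)
          (Φ : KAM.Phase n × KAM.CVec n → KAM.Phase n)
          (φ : KAM.CVec n → KAM.CVec n)
          (e' : KAM.CVec n → ℂ) (P' : KAM.Phase n × KAM.CVec n → ℂ),
          -- `Φ` is the time-1-map of a real analytic hamiltonian `F` that is affine in `I`
          KAM.IsHamiltonianOn F (KAM.phaseDomain n (r / 2) (s - 3 * σ))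
            (KAM.complexNhd (KAM.frequencySet Ω α τ) h) ∧
          KAM.AffineInAction F (KAM.phaseDomain n (r / 2) (s - 3 * σ))
            (KAM.complexNhd (KAM.frequencySet Ω α τ) h) ∧
          KAM.IsTimeOneMap F Φ (KAM.phaseDomain n (η * r) (s - 5 * σ))
            (KAM.phaseDomain n (r / 2) (s - 3 * σ))
            (KAM.complexNhd (KAM.frequencySet Ω α τ) h) ∧
          KAM.RealAnalyticOn Φ (KAM.phaseDomain n (η * r) (s - 5 * σ) ×ˢ
            KAM.complexNhd (KAM.frequencySet Ω α τ) h) ∧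
          KAM.RealAnalyticOn φ (KAM.complexNhd (KAM.frequencySet Ω α τ) (h / 4)) ∧
          -- the transformation belongs to the group and maps between the stated domains
          KAM.IsGroupTransformation (KAM.coordParamMap Φ φ)
            (KAM.phaseDomain n (η * r) (s - 5 * σ))
            (KAM.complexNhd (KAM.frequencySet Ω α τ) (h / 4)) ∧
          Set.MapsTo (KAM.coordParamMap Φ φ)
            (KAM.phaseDomain n (η * r) (s - 5 * σ) ×ˢ
              KAM.complexNhd (KAM.frequencySet Ω α τ) (h / 4))
            (KAM.phaseDomain n r s ×ˢ KAM.complexNhd (KAM.frequencySet Ω α τ) h) ∧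
          -- the new normal form and the new perturbation
          KAM.RealAnalyticOn e' (KAM.complexNhd (KAM.frequencySet Ω α τ) (h / 4)) ∧
          KAM.IsHamiltonianOn P' (KAM.phaseDomain n (η * r) (s - 5 * σ))
            (KAM.complexNhd (KAM.frequencySet Ω α τ) (h / 4)) ∧
          (∀ z ∈ KAM.phaseDomain n (η * r) (s - 5 * σ),
            ∀ ω ∈ KAM.complexNhd (KAM.frequencySet Ω α τ) (h / 4),
              KAM.normalForm e (KAM.coordParamMap Φ φ (z, ω)) +
                  P (KAM.coordParamMap Φ φ (z, ω)) =
                KAM.normalForm e' (z, ω) + P' (z, ω)) ∧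
          (∀ z ∈ KAM.phaseDomain n (η * r) (s - 5 * σ),
            ∀ ω ∈ KAM.complexNhd (KAM.frequencySet Ω α τ) (h / 4),
              ‖P' (z, ω)‖ ≤ c * (ε ^ 2 / (α * r * σ ^ (τ + 1)) +
                (η ^ 2 + K ^ n * Real.exp (-(K * σ))) * ε)) ∧
          -- the weighted estimates of `Φ`
          (∀ z ∈ KAM.phaseDomain n (η * r) (s - 5 * σ),
            ∀ ω ∈ KAM.complexNhd (KAM.frequencySet Ω α τ) h,
              ‖KAM.weight n r σ (Φ (z, ω) - z)‖ ≤ c * (ε / (α * r * σ ^ (τ + 1))) ∧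
              ‖(KAM.weight n r σ).comp
                  ((fderiv ℂ (fun w : KAM.Phase n => Φ (w, ω)) z -
                      ContinuousLinearMap.id ℂ (KAM.Phase n)).comp
                    (KAM.weight n r⁻¹ σ⁻¹))‖ ≤ c * (ε / (α * r * σ ^ (τ + 1)))) ∧
          -- the estimates of `φ`
          (∀ ω ∈ KAM.complexNhd (KAM.frequencySet Ω α τ) (h / 4),
              ‖φ ω - ω‖ ≤ c * (ε / r) ∧
              h * ‖fderiv ℂ φ ω - ContinuousLinearMap.id ℂ (KAM.CVec n)‖ ≤ c * (ε / r)) := by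
  open KAM Set in
  have hτ0 : 0 ≤ τ := by
    have : (2 : ℝ) ≤ n := by exact_mod_cast hn
    linarith
  have hC0 := solConst_nonneg (n := n) (τ := τ)
  set C := solConst n τ with hC
  have h10 : (1 : ℝ) ≤ 10 ^ n := one_le_pow₀ (by norm_num)
  -- The summand 64 serves the frequency map, the Taylor term and the trivial case; `120 * 10 ^ n *
  -- C` serves the quadratic error and the smallness of the flow; the extra `120 * 10 ^ n` covers
  -- the Fourier tail.
  refine ⟨64 + 120 * 10 ^ n * (C + 1), by nlinarith, ?_⟩
  set c := 64 + 120 * 10 ^ n * (C + 1) with hc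
  have hc64 : 64 ≤ c := by nlinarith
  have hcC : 120 * C ≤ c := by nlinarith
  have hc10 : 120 * 10 ^ n * C ≤ c := by nlinarith
  have hc3 : 3 * 10 ^ n ≤ c := by nlinarith
  intro Ω α r s h ε η σ K e P hΩ hα hr hs hh hε hη hη8 hσ hσs hK he hP hPε hca hcb hcc
  set D := frequencySet Ω α τ with hD
  have hDd : D ⊆ diophantineSet n α τ := fun ω hω => hω.2.1
  have hστ : 0 < σ ^ (τ + 1) := Real.rpow_pos_of_pos hσ _
  have hden : 0 < α * r * σ ^ (τ + 1) := by positivity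
  have hX0 : 0 ≤ ε / (α * r * σ ^ (τ + 1)) := by positivity
  -- This is condition (a) in the form in which it controls the flow: weighted displacements are at
  -- most a small multiple of `η`.
  have hcX : c * (ε / (α * r * σ ^ (τ + 1))) ≤ η := by
    rw [← mul_div_assoc, div_le_iff₀ hden]
    linarith
  have hO2 : complexNhd D (h / 4) ⊆ complexNhd D (h / 2) := complexNhd_mono (by linarith)
  have hO1 : complexNhd D (h / 4) ⊆ complexNhd D h := complexNhd_mono (by linarith)
  have hε2 : 0 ≤ ε ^ 2 / (α * r * σ ^ (τ + 1)) := by positivity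
  -- In the first case `c * (Kⁿ e^{-Kσ}) ≥ 1`, so the original perturbation already satisfies the
  -- required bound and the identity is taken.
  rcases le_or_gt (Real.exp (-1)) (K ^ n * Real.exp (-(K * σ))) with hE | hE
  · have hsub : phaseDomain n (η * r) (s - 5 * σ) ⊆ phaseDomain n r s :=
      phaseDomain_mono (by nlinarith) (by linarith)
    refine ⟨fun _ => 0, Prod.fst, id, e, P,
      ⟨⟨fun _ _ => analyticAt_const, fun _ _ _ => star_zero _⟩, fun _ _ _ _ _ _ => rfl⟩,
      ⟨fun _ _ => 0, fun _ _ => 0, fun _ _ _ _ _ => by simp⟩,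
      isTimeOneMap_zero (phaseDomain_mono (by nlinarith) (by linarith)) _,
      ⟨fun _ _ => analyticAt_fst, fun _ _ hz => congrArg Prod.fst hz⟩,
      ⟨fun _ _ => analyticAt_id, fun _ _ hz => hz⟩, isGroupTransformation_id _ _,
      fun p hp => ⟨hsub hp.1, hO1 hp.2⟩,
      ⟨he.1.mono hO1, fun z hz => he.2 z (hO1 hz)⟩,
      ⟨⟨hP.realAnalytic.1.mono (prod_mono hsub hO1),
        fun z hz => hP.realAnalytic.2 z (prod_mono hsub hO1 hz)⟩,
        fun I θ ω k hz hω => hP.periodic I θ ω k (hsub hz) (hO1 hω)⟩,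
      fun _ _ _ _ => rfl, fun z hz ω hω => ?_, fun z _ ω _ => ⟨?_, ?_⟩, fun ω _ => ⟨?_, ?_⟩⟩
    · have h1 : (1 : ℝ) ≤ c * (K ^ n * Real.exp (-(K * σ))) := by
        have h2 : (1 : ℝ) / 64 ≤ Real.exp (-1) := by
          rw [Real.exp_neg, ← one_div]
          exact one_div_le_one_div_of_le (Real.exp_pos 1) (by linarith [Real.exp_one_lt_d9])
        have h3 : c * Real.exp (-1) ≤ c * (K ^ n * Real.exp (-(K * σ))) := by gcongr
        nlinarith
      refine (hPε z (hsub hz) ω (hO1 hω)).trans ?_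
      have h2 : 0 ≤ c * (ε ^ 2 / (α * r * σ ^ (τ + 1)) + η ^ 2 * ε) := by positivity
      nlinarith
    · rw [sub_self, map_zero, norm_zero]
      positivity
    · have h1 : fderiv ℂ (fun w : Phase n => ((w, ω) : Phase n × CVec n).1) z =
          ContinuousLinearMap.id ℂ (Phase n) := fderiv_id
      rw [h1, sub_self, ContinuousLinearMap.zero_comp, ContinuousLinearMap.comp_zero, norm_zero]
      positivity
    · rw [id, sub_self, norm_zero]
      positivity
    · rw [fderiv_id, sub_self, norm_zero, mul_zero]
      positivity
  · have hKn : 1 ≤ K ^ n := one_le_pow₀ hK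
    have hE1 : K ^ n * Real.exp (-(K * σ)) ≤ 1 :=
      hE.le.trans (Real.exp_le_one_iff.2 (by norm_num))
    -- As `Kⁿ ≥ 1`, the smallness of the product forces `e^{-Kσ} < e^{-1}`.
    have hKσ : 1 ≤ K * σ := by
      have h1 : Real.exp (-(K * σ)) < Real.exp (-1) :=
        (le_mul_of_one_le_left (Real.exp_pos _).le hKn).trans_lt hE
      linarith [Real.exp_lt_exp.1 h1]
    have hB : IsBoundedHam P r s ε (complexNhd D h) := ⟨hr, hs, isOpen_complexNhd D h, hP, hPε⟩
    -- Dividing by `rσ`, as the weights do, turns the exponent `τ` into `ν = τ + 1`.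
    have hMX : C * ε / (α * σ ^ τ) / (r * σ) = C * (ε / (α * r * σ ^ (τ + 1))) := by
      rw [Real.rpow_add_one hσ.ne']
      have := Real.rpow_pos_of_pos hσ τ
      field_simp
    set M := C * ε / (α * σ ^ τ) with hM
    set X := ε / (α * r * σ ^ (τ + 1)) with hX
    have hCX : 120 * (C * X) ≤ c * X := by
      rw [← mul_assoc]
      gcongr
    have hCX0 : 0 ≤ C * X := by positivity
    have hηr : η * r ≤ 1 / 8 * r := by gcongr
    have hsm : ∀ a : ℝ, a * M / (r * σ) = a * (C * X) := fun a => by rw [mul_div_assoc, hMX]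
    have hF := hB.isSmallTrigHam hε hDd hα hτ0 hσ (by linarith) hcc (by rw [hsm]; linarith)
    obtain ⟨Γ, hΓ⟩ := hF.exists_flow
    have hR := hB.isRealTrig_sol K
    have hM32 : 32 * M / (r * σ) < 1 := by rw [hsm]; linarith
    have hMη : 2 * M / σ ≤ η * r := by
      have h1 : 2 * M / σ = 2 * M / (r * σ) * r := by field_simp
      rw [h1, hsm]
      gcongr
      linarith
    have hcεh : c * (ε / r) ≤ h := by
      rw [← mul_div_assoc, div_le_iff₀ hr]
      exact hcb
    have hεr : 0 ≤ ε / r := by positivity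
    have hεc : 64 * (ε / r) ≤ c * (ε / r) := by gcongr
    -- The shift is the mean of the action gradient of `P`, of size at most `2ε / r`. Condition (b)
    -- and `c ≥ 64` give the required `32 · 2ε / r ≤ h`. The map is obtained on the `h /
    -- 2`-neighbourhood, which leaves room for the Cauchy estimate of its derivative at `h / 4`.
    obtain ⟨φ, hφa, hφ⟩ := exists_freqMap (D := D) (m := 2 * ε / r) hh (by positivity)
      (by rw [mul_div_assoc]; linarith) (fun ω hω => hB.analyticAt_coeffOne hω 0)
      (fun ω hω => hB.norm_coeffOne_zero_le hω)
      (fun ω hω hω' => by simpa using (hB.coeffOne_neg hω hω' 0).symm)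
    have hφm : ∀ ω ∈ complexNhd D (h / 2), ‖φ ω - ω‖ ≤ 2 * ε / r := by
      intro ω hω
      have h1 : φ ω - ω = -coeffOne P 0 (φ ω) := by
        have h2 := eq_sub_of_add_eq (hφ ω hω).2.1
        rw [sub_eq_iff_eq_add, neg_add_eq_sub]
        exact h2
      rw [h1, norm_neg]
      exact hB.norm_coeffOne_zero_le (hφ ω hω).1
    have hφi : InjOn φ (complexNhd D (h / 4)) := by
      intro ω hω ω' hω' heq
      rw [← (hφ ω (hO2 hω)).2.1, ← (hφ ω' (hO2 hω')).2.1, heq]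
    have hφR : RealAnalyticOn φ (complexNhd D (h / 4)) :=
      ⟨hφa.mono hO2, fun ω hω hr => (hφ ω (hO2 hω)).2.2 hr⟩
    have hφO : MapsTo φ (complexNhd D (h / 4)) (complexNhd D h) := fun ω hω => (hφ ω (hO2 hω)).1
    -- The generator is bounded on the strip of width `s - 2σ`. Its orbits need one more `σ`, the
    -- initial values two, and the estimate of the Jacobian three.
    have hs5 : s - 5 * σ = s - 2 * σ - 3 * σ := by ring
    have hs3 : s - 3 * σ = s - 2 * σ - σ := by ring
    rw [hs5, hs3]
    have hsub : phaseDomain n (η * r) (s - 2 * σ - 3 * σ) ⊆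
        phaseDomain n (r / 4) (s - 2 * σ - 2 * σ) :=
      phaseDomain_mono (by linarith) (by linarith)
    have hT := hΓ.isGroupTransformation hF hR hη8.le hM32 hφR hφO hφi
    have hmaps : MapsTo (coordParamMap (fun p => Γ p 1) φ)
        (phaseDomain n (η * r) (s - 2 * σ - 3 * σ) ×ˢ complexNhd D (h / 4))
        (phaseDomain n r s ×ˢ complexNhd D h) := fun p hp =>
      ⟨phaseDomain_mono (by linarith) (by linarith)
        (hΓ.mem p.1 (hsub hp.1) (φ p.2) (hφO hp.2) 1), hφO hp.2⟩
    have he' : RealAnalyticOn (fun ω => e (φ ω) + coeffZero P 0 (φ ω)) (complexNhd D (h / 4)) := by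
      refine ⟨fun ω hω => ((he.1 _ (hφO hω)).fun_comp (hφR.1 ω hω)).fun_add
        ((hB.analyticAt_coeffZero (hφO hω) 0).fun_comp (hφR.1 ω hω)), fun ω hω hr => ?_⟩
      have h1 := hφR.2 ω hω hr
      have h2 := hB.coeffZero_neg (hφO hω) h1 0
      rw [neg_zero] at h2
      rw [star_add, he.2 _ (hφO hω) h1, ← h2]
    have hΦ := hΓ.realAnalyticOn hF hR
    refine ⟨trigHam ((intBall n K).erase 0) (solZero P) (solOne P), fun p => Γ p 1, φ,
      fun ω => e (φ ω) + coeffZero P 0 (φ ω), _, hF.isHamiltonianOn hR _,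
      affineInAction_trigHam _, fun z hz => hΓ.isTimeOneMap z (hsub hz),
      ⟨hΦ.1.mono (prod_mono hsub subset_rfl), fun p hp => hΦ.2 p ⟨hsub hp.1, hp.2⟩⟩,
      hφR, hT, hmaps, he', hT.isHamiltonianOn_comp_sub hmaps he he' hP,
      fun z hz ω hω => (add_sub_cancel _ _).symm, fun z hz ω hω => ?_,
      fun z hz ω hω => ⟨?_, ?_⟩, fun ω hω => ⟨?_, ?_⟩⟩
    · rw [normalForm_add_sub_eq (hφ ω (hO2 hω)).2.1]
      refine (IsTrigFlow.norm_newPerturbation_le hB hDd hα hτ0 (by linarith) rfl hcc hKσ hK hE1 hF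
        hΓ hη8.le hMη hz (hφO hω)).trans ?_
      rw [hMX]
      have h1 : ε ^ 2 / (α * r * σ ^ (τ + 1)) = X * ε := by rw [hX]; ring
      have h2 : 120 * 10 ^ n * C * (X * ε) ≤ c * (X * ε) := by gcongr
      have h3 : 16 * (η ^ 2 * ε) ≤ c * (η ^ 2 * ε) := by
        gcongr
        linarith
      have h4 : 3 * 10 ^ n * (K ^ n * Real.exp (-(K * σ)) * ε) ≤
          c * (K ^ n * Real.exp (-(K * σ)) * ε) := by gcongr
      rw [h1]
      linarith
    · refine (hΓ.norm_weight_sub_le hF (hsub hz) hω 1).trans ?_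
      rw [hsm]
      linarith
    · refine (hΓ.norm_weight_fderiv_le hF hη8.le hz hω).trans ?_
      rw [hsm]
      linarith
    · refine (hφm ω (hO2 hω)).trans ?_
      rw [mul_div_assoc]
      gcongr
      linarith
    · refine (norm_fderiv_freqMap_sub_le hh hφa hφm hω).trans ?_
      rw [mul_div_assoc, ← mul_assoc]
      gcongr
      linarith
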